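/- **Setting.** Let $d\ge 1$, $\sigma>0$, let $\mathcal X\subset\mathbb R^d$ be a nonempty compact set of arms with $\|x\|_2\le 1$ for all $x\in\mathcal X$, and let $\theta^*\in\mathbb R^d$ satisfy $\|\theta^*\|_2\le 1$ and $\langle x,\theta^*\rangle\ge 0$ for all $x\in\mathcal X$. In each round $t=1,\dots,T$ a learner picks an arm $x_t\in\mathcal X$ and observes a reward $r_t$ which, given the past and $x_t$, has mean $\langle x_t,\theta^*\rangle$ and is $\sigma$-sub-Gaussian: $\mathbb E[\exp(\zeta(r_t-\langle x_t,\theta^*\rangle))\mid \text{past},x_t]\le \exp(\sigma^2\zeta^2/2)$ for all $\zeta\in\mathbb R$. The Nash regret is $$\mathrm{NR}_T=\max_{x\in\mathcal X}\langle x,\theta^*\rangle-\Big(\prod_{t=1}^T\mathbb E[\langle x_t,\theta^*\rangle]\Big)^{1/T}.$$ **Ingredients.** For a probability distribution $\lambda$ with finite support in a set $S$ of arms let $U(\lambda)=\sum_x\lambda_x xx^\top$. A D-optimal design on $S$ is a $\lambda$ that maximizes $\det U(\lambda)$ (the determinant being taken on $\mathrm{span}(S)$) and has at most $d(d+1)/2$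 support points. Let $\lambda^*$ be a D-optimal design on $\mathcal X$. Let $\rho$ be a distribution on at most $d+1$ arms whose mean is the center of the John ellipsoid of $\mathrm{conv}(\mathcal X)$, the ellipsoid of largest volume contained in $\mathrm{conv}(\mathcal X)$ (relative to the affine hull). For $V=\sum x_ix_i^\top$ and $s=\sum r_ix_i$ over a set of rounds, the least squares estimate is $\hat\theta=V^{-1}s$ (the solution of $V\theta=s$ of least norm if $V$ is singular, and $0$ if there are no rounds yet). **FairLinBandit, Phase I.** Phase I consists of consecutive epochs of lengths $n=2^k\lceil 72\log T\rceil$, $k=0,1,2,\dots$. In each round of an epoch a fair coin is flipped. If it shows $D$, the next arm in round robin order over the still available support points of $\lambda^*$ is pulled; an arm $z$ is available until it has been pulled $\lceil\lambda^*_z n/3\rceil$ times in this way during the epoch. If it shows $U$, or if no arm is available, an arm is drawn from $\rho$. Before each epoch, with $t-1$ the number of past rounds, $\hat\theta$ the least squares estimate from all of them and $m=\max_{x\in\mathcal X}\langle x,\hat\theta\rangle$, a new epoch is started if $$t\le\frac{48\sigma^2d^2\log T}{m^2}\qquad\text{or}\qquad t\le\frac{900\,\sigma^2d^2\log T}{\big(m-\sqrt{48\sigma^2d^2\log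 T/t}\,\big)^2}$$ (a quotient with denominator $0$ being $+\infty$); otherwise Phase I ends. Let $\tau$ be the number of its rounds. Phase II takes up the remaining rounds; all pulling stops after round $T$. **Phase II, LinUCB with regularizer $\alpha>0$.** In each round $t>\tau$, with $\overline V_{t-1}=\alpha I_d+\sum_{i<t}x_ix_i^\top$ and $\hat\theta_{t-1}=\overline V_{t-1}^{-1}\sum_{i<t}r_ix_i$, pull an arm maximizing $\langle x,\hat\theta_{t-1}\rangle+\beta_{t-1}\sqrt{x^\top\overline V_{t-1}^{-1}x}$ over $x\in\mathcal X$, where $\beta_{t-1}=\sigma\sqrt{d\log(1+\frac{t-1}{d\alpha})+2\log T}+\sqrt\alpha$. **Phase II, LinPE.** Put $T'=\frac23\tau$ and let $\widetilde{\mathcal X}$ be the set of $x\in\mathcal X$ with $\langle x,\hat\theta\rangle\ge\max_{z\in\mathcal X}\langle z,\hat\theta\rangle-8\sqrt{d^2\sigma^2\log T/\tau}$, where $\hat\theta$ is the estimate at the end of Phase I. Repeat: take a D-optimal design $\lambda$ on $\widetilde{\mathcal X}$; pull each arm $a$ of its support for $\lceil\lambda_aT'\rceil$ successive rounds; compute the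 least squares estimate $\hat\theta$ from the rounds of this episode only; replace $\widetilde{\mathcal X}$ by the set of $x\in\widetilde{\mathcal X}$ with $\langle x,\hat\theta\rangle\ge\max_{z\in\widetilde{\mathcal X}}\langle z,\hat\theta\rangle-8\sqrt{d^2\sigma^2\log T/T'}$; replace $T'$ by $2T'$. **Theorem.** There is an absolute constant $C>0$ such that for all $d\ge1$, $\sigma>0$ and $0<\alpha_0\le\alpha_1$ there is a $T_0$, depending on these four numbers only, such that for every horizon $T\ge T_0$ and all $\mathcal X$ and $\theta^*$ as above, FairLinBandit, run with LinPE or with LinUCB with any regularizer $\alpha\in[\alpha_0,\alpha_1]$ in Phase II, has Nash regret $$\mathrm{NR}_T\le C\,\frac{\sigma d\log T}{\sqrt T}.$$ -/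

import Mathlib

open MeasureTheory ProbabilityTheory
open scoped Matrix

noncomputable section

namespace FairLinBandit

/-- Vectors of `ℝ^d`. Lengths are always measured by `euclNorm`. -/
abbrev Vec (d : ℕ) : Type := Fin d → ℝ

/-- The Euclidean norm `‖x‖₂`. -/
def euclNorm {d : ℕ} (x : Vec d) : ℝ := √(x ⬝ᵥ x)

/-- The weighted norm `‖x‖_A = √(xᵀ A x)`. -/
def weightedNorm {d : ℕ} (A : Matrix (Fin d) (Fin d) ℝ) (x : Vec d) : ℝ :=
  √(x ⬝ᵥ (A *ᵥ x))

/-- `max_{x ∈ S} ⟨x, θ⟩` (the supremum is attained for nonempty compact `S`). -/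
def maxReward {d : ℕ} (S : Set (Vec d)) (θ : Vec d) : ℝ :=
  sSup ((fun x => x ⬝ᵥ θ) '' S)

/-! ### Designs -/

/-- `l` is a (finitely supported) probability distribution on `S`. -/
structure IsDesign {d : ℕ} (S : Set (Vec d)) (l : Vec d →₀ ℝ) : Prop where
  nonneg : ∀ z, 0 ≤ l z
  mem : ∀ z ∈ l.support, z ∈ S
  sum_one : (l.sum fun _ w => w) = 1

/-- The design matrix `U(l) = ∑ₓ l(x) x xᵀ`. -/
def designMatrix {d : ℕ} (l : Vec d →₀ ℝ) : Matrix (Fin d) (Fin d) ℝ :=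
  l.sum fun x w => w • Matrix.vecMulVec x x

/-- `l` is a D-optimal design on `S` with at most `d(d+1)/2` support points.

If `S` spans `ℝ^d`, this says that `l` maximizes `det U(l)`. If `S` spans a proper subspace `W`
of dimension `k`, the determinant is that of the design matrix read in linear coordinates of `W`:
a matrix `B` of size `d × k` gives the map `x ↦ Bᵀ x`; if it is injective on `W`,
another choice of `B` multiplies all determinants by one positive constant, and if it is not,
both sides of the inequality are `0`. -/
structure IsDOptimal {d : ℕ} (S : Set (Vec d)) (l : Vec d →₀ ℝ) : Prop where
  design : IsDesign S l
  card_le : l.support.card ≤ d * (d + 1) / 2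
  optimal : ∀ l' : Vec d →₀ ℝ, IsDesign S l' →
    ∀ B : Matrix (Fin d) (Fin (Module.finrank ℝ (Submodule.span ℝ S))) ℝ,
      (Bᵀ * designMatrix l' * B).det ≤ (Bᵀ * designMatrix l * B).det

/-- A subroutine that returns a D-optimal design for each nonempty compact set of arms. -/
def IsDesignOracle {d : ℕ} (X : Set (Vec d)) (D : Set (Vec d) → (Vec d →₀ ℝ)) : Prop :=
  ∀ S : Set (Vec d), S ⊆ X → S.Nonempty → IsCompact S → IsDOptimal S (D S)

/-- A subroutine that lists the points of each finite set in some order, without repetition. -/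
def IsEnumeration {d : ℕ} (order : Finset (Vec d) → List (Vec d)) : Prop :=
  ∀ s : Finset (Vec d), (order s).Nodup ∧ ∀ z, z ∈ order s ↔ z ∈ s

/-- The ellipsoid `{c + A u : ‖u‖₂ ≤ 1}`. -/
def ellipsoid {d k : ℕ} (c : Vec d) (A : Matrix (Fin d) (Fin k) ℝ) : Set (Vec d) :=
  {z | ∃ u : Vec k, euclNorm u ≤ 1 ∧ z = c + A *ᵥ u}

/-- `c` is the center of the John ellipsoid of `conv X`: the ellipsoid of largest volume contained
in `conv X`, where volume is `k`-dimensional volume and `k` is the dimension of `conv X`. The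
`k`-dimensional volume of `ellipsoid c A` is a constant times `√det(Aᵀ A)`. -/
def IsJohnCenter {d : ℕ} (X : Set (Vec d)) (c : Vec d) : Prop :=
  ∃ A : Matrix (Fin d) (Fin (Module.finrank ℝ (vectorSpan ℝ X))) ℝ,
    ellipsoid c A ⊆ convexHull ℝ X ∧
    ∀ (c' : Vec d) (A' : Matrix (Fin d) (Fin (Module.finrank ℝ (vectorSpan ℝ X))) ℝ),
      ellipsoid c' A' ⊆ convexHull ℝ X → (A'ᵀ * A').det ≤ (Aᵀ * A).det

/-- A distribution on at most `d + 1` arms whose mean is the center of the John ellipsoid. -/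
structure IsJohnDistribution {d : ℕ} (X : Set (Vec d)) (ρ : Vec d →₀ ℝ) : Prop where
  design : IsDesign X ρ
  card_le : ρ.support.card ≤ d + 1
  mean : IsJohnCenter X (ρ.sum fun x w => w • x)

/-! ### Statistics of a trajectory

Rounds are numbered `0, 1, 2, …`; round `i` is time step `i + 1`. -/

/-- `∑ xᵢ xᵢᵀ` over the rounds `m ≤ i < n`. -/
def gramMatrix {d : ℕ} (arm : ℕ → Vec d) (m n : ℕ) : Matrix (Fin d) (Fin d) ℝ :=
  ∑ i ∈ Finset.Ico m n, Matrix.vecMulVec (arm i) (arm i)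

/-- `∑ rᵢ xᵢ` over the rounds `m ≤ i < n`. -/
def responseSum {d : ℕ} (arm : ℕ → Vec d) (reward : ℕ → ℝ) (m n : ℕ) : Vec d :=
  ∑ i ∈ Finset.Ico m n, reward i • arm i

/-- The least squares estimate `V⁻¹ s`. If `V` is singular, this is the solution of `V θ = s` of
least norm, that is, the unique solution in the range of the symmetric matrix `V`. -/
def leastSquares {d : ℕ} (V : Matrix (Fin d) (Fin d) ℝ) (s : Vec d) : Vec d :=
  Classical.epsilon fun θ => V *ᵥ θ = s ∧ θ ∈ LinearMap.range V.mulVecLin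

/-- The least squares estimate from the rounds `m ≤ i < n`. -/
def estimate {d : ℕ} (arm : ℕ → Vec d) (reward : ℕ → ℝ) (m n : ℕ) : Vec d :=
  leastSquares (gramMatrix arm m n) (responseSum arm reward m n)

/-! ### Phase I -/

/-- Length of the `k`-th call of `PullArms`, `2ᵏ ⌈72 log T⌉`. -/
def epochLength (T k : ℕ) : ℕ := 2 ^ k * ⌈72 * Real.log T⌉₊

/-- Number of rounds before the `k`-th call of `PullArms`. -/
def epochStart (T k : ℕ) : ℕ := ∑ j ∈ Finset.range k, epochLength T j

/-- The round robin queue of `PullArms`: the arms that are still available, each with the number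
of its remaining pulls. At the start arm `z` has `⌈l(z) n / 3⌉` pulls. -/
def initialQueue {d : ℕ} (order : Finset (Vec d) → List (Vec d)) (l : Vec d →₀ ℝ) (n : ℕ) :
    List (Vec d × ℕ) :=
  (order l.support).map fun z => (z, ⌈l z * n / 3⌉₊)

/-- One round robin pull: the first arm of the queue goes to the end, or leaves the queue if this
was its last pull. -/
def serveQueue {d : ℕ} : List (Vec d × ℕ) → List (Vec d × ℕ)
  | [] => []
  | (z, c) :: q => if c ≤ 1 then q else q ++ [(z, c - 1)]

/-- The queue after `j` rounds of a call of `PullArms` that starts in round `start` and has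
length `n`. The flag `true` stands for `D` and `false` for `U`. -/
def queueAfter {d : ℕ} (order : Finset (Vec d) → List (Vec d)) (l : Vec d →₀ ℝ) (n : ℕ)
    (flag : ℕ → Bool) (start : ℕ) : ℕ → List (Vec d × ℕ)
  | 0 => initialQueue order l n
  | j + 1 =>
    if flag (start + j) then serveQueue (queueAfter order l n flag start j)
    else queueAfter order l n flag start j

/-- The arm pulled by `PullArms` when the flag is `f`, the queue is `q`, and the arm drawn from
the John ellipsoid distribution is `u`. -/
def pulledArm {d : ℕ} (f : Bool) (u : Vec d) (q : List (Vec d × ℕ)) : Vec d :=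
  match f, q with
  | true, (z, _) :: _ => z
  | _, _ => u

/-- Phase I goes on after its first `n` rounds, that is, at `t = n + 1`: with
`m = max_{x ∈ X} ⟨x, θ̂⟩`,
`t ≤ 48 σ² d² log T / m²` or `t ≤ 900 σ² d² log T / (m - √(48 σ² d² log T / t))²`
(a quotient with denominator `0` counts as `+∞`). -/
def PhaseOneContinues {d : ℕ} (X : Set (Vec d)) (σ : ℝ) (T : ℕ)
    (arm : ℕ → Vec d) (reward : ℕ → ℝ) (n : ℕ) : Prop :=
  let t : ℝ := n + 1
  let m : ℝ := maxReward X (estimate arm reward 0 n)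
  t * m ^ 2 ≤ 48 * σ ^ 2 * d ^ 2 * Real.log T ∨
    t * (m - √(48 * σ ^ 2 * d ^ 2 * Real.log T / t)) ^ 2 ≤ 900 * σ ^ 2 * d ^ 2 * Real.log T

/-! ### Phase II: LinUCB -/

/-- The upper confidence bound of arm `z` after `n` rounds. -/
def ucbIndex {d : ℕ} (σ α : ℝ) (T : ℕ) (arm : ℕ → Vec d) (reward : ℕ → ℝ) (n : ℕ)
    (z : Vec d) : ℝ :=
  let W : Matrix (Fin d) (Fin d) ℝ := (gramMatrix arm 0 n + α • 1)⁻¹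
  let β : ℝ := σ * √(d * Real.log (1 + n / (d * α)) + 2 * Real.log T) + √α
  z ⬝ᵥ (W *ᵥ responseSum arm reward 0 n) + β * weightedNorm W z

/-- From round `τ` on, the arms are pulled by LinUCB with regularizer `α`. -/
def FollowsLinUCB {d : ℕ} (X : Set (Vec d)) (σ α : ℝ) (T τ : ℕ)
    (arm : ℕ → Vec d) (reward : ℕ → ℝ) : Prop :=
  ∀ i, τ ≤ i → i < T → arm i ∈ X ∧
    ∀ z ∈ X, ucbIndex σ α T arm reward i z ≤ ucbIndex σ α T arm reward i (arm i)

/-! ### Phase II: LinPE -/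

/-- The arms of `S` that survive the elimination with estimate `θ` and sample size `n`. -/
def survivors {d : ℕ} (S : Set (Vec d)) (σ : ℝ) (T : ℕ) (θ : Vec d) (n : ℝ) : Set (Vec d) :=
  {x ∈ S | maxReward S θ - 8 * √(d ^ 2 * σ ^ 2 * Real.log T / n) ≤ x ⬝ᵥ θ}

/-- The pulls of one episode: each arm `a` of the support is pulled `⌈l(a) T'⌉` times in a row. -/
def episodePulls {d : ℕ} (order : Finset (Vec d) → List (Vec d)) (l : Vec d →₀ ℝ) (T' : ℝ) :
    List (Vec d) :=
  (order l.support).flatMap fun a => List.replicate ⌈l a * T'⌉₊ a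

/-- The parameter `T'` of episode `e`. -/
def episodeParam (τ e : ℕ) : ℝ := 2 ^ e * (2 / 3 * (τ : ℝ))

/-- The first round of episode `e` of LinPE and the set of arms that have survived until then. -/
def episodeState {d : ℕ} (X : Set (Vec d)) (D : Set (Vec d) → (Vec d →₀ ℝ))
    (order : Finset (Vec d) → List (Vec d)) (σ : ℝ) (T τ : ℕ)
    (arm : ℕ → Vec d) (reward : ℕ → ℝ) : ℕ → ℕ × Set (Vec d)
  | 0 => (τ, survivors X σ T (estimate arm reward 0 τ) τ)
  | e + 1 =>
    let start := (episodeState X D order σ T τ arm reward e).1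
    let S := (episodeState X D order σ T τ arm reward e).2
    let next := start + (episodePulls order (D S) (episodeParam τ e)).length
    (next, survivors S σ T (estimate arm reward start next) (episodeParam τ e))

/-- From round `τ` on, the arms are pulled by LinPE. -/
def FollowsLinPE {d : ℕ} (X : Set (Vec d)) (D : Set (Vec d) → (Vec d →₀ ℝ))
    (order : Finset (Vec d) → List (Vec d)) (σ : ℝ) (T τ : ℕ)
    (arm : ℕ → Vec d) (reward : ℕ → ℝ) : Prop :=
  ∀ e j : ℕ,
    let start := (episodeState X D order σ T τ arm reward e).1
    let S := (episodeState X D order σ T τ arm reward e).2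
    let pulls := episodePulls order (D S) (episodeParam τ e)
    ∀ h : j < pulls.length, start + j < T → arm (start + j) = pulls[j]

/-- The episodes that the subroutines `D` and `order` prescribe depend measurably on the past. -/
structure IsMeasurableLinPE {d : ℕ} (X : Set (Vec d)) (D : Set (Vec d) → (Vec d →₀ ℝ))
    (order : Finset (Vec d) → List (Vec d)) (σ : ℝ) (T : ℕ) : Prop where
  start : ∀ τ e : ℕ, Measurable fun h : (ℕ → Vec d) × (ℕ → ℝ) =>
    (episodeState X D order σ T τ h.1 h.2 e).1
  pulls : ∀ τ e j : ℕ, Measurable fun h : (ℕ → Vec d) × (ℕ → ℝ) =>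
    (episodePulls order (D (episodeState X D order σ T τ h.1 h.2 e).2) (episodeParam τ e)).getD j 0

/-! ### The meta-algorithm -/

/-- The algorithm run in Phase II. -/
inductive PhaseTwo : Type
  | linPE : PhaseTwo
  | linUCB (α : ℝ) : PhaseTwo

/-- From round `τ` on, the arms are pulled by the given Phase II algorithm. -/
def FollowsPhaseTwo {d : ℕ} (alg : PhaseTwo) (X : Set (Vec d)) (D : Set (Vec d) → (Vec d →₀ ℝ))
    (order : Finset (Vec d) → List (Vec d)) (σ : ℝ) (T τ : ℕ) (arm : ℕ → Vec d) (reward : ℕ → ℝ) : Prop :=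
  match alg with
  | PhaseTwo.linPE => FollowsLinPE X D order σ T τ arm reward
  | PhaseTwo.linUCB α => FollowsLinUCB X σ α T τ arm reward

/-- In the rounds `0, …, T - 1` the arms are those pulled by FairLinBandit with horizon `T`, given
the flags, the arms `sample i` drawn from the John ellipsoid distribution, and the rewards. -/
structure FollowsFairLinBandit {d : ℕ} (alg : PhaseTwo) (X : Set (Vec d))
    (D : Set (Vec d) → (Vec d →₀ ℝ)) (order : Finset (Vec d) → List (Vec d)) (σ : ℝ) (T : ℕ)
    (flag : ℕ → Bool) (sample arm : ℕ → Vec d) (reward : ℕ → ℝ) : Prop where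
  phaseOne : ∀ k, (∀ k' ≤ k, PhaseOneContinues X σ T arm reward (epochStart T k')) →
    ∀ j < epochLength T k, epochStart T k + j < T →
      arm (epochStart T k + j) =
        pulledArm (flag (epochStart T k + j)) (sample (epochStart T k + j))
          (queueAfter order (D X) (epochLength T k) flag (epochStart T k) j)
  phaseTwo : ∀ k, (∀ k' < k, PhaseOneContinues X σ T arm reward (epochStart T k')) →
    ¬ PhaseOneContinues X σ T arm reward (epochStart T k) →
      FollowsPhaseTwo alg X D order σ T (epochStart T k) arm reward

/-! ### The stochastic model -/

/-- The information generated by the internal coins of round `t`. -/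
abbrev coinInfo {d : ℕ} {Ω : Type*} (flag : ℕ → Ω → Bool) (sample : ℕ → Ω → Vec d) (t : ℕ) :
    MeasurableSpace Ω :=
  MeasurableSpace.comap (flag t) inferInstance ⊔ MeasurableSpace.comap (sample t) inferInstance

/-- The internal coins of the algorithm: in each round, independently of the past `ℱ t`, a fair
flag and, independently of the flag, an arm drawn from `ρ`. -/
structure IsCoinSequence {d : ℕ} {Ω : Type*} [mΩ : MeasurableSpace Ω] (P : Measure Ω)
    (ℱ : Filtration ℕ mΩ) (T : ℕ) (ρ : Vec d →₀ ℝ)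
    (flag : ℕ → Ω → Bool) (sample : ℕ → Ω → Vec d) : Prop where
  adapted : ∀ t < T, coinInfo flag sample t ≤ ℱ (t + 1)
  indep : ∀ t < T, Indep (coinInfo flag sample t) (ℱ t) P
  law : ∀ t < T, ∀ (f : Bool) (z : Vec d),
    P {ω | flag t ω = f ∧ sample t ω = z} = ENNReal.ofReal (ρ z / 2)

/-- The arm of round `t` is chosen from the past `ℱ t` and the coins of round `t`. Given these,
the reward of round `t` has mean `⟨xₜ, θ⟩` and is `σ`-sub-Gaussian. -/
structure IsBanditInteraction {d : ℕ} {Ω : Type*} [mΩ : MeasurableSpace Ω] (P : Measure Ω)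
    (ℱ : Filtration ℕ mΩ) (T : ℕ) (θ : Vec d) (σ : ℝ)
    (flag : ℕ → Ω → Bool) (sample arm : ℕ → Ω → Vec d) (reward : ℕ → Ω → ℝ) : Prop where
  arm_measurable : ∀ t < T, Measurable[ℱ t ⊔ coinInfo flag sample t] (arm t)
  reward_measurable : ∀ t < T, Measurable[ℱ (t + 1)] (reward t)
  reward_integrable : ∀ t < T, Integrable (reward t) P
  reward_mean : ∀ t < T,
    P[reward t | ℱ t ⊔ coinInfo flag sample t] =ᵐ[P] fun ω => arm t ω ⬝ᵥ θ
  exp_integrable : ∀ t < T, ∀ ζ : ℝ,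
    Integrable (fun ω => Real.exp (ζ * (reward t ω - arm t ω ⬝ᵥ θ))) P
  subgaussian : ∀ t < T, ∀ ζ : ℝ,
    P[fun ω => Real.exp (ζ * (reward t ω - arm t ω ⬝ᵥ θ)) | ℱ t ⊔ coinInfo flag sample t]
      ≤ᵐ[P] fun _ => Real.exp (σ ^ 2 * ζ ^ 2 / 2)

/-- The Nash regret `max_{x ∈ X} ⟨x, θ⟩ - (∏ₜ 𝔼[⟨xₜ, θ⟩])^{1/T}`. -/
def nashRegret {d : ℕ} {Ω : Type*} [MeasurableSpace Ω] (P : Measure Ω) (X : Set (Vec d))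
    (θ : Vec d) (T : ℕ) (arm : ℕ → Ω → Vec d) : ℝ :=
  maxReward X θ - (∏ t ∈ Finset.range T, ∫ ω, arm t ω ⬝ᵥ θ ∂P) ^ (1 / (T : ℝ))

end FairLinBandit

end

namespace FairLinBandit

/-! ### Quadratic forms and determinants -/

/-! Write μ for the best mean reward and κ = σ d log T / √T. If μ ≤ κ, the bound is immediate, since
the geometric mean is nonnegative. Otherwise the logarithm of the geometric mean is estimated round
by round (`sub_geom_mean_le`). Rounds before the deterministic bound `phaseOneBound` are charged
log(8(d+1)) ≤ log T each. Later rounds have expected reward at least μ/4, so their logarithmic loss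
is at most four times their ordinary relative regret.

The charge for the early rounds rests on the coin: it shows U with probability 1/2, and the arm
drawn then earns at least μ/(d+1) on average. Indeed conv X lies in its John ellipsoid stretched by
the dimension about the center, because otherwise the ellipsoid could be enlarged towards an
outlying point (`IsJohnCenter.dotProduct_le`). Phase I has O(d²σ² log T / μ² + log T) rounds. The
first term contributes about μ · (d²σ² log T / μ²) · log T / T = κ²/μ ≤ κ to the Nash regret, and
the second is negligible for large T.

Everything else is deterministic on a favourable event (`IsGoodPath`) that fails with probability at
most 3/T (`measure_not_isGoodPath_le`). Hoeffding's inequality supplies enough flags D to finish the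
round robin, so that the Gram matrix dominates n/3 times the optimal design. The noise is controlled
by self-normalized bounds: mixing exponential supermartingales over a Gaussian gives a
supermartingale, to which Ville's inequality applies (`measure_selfNormalized_le`). A limit allows
semidefinite regularizers (`measure_selfNormalized_posSemidef_le`), which covers arms that do not
span ℝ^d. The regularizer is the design matrix in Phase I, α I for LinUCB, and a third of the
already scheduled Gram matrix for an episode of LinPE. With the Kiefer-Wolfowitz bound
(`IsDOptimal.sq_dotProduct_le`) the noise bounds become uniform estimation errors of four radii
(`phaseOne_error_le`, `episode_error_le`).

The stopping rule of Phase I then works both ways. While it continues, μ is at most 41 radii, which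
bounds the length; once it stops, μ is at least 32 radii, so gaps of 16 radii in Phase II leave
every arm at least μ/2. The cumulative regret of Phase II is O(σ d log T √T), by optimism and the
elliptical potential for LinUCB (`linUCB_regret`) and by elimination with doubling samples for LinPE
(`linPE_regret`). -/

lemma vecMulVec_mulVec_self {k : ℕ} (x v : Vec k) :
    Matrix.vecMulVec x x *ᵥ v = (x ⬝ᵥ v) • x := by
  rw [Matrix.vecMulVec_mulVec]
  simp

lemma dotProduct_vecMulVec_mulVec {k : ℕ} (x v : Vec k) :
    v ⬝ᵥ (Matrix.vecMulVec x x *ᵥ v) = (x ⬝ᵥ v) ^ 2 := by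
  rw [vecMulVec_mulVec_self, dotProduct_smul, smul_eq_mul, dotProduct_comm v x, sq]

lemma posSemidef_vecMulVec {k : ℕ} (x : Vec k) : (Matrix.vecMulVec x x).PosSemidef := by
  simpa using Matrix.posSemidef_vecMulVec_self_star x

lemma gramMatrix_posSemidef {d : ℕ} (x : ℕ → Vec d) (m n : ℕ) :
    (gramMatrix x m n).PosSemidef :=
  Matrix.posSemidef_sum _ fun i _ => posSemidef_vecMulVec (x i)

lemma gramMatrix_quad {d : ℕ} (x : ℕ → Vec d) (m n : ℕ) (v : Vec d) :
    v ⬝ᵥ (gramMatrix x m n *ᵥ v) = ∑ i ∈ Finset.Ico m n, (x i ⬝ᵥ v) ^ 2 := by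
  rw [gramMatrix, Matrix.sum_mulVec, dotProduct_sum]
  exact Finset.sum_congr rfl fun i _ => dotProduct_vecMulVec_mulVec _ _

lemma designMatrix_mulVec_quad {d : ℕ} (l : Vec d →₀ ℝ) (v : Vec d) :
    v ⬝ᵥ (designMatrix l *ᵥ v) = l.sum fun x w => w * (x ⬝ᵥ v) ^ 2 := by
  rw [designMatrix, Finsupp.sum, Matrix.sum_mulVec, dotProduct_sum, Finsupp.sum]
  refine Finset.sum_congr rfl fun i _ => ?_
  rw [Matrix.smul_mulVec, dotProduct_smul, dotProduct_vecMulVec_mulVec, smul_eq_mul]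

lemma designMatrix_posSemidef {d : ℕ} {S : Set (Vec d)} {l : Vec d →₀ ℝ} (hl : IsDesign S l) :
    (designMatrix l).PosSemidef := by
  rw [designMatrix, Finsupp.sum]
  exact Matrix.posSemidef_sum _ fun i _ => (posSemidef_vecMulVec i).smul (hl.nonneg i)

lemma quad_nonneg {k : ℕ} {A : Matrix (Fin k) (Fin k) ℝ} (hA : A.PosSemidef) (v : Vec k) :
    0 ≤ v ⬝ᵥ (A *ᵥ v) := by
  simpa using hA.dotProduct_mulVec_nonneg v

lemma dotProduct_mulVec_symm {k : ℕ} {A : Matrix (Fin k) (Fin k) ℝ} (hA : A.IsHermitian)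
    (u v : Vec k) : u ⬝ᵥ (A *ᵥ v) = (A *ᵥ u) ⬝ᵥ v := by
  have : Aᵀ = A := by simpa [Matrix.IsHermitian] using hA
  rw [Matrix.dotProduct_mulVec, ← Matrix.mulVec_transpose, this]

/-- The Cauchy-Schwarz inequality for a positive semidefinite form. -/
lemma sq_quad_le {k : ℕ} {A : Matrix (Fin k) (Fin k) ℝ} (hA : A.PosSemidef) (u v : Vec k) :
    (u ⬝ᵥ (A *ᵥ v)) ^ 2 ≤ (u ⬝ᵥ (A *ᵥ u)) * (v ⬝ᵥ (A *ᵥ v)) := by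
  have key : ∀ t : ℝ, 0 ≤ (v ⬝ᵥ (A *ᵥ v)) * (t * t) + (2 * (u ⬝ᵥ (A *ᵥ v))) * t
      + u ⬝ᵥ (A *ᵥ u) := by
    intro t
    have h := quad_nonneg hA (u + t • v)
    have hs : v ⬝ᵥ (A *ᵥ u) = u ⬝ᵥ (A *ᵥ v) := by
      rw [dotProduct_mulVec_symm hA.1, dotProduct_comm]
    simp only [Matrix.mulVec_add, Matrix.mulVec_smul, dotProduct_add, add_dotProduct,
      dotProduct_smul, smul_dotProduct, smul_eq_mul, hs] at h
    linarith
  have := discrim_le_zero key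
  rw [discrim] at this
  nlinarith

lemma mul_inv_posDef {k : ℕ} {A : Matrix (Fin k) (Fin k) ℝ} (hA : A.PosDef) : A * A⁻¹ = 1 :=
  Matrix.mul_nonsing_inv _ ((Matrix.isUnit_iff_isUnit_det _).1 hA.isUnit)

lemma mulVec_inv_mulVec {k : ℕ} {A : Matrix (Fin k) (Fin k) ℝ} (hA : A.PosDef) (x : Vec k) :
    A *ᵥ (A⁻¹ *ᵥ x) = x := by
  rw [Matrix.mulVec_mulVec, mul_inv_posDef hA, Matrix.one_mulVec]

/-- Cauchy-Schwarz in the form of `A`, applied to `s = A (A⁻¹ s)`. It allows norms in `A⁻¹` to be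
replaced by bounds in each direction `v`, which still make sense for singular Gram matrices. -/
lemma sq_dotProduct_le_inv {k : ℕ} {A : Matrix (Fin k) (Fin k) ℝ} (hA : A.PosDef)
    (s v : Vec k) : (s ⬝ᵥ v) ^ 2 ≤ (s ⬝ᵥ (A⁻¹ *ᵥ s)) * (v ⬝ᵥ (A *ᵥ v)) := by
  have h := sq_quad_le hA.posSemidef (A⁻¹ *ᵥ s) v
  rw [dotProduct_mulVec_symm hA.1, mulVec_inv_mulVec hA] at h
  rwa [dotProduct_comm (A⁻¹ *ᵥ s) s] at h

/-- The matrix determinant lemma for a symmetric rank-one update. -/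
lemma det_add_vecMulVec {k : ℕ} {A : Matrix (Fin k) (Fin k) ℝ} (hA : IsUnit A.det)
    (x y : Vec k) : (A + Matrix.vecMulVec x y).det = A.det * (1 + y ⬝ᵥ (A⁻¹ *ᵥ x)) := by
  have h := Matrix.det_add_replicateCol_mul_replicateRow (ι := Unit) hA x y
  rw [← Matrix.vecMulVec_eq] at h
  have e : Matrix.replicateRow Unit y * A⁻¹ * Matrix.replicateCol Unit x
      = (y ⬝ᵥ (A⁻¹ *ᵥ x)) • (1 : Matrix Unit Unit ℝ) := by
    rw [Matrix.mul_assoc, ← Matrix.replicateCol_mulVec]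
    ext i j
    simp [Matrix.mul_apply, dotProduct]
  rw [h, e, Matrix.det_unique (n := Unit)]
  simp

lemma det_add_smul_vecMulVec {k : ℕ} {A : Matrix (Fin k) (Fin k) ℝ} (hA : IsUnit A.det)
    (c : ℝ) (x : Vec k) :
    (A + c • Matrix.vecMulVec x x).det = A.det * (1 + c * (x ⬝ᵥ (A⁻¹ *ᵥ x))) := by
  rw [← Matrix.vecMulVec_smul, det_add_vecMulVec hA, smul_dotProduct, smul_eq_mul]

/-- The Sherman-Morrison formula for a symmetric rank-one update. -/
lemma inv_add_vecMulVec {k : ℕ} {A : Matrix (Fin k) (Fin k) ℝ} (hA : A.PosDef) (x : Vec k) :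
    (A + Matrix.vecMulVec x x)⁻¹ = A⁻¹ - (1 + x ⬝ᵥ (A⁻¹ *ᵥ x))⁻¹ •
      Matrix.vecMulVec (A⁻¹ *ᵥ x) (A⁻¹ *ᵥ x) := by
  have hw : 0 ≤ x ⬝ᵥ (A⁻¹ *ᵥ x) := quad_nonneg hA.inv.posSemidef x
  apply Matrix.inv_eq_right_inv
  refine Matrix.mulVec_injective (funext fun v => ?_)
  have e1 : Matrix.vecMulVec x x *ᵥ (A⁻¹ *ᵥ v) = ((A⁻¹ *ᵥ x) ⬝ᵥ v) • x := by
    rw [vecMulVec_mulVec_self, dotProduct_mulVec_symm hA.inv.1]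
  rw [← Matrix.mulVec_mulVec, Matrix.sub_mulVec, Matrix.smul_mulVec, vecMulVec_mulVec_self,
    Matrix.mulVec_sub, Matrix.add_mulVec, Matrix.add_mulVec, mulVec_inv_mulVec hA, e1,
    Matrix.mulVec_smul, Matrix.mulVec_smul, mulVec_inv_mulVec hA, Matrix.mulVec_smul,
    Matrix.mulVec_smul, vecMulVec_mulVec_self, Matrix.one_mulVec]
  ext i
  simp only [Pi.sub_apply, Pi.add_apply, Pi.smul_apply, smul_eq_mul]
  field_simp
  ring

/-- The increment of `‖s‖²` in the inverse Gram matrix when one observation is added. -/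
lemma inv_quad_update {k : ℕ} {A : Matrix (Fin k) (Fin k) ℝ} (hA : A.PosDef) (x s : Vec k)
    (y : ℝ) :
    (s + y • x) ⬝ᵥ ((A + Matrix.vecMulVec x x)⁻¹ *ᵥ (s + y • x)) =
      s ⬝ᵥ (A⁻¹ *ᵥ s) + (2 * y * (x ⬝ᵥ (A⁻¹ *ᵥ s)) + y ^ 2 * (x ⬝ᵥ (A⁻¹ *ᵥ x))
        - (x ⬝ᵥ (A⁻¹ *ᵥ s)) ^ 2) / (1 + x ⬝ᵥ (A⁻¹ *ᵥ x)) := by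
  have hw : 0 ≤ x ⬝ᵥ (A⁻¹ *ᵥ x) := quad_nonneg hA.inv.posSemidef x
  rw [inv_add_vecMulVec hA, Matrix.sub_mulVec, Matrix.smul_mulVec, vecMulVec_mulVec_self,
    ← dotProduct_mulVec_symm hA.inv.1]
  have hs : s ⬝ᵥ (A⁻¹ *ᵥ x) = x ⬝ᵥ (A⁻¹ *ᵥ s) := by
    rw [dotProduct_mulVec_symm hA.inv.1, dotProduct_comm]
  simp only [Matrix.mulVec_add, Matrix.mulVec_smul, dotProduct_add, add_dotProduct,
    dotProduct_smul, smul_dotProduct, smul_eq_mul, dotProduct_sub, hs]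
  field_simp
  ring

lemma posDef_add_vecMulVec {k : ℕ} {A : Matrix (Fin k) (Fin k) ℝ} (hA : A.PosDef) (x : Vec k) :
    (A + Matrix.vecMulVec x x).PosDef :=
  hA.add_posSemidef (posSemidef_vecMulVec x)

lemma det_update {k : ℕ} {A : Matrix (Fin k) (Fin k) ℝ} (hA : A.PosDef) (x : Vec k) :
    (A + Matrix.vecMulVec x x).det = A.det * (1 + x ⬝ᵥ (A⁻¹ *ᵥ x)) :=
  det_add_vecMulVec hA.det_pos.ne'.isUnit x x

lemma det_le_det_add_sum {k : ℕ} {A : Matrix (Fin k) (Fin k) ℝ} (hA : A.PosDef) {ι : Type*}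
    (s : Finset ι) (x : ι → Vec k) :
    (A + ∑ i ∈ s, Matrix.vecMulVec (x i) (x i)).PosDef ∧
      A.det ≤ (A + ∑ i ∈ s, Matrix.vecMulVec (x i) (x i)).det := by
  classical
  induction s using Finset.induction_on with
  | empty => simpa using hA
  | insert i s hi ih =>
    rw [Finset.sum_insert hi, add_left_comm, add_comm]
    refine ⟨posDef_add_vecMulVec ih.1 _, ih.2.trans ?_⟩
    rw [det_update ih.1]
    have := quad_nonneg ih.1.inv.posSemidef (x i)
    nlinarith [ih.1.det_pos]

lemma conjTranspose_mul_self_eq_sum {k m : ℕ} (B : Matrix (Fin m) (Fin k) ℝ) :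
    Bᴴ * B = ∑ i, Matrix.vecMulVec (B i) (B i) := by
  ext a b
  simp [Matrix.mul_apply, Matrix.sum_apply, Matrix.vecMulVec_apply]

/-- The determinant is monotone in the Loewner order. -/
lemma det_le_det_of_quad_le {k : ℕ} {A B : Matrix (Fin k) (Fin k) ℝ} (hA : A.PosDef)
    (hB : B.IsHermitian) (h : ∀ v : Vec k, v ⬝ᵥ (A *ᵥ v) ≤ v ⬝ᵥ (B *ᵥ v)) : A.det ≤ B.det := by
  have hP : (B - A).PosSemidef := by
    refine Matrix.PosSemidef.of_dotProduct_mulVec_nonneg (hB.sub hA.1) fun v => ?_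
    rw [Matrix.sub_mulVec, dotProduct_sub]
    simpa using h v
  -- A square root of `B - A` writes `B` as `A` plus rank-one terms, and each of these multiplies
  -- the determinant by a factor at least 1.
  obtain ⟨C, hC⟩ : ∃ C, B - A = Cᴴ * C := by
    open scoped MatrixOrder in
    exact CStarAlgebra.nonneg_iff_eq_star_mul_self.1 hP.nonneg
  have hBA : B = A + ∑ i, Matrix.vecMulVec (C i) (C i) := by
    rw [← conjTranspose_mul_self_eq_sum, ← hC]; abel
  rw [hBA]
  exact (det_le_det_add_sum hA _ _).2

/-- The arithmetic-geometric mean inequality for the eigenvalues. -/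
lemma det_le_trace_div_pow {k : ℕ} (hk : 0 < k) {A : Matrix (Fin k) (Fin k) ℝ}
    (hA : A.PosSemidef) : A.det ≤ (A.trace / k) ^ k := by
  have hd : A.det = ∏ i, hA.1.eigenvalues i := by simpa using hA.1.det_eq_prod_eigenvalues
  have ht : A.trace = ∑ i, hA.1.eigenvalues i := by simpa using hA.1.trace_eq_sum_eigenvalues
  have hk' : (k : ℝ) ≠ 0 := by positivity
  have h := Real.geom_mean_le_arith_mean_weighted Finset.univ (fun _ : Fin k => 1 / (k : ℝ))
    hA.1.eigenvalues (fun _ _ => by positivity) (by simp [hk']) (fun i _ => hA.eigenvalues_nonneg i)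
  rw [Real.finsetProd_rpow _ _ (fun i _ => hA.eigenvalues_nonneg i), ← hd, ← Finset.mul_sum,
    ← ht] at h
  have hdn : 0 ≤ A.det := hA.det_nonneg
  calc A.det = (A.det ^ (1 / (k : ℝ))) ^ k := by
        rw [← Real.rpow_natCast, ← Real.rpow_mul hdn, one_div_mul_cancel hk', Real.rpow_one]
    _ ≤ (1 / k * A.trace) ^ k := pow_le_pow_left₀ (by positivity) h k
    _ = _ := by rw [one_div_mul_eq_div]

/-! ### Least squares -/

/-- One inclusion is clear and the ranks agree. This is the solvability of the normal equations,
also for singular Gram matrices. -/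
lemma range_transpose_mul_self {m k : ℕ} (A : Matrix (Fin m) (Fin k) ℝ) :
    LinearMap.range (Aᵀ * A).mulVecLin = LinearMap.range Aᵀ.mulVecLin := by
  apply Submodule.eq_of_le_of_finrank_eq
  · rw [Matrix.mulVecLin_mul]
    exact LinearMap.range_comp_le_range _ _
  · have h := Matrix.rank_transpose_mul_self A
    rw [← Matrix.rank_transpose A] at h
    exact h

lemma responseSum_mem_range {d : ℕ} (x : ℕ → Vec d) (r : ℕ → ℝ) (m n : ℕ) :
    responseSum x r m n ∈ LinearMap.range (gramMatrix x m n).mulVecLin := by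
  set A : Matrix (Fin (n - m)) (Fin d) ℝ := fun i => x (m + i)
  have hA : gramMatrix x m n = Aᵀ * A := by
    rw [gramMatrix, Finset.sum_Ico_eq_sum_range, Finset.sum_range, ← conjTranspose_mul_self_eq_sum A]
    rfl
  rw [hA, range_transpose_mul_self]
  refine ⟨fun i => r (m + i), ?_⟩
  rw [responseSum, Finset.sum_Ico_eq_sum_range, Finset.sum_range]
  ext j
  simp only [Matrix.mulVecLin_apply, Matrix.mulVec, dotProduct, Matrix.transpose_apply,
    Finset.sum_apply, Pi.smul_apply, smul_eq_mul]
  exact Finset.sum_congr rfl fun i _ => mul_comm _ _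

lemma gramMatrix_mulVec_estimate {d : ℕ} (x : ℕ → Vec d) (r : ℕ → ℝ) (m n : ℕ) :
    gramMatrix x m n *ᵥ estimate x r m n = responseSum x r m n := by
  set V := gramMatrix x m n
  have hT : Vᵀ = V := by simpa [Matrix.IsHermitian] using (gramMatrix_posSemidef x m n).1
  -- For the symmetric `V` the ranges of `V V` and `V` agree. So the response is `V (V u)`, and `V
  -- u` is a solution inside the range, as the choice in `leastSquares` requires.
  have h1 : responseSum x r m n ∈ LinearMap.range (V * V).mulVecLin := by
    have := range_transpose_mul_self V
    rw [hT] at this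
    rw [this]
    exact responseSum_mem_range x r m n
  obtain ⟨u, hu⟩ := h1
  have : ∃ θ, V *ᵥ θ = responseSum x r m n ∧ θ ∈ LinearMap.range V.mulVecLin :=
    ⟨V *ᵥ u, by rw [Matrix.mulVec_mulVec]; exact hu, ⟨u, rfl⟩⟩
  exact (Classical.epsilon_spec this).1

/-- Each reward splits into its mean for `θ` and noise, so the estimation error depends on the noise
alone. -/
lemma responseSum_decomp {d : ℕ} (x : ℕ → Vec d) (r : ℕ → ℝ) (m n : ℕ) (θ : Vec d) :
    responseSum x r m n = gramMatrix x m n *ᵥ θ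
      + responseSum x (fun i => r i - x i ⬝ᵥ θ) m n := by
  rw [responseSum, responseSum, gramMatrix, Matrix.sum_mulVec, ← Finset.sum_add_distrib]
  refine Finset.sum_congr rfl fun i _ => ?_
  rw [vecMulVec_mulVec_self, ← add_smul]
  ring_nf

/-! ### D-optimal designs -/

lemma designMatrix_add {d : ℕ} (l l' : Vec d →₀ ℝ) :
    designMatrix (l + l') = designMatrix l + designMatrix l' :=
  Finsupp.sum_add_index' (by simp) (by simp [add_smul])

lemma designMatrix_smul {d : ℕ} (c : ℝ) (l : Vec d →₀ ℝ) :
    designMatrix (c • l) = c • designMatrix l := by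
  rw [designMatrix, Finsupp.sum_smul_index (by simp), designMatrix, Finsupp.smul_sum]
  simp [mul_smul]

lemma designMatrix_single {d : ℕ} (x : Vec d) (w : ℝ) :
    designMatrix (Finsupp.single x w) = w • Matrix.vecMulVec x x :=
  Finsupp.sum_single_index (by simp)

lemma designMatrix_sum {d : ℕ} {ι : Type*} (s : Finset ι) (l : ι → Vec d →₀ ℝ) :
    designMatrix (∑ i ∈ s, l i) = ∑ i ∈ s, designMatrix (l i) := by
  classical
  induction s using Finset.induction_on with
  | empty => simp [designMatrix]
  | insert i s hi ih => rw [Finset.sum_insert hi, Finset.sum_insert hi, designMatrix_add, ih]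

lemma isDesign_single {d : ℕ} {S : Set (Vec d)} {x : Vec d} (hx : x ∈ S) :
    IsDesign S (Finsupp.single x 1) where
  nonneg z := by
    classical
    rw [Finsupp.single_apply]; split_ifs <;> norm_num
  mem z hz := by
    classical
    rw [Finsupp.support_single _ one_ne_zero, Finset.mem_singleton] at hz
    exact hz ▸ hx
  sum_one := by rw [Finsupp.sum_single_index rfl]

lemma IsDesign.convexComb {d : ℕ} {S : Set (Vec d)} {l l' : Vec d →₀ ℝ} (hl : IsDesign S l)
    (hl' : IsDesign S l') {a b : ℝ} (ha : 0 ≤ a) (hb : 0 ≤ b) (hab : a + b = 1) :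
    IsDesign S (a • l + b • l') where
  nonneg z := by
    have := mul_nonneg ha (hl.nonneg z)
    have := mul_nonneg hb (hl'.nonneg z)
    simpa using by linarith
  mem z hz := by
    classical
    rcases Finset.mem_union.1 (Finsupp.support_add hz) with h | h
    · exact hl.mem z (Finsupp.support_smul h)
    · exact hl'.mem z (Finsupp.support_smul h)
  sum_one := by
    rw [Finsupp.sum_add_index' (by simp) (by simp), Finsupp.sum_smul_index (by simp),
      Finsupp.sum_smul_index (by simp), ← Finsupp.mul_sum, ← Finsupp.mul_sum, hl.sum_one,
      hl'.sum_one, mul_one, mul_one, hab]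

/-- A competitor that makes the optimal determinant positive. As a sum of point masses it does not
need `f` to be injective. -/
lemma exists_isDesign_uniform {d k : ℕ} (hk : 0 < k) {S : Set (Vec d)} {f : Fin k → Vec d}
    (hf : ∀ i, f i ∈ S) :
    ∃ l : Vec d →₀ ℝ, IsDesign S l ∧
      designMatrix l = (1 / k : ℝ) • ∑ i, Matrix.vecMulVec (f i) (f i) := by
  classical
  have hk' : (k : ℝ) ≠ 0 := by positivity
  refine ⟨∑ i, Finsupp.single (f i) (1 / (k : ℝ)), ⟨fun z => ?_, fun z hz => ?_, ?_⟩, ?_⟩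
  · rw [Finsupp.finsetSum_apply]
    refine Finset.sum_nonneg fun i _ => ?_
    rw [Finsupp.single_apply]; split_ifs <;> positivity
  · obtain ⟨i, -, hi⟩ := Finset.mem_biUnion.1 (Finsupp.support_finsetSum hz)
    have := Finsupp.support_single_subset hi
    rw [Finset.mem_singleton] at this
    exact this ▸ hf i
  · rw [← Finsupp.sum_finsetSum_index (by simp) (by simp)]
    simp [hk']
  · rw [designMatrix_sum, Finset.smul_sum]
    exact Finset.sum_congr rfl fun i _ => designMatrix_single _ _

lemma posDef_of_posSemidef_of_det_pos {k : ℕ} {A : Matrix (Fin k) (Fin k) ℝ}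
    (hA : A.PosSemidef) (hd : 0 < A.det) : A.PosDef := by
  refine Matrix.PosDef.of_dotProduct_mulVec_pos hA.1 fun v hv => ?_
  refine lt_of_le_of_ne (hA.dotProduct_mulVec_nonneg v) fun h => hv ?_
  have h0 : v ⬝ᵥ (A *ᵥ v) = 0 := by simpa using h.symm
  have hz : A *ᵥ v = 0 := by
    have := sq_quad_le hA (A *ᵥ v) v
    rw [h0, mul_zero] at this
    have := pow_eq_zero_iff (two_ne_zero) |>.1 (le_antisymm this (sq_nonneg _))
    exact dotProduct_self_eq_zero.1 this
  exact Matrix.eq_zero_of_mulVec_eq_zero hd.ne' hz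

lemma posDef_transpose_mul_self_of_linearIndependent {d k : ℕ} {f : Fin k → Vec d}
    (hf : LinearIndependent ℝ f) :
    ((Matrix.of f) * (Matrix.of f)ᵀ).PosDef := by
  have hinj : Function.Injective (Matrix.of f).vecMul := by
    rw [Matrix.vecMul_injective_iff]
    exact hf
  simpa using Matrix.PosDef.mul_conjTranspose_self (Matrix.of f) hinj

/-- The first-order optimality condition: the left side equals 1 at ε = 0 and has derivative q - k
there. Bernoulli's inequality takes the place of the derivative. -/
lemma le_of_forall_one_sub_pow_mul_le {k : ℕ} (hk : 0 < k) {q : ℝ}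
    (h : ∀ ε : ℝ, 0 < ε → ε < 1 → (1 - ε) ^ k * (1 + ε / (1 - ε) * q) ≤ 1) : q ≤ k := by
  by_contra! hq
  have hk1 : (1 : ℝ) ≤ k := by exact_mod_cast hk
  have hq0 : 0 < q := by linarith
  -- Chosen so that k q ε = (q - k)/2, whence (1 - kε)(1 + εq) = 1 + ε(q - k)/2 > 1.
  set ε : ℝ := (q - k) / (2 * k * q)
  have hkq : 0 < 2 * k * q := by positivity
  have hε : 0 < ε := div_pos (by linarith) hkq
  have hεq : ε * (2 * k * q) = q - k := div_mul_cancel₀ _ hkq.ne'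
  have hε1 : k * ε ≤ 1 / 2 := by
    by_contra! hc
    nlinarith
  have hε2 : ε ≤ 1 / 2 := by nlinarith
  have h1 := h ε hε (by linarith)
  have hb : 1 - k * ε ≤ (1 - ε) ^ k := by
    have := one_add_mul_le_pow (a := -ε) (by linarith) k
    rw [← sub_eq_add_neg] at this
    linarith
  have hc : 1 + ε * q ≤ 1 + ε / (1 - ε) * q := by
    have : ε ≤ ε / (1 - ε) := by
      rw [le_div_iff₀ (by linarith)]; nlinarith
    nlinarith
  have : (1 - k * ε) * (1 + ε * q) ≤ 1 :=
    (mul_le_mul hb hc (by positivity) (pow_nonneg (by linarith) _)).trans h1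
  nlinarith

/-- The Kiefer-Wolfowitz bound `x xᵀ ≤ d U(l)` for a D-optimal design. -/
theorem IsDOptimal.sq_dotProduct_le {d : ℕ} {S : Set (Vec d)} {l : Vec d →₀ ℝ}
    (hl : IsDOptimal S l) {x : Vec d} (hx : x ∈ S) (v : Vec d) :
    (x ⬝ᵥ v) ^ 2 ≤ d * (v ⬝ᵥ (designMatrix l *ᵥ v)) := by
  have hopt := hl.optimal
  obtain ⟨f, hfS, hfspan, hfli⟩ := Submodule.exists_fun_fin_finrank_span_eq ℝ S
  have hkd : Module.finrank ℝ (Submodule.span ℝ S) ≤ d := by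
    simpa using Submodule.finrank_le (Submodule.span ℝ S)
  generalize Module.finrank ℝ (Submodule.span ℝ S) = k at hopt f hkd
  have hxs : ∀ z ∈ S, z ∈ Submodule.span ℝ (Set.range f) := fun z hz =>
    hfspan ▸ Submodule.subset_span hz
  have hUnn := quad_nonneg (designMatrix_posSemidef hl.design) v
  rcases Nat.eq_zero_or_pos k with rfl | hk
  · have : x = 0 := by simpa using hxs x hx
    rw [this, zero_dotProduct, zero_pow two_ne_zero]
    exact mul_nonneg (Nat.cast_nonneg _) hUnn
  -- The rows of `F` form a basis of the span, chosen among the points of `S`. With `B = Fᵀ`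
  -- optimality becomes a statement about genuine `k × k` determinants.
  set F : Matrix (Fin k) (Fin d) ℝ := Matrix.of f
  set U := designMatrix l
  have hG : (F * Fᵀ).PosDef := posDef_transpose_mul_self_of_linearIndependent hfli
  have hM0 : (F * U * Fᵀ).PosSemidef := by
    simpa using (designMatrix_posSemidef hl.design).mul_mul_conjTranspose_same F
  -- The optimal determinant is at least that of the uniform design on the basis, which is a
  -- positive multiple of det(F Fᵀ)².
  have hM : (F * U * Fᵀ).PosDef := by
    refine posDef_of_posSemidef_of_det_pos hM0 ?_
    obtain ⟨l₀, hl₀, hU₀⟩ := exists_isDesign_uniform hk hfS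
    have h := hopt l₀ hl₀ Fᵀ
    have hFF : ∑ i, Matrix.vecMulVec (f i) (f i) = Fᵀ * F := by
      have := conjTranspose_mul_self_eq_sum F
      rw [Matrix.conjTranspose_eq_transpose_of_trivial] at this
      exact this.symm
    rw [hU₀, hFF, Matrix.transpose_transpose, Matrix.mul_smul, Matrix.smul_mul, Matrix.det_smul,
      ← Matrix.mul_assoc, Matrix.mul_assoc, Matrix.det_mul] at h
    refine lt_of_lt_of_le ?_ h
    have := hG.det_pos
    positivity
  set y : Vec k := F *ᵥ x
  -- Moving mass ε to `x` multiplies the determinant by (1 - ε)^k (1 + ε/(1 - ε) · q), where `q` is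
  -- the left side; optimality keeps this factor at most 1.
  have hq : y ⬝ᵥ ((F * U * Fᵀ)⁻¹ *ᵥ y) ≤ k := by
    refine le_of_forall_one_sub_pow_mul_le hk fun ε h0 h1 => ?_
    have h := hopt _ (hl.design.convexComb (isDesign_single hx) (a := 1 - ε) (b := ε)
      (by linarith) h0.le (by ring)) Fᵀ
    have hne : 1 - ε ≠ 0 := by linarith
    have e : F * ((1 - ε) • U + ε • Matrix.vecMulVec x x) * Fᵀ
        = (1 - ε) • (F * U * Fᵀ + (ε / (1 - ε)) • Matrix.vecMulVec y y) := by
      have : F * Matrix.vecMulVec x x * Fᵀ = Matrix.vecMulVec y y := by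
        rw [Matrix.mul_vecMulVec, Matrix.vecMulVec_mul, Matrix.vecMul_transpose]
      rw [Matrix.mul_add, Matrix.add_mul, Matrix.mul_smul, Matrix.smul_mul, Matrix.mul_smul,
        Matrix.smul_mul, this, smul_add, smul_smul, mul_div_cancel₀ _ hne]
    rw [Matrix.transpose_transpose, designMatrix_add, designMatrix_smul, designMatrix_smul,
      designMatrix_single, one_smul, e, Matrix.det_smul, Fintype.card_fin,
      det_add_smul_vecMulVec hM.det_pos.ne'.isUnit] at h
    have hp := hM.det_pos
    by_contra! hc
    nlinarith
  -- `Fᵀ u` is the orthogonal projection of `v` onto the span of `S`, so it pairs with the arms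
  -- exactly as `v` does.
  set u : Vec k := (F * Fᵀ)⁻¹ *ᵥ (F *ᵥ v)
  have hort : ∀ z ∈ S, z ⬝ᵥ v = z ⬝ᵥ (Fᵀ *ᵥ u) := by
    intro z hz
    have h1 : F *ᵥ (Fᵀ *ᵥ u) = F *ᵥ v := by
      rw [Matrix.mulVec_mulVec, mulVec_inv_mulVec hG]
    refine Submodule.span_induction ?_ ?_ ?_ ?_ (hxs z hz)
    · rintro _ ⟨i, rfl⟩
      exact (congrFun h1 i).symm
    · simp
    · intro a b _ _ ha hb
      rw [add_dotProduct, add_dotProduct, ha, hb]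
    · intro c a _ ha
      rw [smul_dotProduct, smul_dotProduct, ha]
  have hxu : x ⬝ᵥ v = y ⬝ᵥ u := by
    rw [hort x hx, Matrix.dotProduct_mulVec, Matrix.vecMul_transpose]
  have hUu : u ⬝ᵥ ((F * U * Fᵀ) *ᵥ u) = v ⬝ᵥ (U *ᵥ v) := by
    have : u ⬝ᵥ ((F * U * Fᵀ) *ᵥ u) = (Fᵀ *ᵥ u) ⬝ᵥ (U *ᵥ (Fᵀ *ᵥ u)) := by
      rw [← Matrix.mulVec_mulVec, ← Matrix.mulVec_mulVec, Matrix.dotProduct_mulVec,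
        ← Matrix.mulVec_transpose]
    rw [this, designMatrix_mulVec_quad, designMatrix_mulVec_quad]
    exact Finsupp.sum_congr fun z hz => by rw [hort z (hl.design.mem z hz)]
  calc (x ⬝ᵥ v) ^ 2 ≤ (y ⬝ᵥ ((F * U * Fᵀ)⁻¹ *ᵥ y)) * (u ⬝ᵥ ((F * U * Fᵀ) *ᵥ u)) := by
        rw [hxu]; exact sq_dotProduct_le_inv hM y u
    _ ≤ d * (v ⬝ᵥ (U *ᵥ v)) := by
        rw [hUu]
        have : (k : ℝ) ≤ d := by exact_mod_cast hkd
        exact mul_le_mul_of_nonneg_right (hq.trans this) hUnn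

/-! ### The John ellipsoid -/

lemma euclNorm_nonneg {d : ℕ} (x : Vec d) : 0 ≤ euclNorm x := Real.sqrt_nonneg _

lemma dotProduct_self_nonneg' {d : ℕ} (x : Vec d) : 0 ≤ x ⬝ᵥ x := by
  simpa using dotProduct_star_self_nonneg x

lemma euclNorm_sq {d : ℕ} (x : Vec d) : euclNorm x ^ 2 = x ⬝ᵥ x :=
  Real.sq_sqrt (dotProduct_self_nonneg' x)

lemma sq_dotProduct_le {d : ℕ} (x y : Vec d) : (x ⬝ᵥ y) ^ 2 ≤ (x ⬝ᵥ x) * (y ⬝ᵥ y) := by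
  simpa using sq_quad_le (Matrix.PosSemidef.one (R := ℝ) (n := Fin d)) x y

lemma abs_dotProduct_le {d : ℕ} (x y : Vec d) : |x ⬝ᵥ y| ≤ euclNorm x * euclNorm y := by
  refine abs_le_of_sq_le_sq ?_ (mul_nonneg (euclNorm_nonneg x) (euclNorm_nonneg y))
  rw [mul_pow, euclNorm_sq, euclNorm_sq]
  exact sq_dotProduct_le x y

lemma euclNorm_smul {d : ℕ} (c : ℝ) (x : Vec d) : euclNorm (c • x) = |c| * euclNorm x := by
  rw [euclNorm, smul_dotProduct, dotProduct_smul, smul_eq_mul, smul_eq_mul, ← mul_assoc,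
    Real.sqrt_mul (mul_self_nonneg c), Real.sqrt_mul_self_eq_abs, euclNorm]

lemma euclNorm_eq_zero {d : ℕ} {x : Vec d} (h : euclNorm x = 0) : x = 0 := by
  have := euclNorm_sq x
  rw [h, zero_pow two_ne_zero] at this
  exact dotProduct_self_eq_zero.1 this.symm

lemma euclNorm_zero {d : ℕ} : euclNorm (0 : Vec d) = 0 := by simp [euclNorm]

/-- Affinely independent points of `X` span a simplex, and a small ellipsoid about its barycenter
fits inside. Hence the maximal volume in the definition of the John center is positive. -/
lemma exists_nondegenerate_ellipsoid {d : ℕ} {X : Set (Vec d)} (hX : X.Nonempty) :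
    ∃ (c : Vec d) (A : Matrix (Fin d) (Fin (Module.finrank ℝ (vectorSpan ℝ X))) ℝ),
      ellipsoid c A ⊆ convexHull ℝ X ∧ 0 < (Aᵀ * A).det := by
  obtain ⟨p, hp⟩ := hX
  obtain ⟨f, hfS, hfli⟩ : ∃ f : Fin (Module.finrank ℝ (vectorSpan ℝ X)) → Vec d,
      (∀ i, f i ∈ (· -ᵥ p) '' X) ∧ LinearIndependent ℝ f := by
    rw [vectorSpan_eq_span_vsub_set_right ℝ hp]
    obtain ⟨f, hfS, -, hfli⟩ := Submodule.exists_fun_fin_finrank_span_eq ℝ ((· -ᵥ p) '' X)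
    exact ⟨f, hfS, hfli⟩
  generalize Module.finrank ℝ (vectorSpan ℝ X) = k at f hfS hfli
  have hk : (0 : ℝ) < k + 1 := by positivity
  -- Small enough that the weights 1/(k+1) + ε uᵢ are nonnegative and sum to at most k/(k+1) +
  -- k/(k+1)² ≤ 1; the rest of the mass goes to `p`.
  set ε : ℝ := 1 / (k + 1) ^ 2
  have hε : 0 < ε := by positivity
  have hεk : ε * (k + 1) = 1 / (k + 1) := by simp only [ε]; field_simp
  set F : Matrix (Fin k) (Fin d) ℝ := Matrix.of f
  refine ⟨p + ∑ i, (1 / (k + 1 : ℝ)) • f i, ε • Fᵀ, ?_, ?_⟩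
  · rintro z ⟨u, hu, rfl⟩
    have hu1 : ∀ i, |u i| ≤ 1 := by
      intro i
      have := abs_dotProduct_le u (Pi.single i 1)
      simp only [dotProduct_single, mul_one] at this
      refine this.trans ?_
      have h1 : euclNorm (Pi.single i 1 : Vec k) = 1 := by simp [euclNorm]
      rw [h1, mul_one]; exact hu
    have hz : p + ∑ i, (1 / (k + 1 : ℝ)) • f i + (ε • Fᵀ) *ᵥ u
        = (1 - ∑ i, (1 / (k + 1 : ℝ) + ε * u i)) • p
          + ∑ i, (1 / (k + 1 : ℝ) + ε * u i) • (f i + p) := by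
      have h2 : (ε • Fᵀ) *ᵥ u = ∑ i, (ε * u i) • f i := by
        ext j
        simp [Matrix.mulVec, dotProduct, F, mul_comm, mul_left_comm]
      rw [h2]
      simp only [smul_add, Finset.sum_add_distrib, add_smul, sub_smul, one_smul, Finset.sum_smul]
      abel
    have hw : ∀ i, 0 ≤ 1 / (k + 1 : ℝ) + ε * u i := by
      intro i
      have h1 := neg_abs_le (u i)
      have h2 := hu1 i
      have : ε ≤ 1 / (k + 1) := by rw [← hεk]; nlinarith [Nat.cast_nonneg (α := ℝ) k]
      nlinarith
    have hsum : ∑ i, (1 / (k + 1 : ℝ) + ε * u i) ≤ 1 := by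
      have : ∀ i, 1 / (k + 1 : ℝ) + ε * u i ≤ 1 / (k + 1) + ε := fun i => by
        have := (le_abs_self _).trans (hu1 i)
        nlinarith
      refine (Finset.sum_le_sum fun i _ => this i).trans ?_
      rw [Finset.sum_const, Finset.card_univ, Fintype.card_fin, nsmul_eq_mul, mul_add]
      have h3 : k * ε ≤ 1 / (k + 1) := by rw [← hεk]; nlinarith
      have h4 : k * (1 / (k + 1 : ℝ)) + 1 / (k + 1) = 1 := by field_simp
      linarith
    have hfX : ∀ i, f i + p ∈ convexHull ℝ X := by
      intro i
      obtain ⟨q, hq, hqf⟩ := hfS i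
      rw [← hqf]
      simpa using subset_convexHull ℝ X hq
    have hpK := subset_convexHull ℝ X hp
    have := (convex_convexHull ℝ X).sum_mem (t := Finset.univ)
      (w := Fin.cons (1 - ∑ i, (1 / (k + 1 : ℝ) + ε * u i)) fun i => 1 / (k + 1 : ℝ) + ε * u i)
      (z := (Fin.cons p fun i => f i + p : Fin (k + 1) → Vec d))
      (fun i _ => by
        refine Fin.cases ?_ (fun i => ?_) i
        · rw [Fin.cons_zero]; linarith
        · rw [Fin.cons_succ]; exact hw i)
      (by rw [Fin.sum_univ_succ]; simp only [Fin.cons_zero, Fin.cons_succ]; ring)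
      (fun i _ => by
        refine Fin.cases ?_ (fun i => ?_) i
        · rw [Fin.cons_zero]; exact hpK
        · rw [Fin.cons_succ]; exact hfX i)
    rw [Fin.sum_univ_succ] at this
    simp only [Fin.cons_zero, Fin.cons_succ] at this
    rw [hz]
    exact this
  · have := (posDef_transpose_mul_self_of_linearIndependent hfli).det_pos
    rw [Matrix.transpose_smul, Matrix.transpose_transpose, Matrix.smul_mul, Matrix.mul_smul,
      Matrix.det_smul, Matrix.det_smul]
    positivity

/-- A comparison of support functions. For a functional of norm `N` with value `p` at a unit vector
e, the right side belongs to the hull of the unit ball and the point r e. The left side belongs to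
the ellipsoid with center h e and semi-axes 1 + h along e and √b2 across. The value of `b2` makes
the difference of squares, times r - 1, factor as 2h(N + p)(N - rp) in one case and as (r - 1 -
2h)(rp - N)(rp + N) in the other. -/
lemma add_le_max_of_sq_le {r h N p q b2 : ℝ} (hr : 1 < r) (h0 : 0 ≤ h) (h1 : h ≤ 1)
    (hhr : 2 * h ≤ r - 1)
    (hb : b2 * (r - 1) = r - 1 - 2 * h) (hp : |p| ≤ N)
    (hq : q ^ 2 ≤ b2 * (N ^ 2 - p ^ 2) + (1 + h) ^ 2 * p ^ 2) : h * p + q ≤ max N (r * p) := by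
  have hN : 0 ≤ N := (abs_nonneg p).trans hp
  obtain ⟨hp1, hp2⟩ := abs_le.1 hp
  have hr1 : 0 < r - 1 := by linarith
  rcases le_total (r * p) N with hc | hc
  · refine le_max_of_le_left ?_
    have hnn : 0 ≤ N - h * p := by nlinarith
    have : q ^ 2 ≤ (N - h * p) ^ 2 := by
      refine hq.trans ?_
      have e : ((N - h * p) ^ 2 - (b2 * (N ^ 2 - p ^ 2) + (1 + h) ^ 2 * p ^ 2)) * (r - 1)
          = 2 * h * ((N + p) * (N - r * p)) := by
        linear_combination (-(N ^ 2 - p ^ 2)) * hb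
      have : 0 ≤ 2 * h * ((N + p) * (N - r * p)) :=
        mul_nonneg (by linarith) (mul_nonneg (by linarith) (by linarith))
      rw [← e] at this
      have := nonneg_of_mul_nonneg_left this hr1
      linarith
    linarith [(abs_le.1 (abs_le_of_sq_le_sq this hnn)).2]
  · refine le_max_of_le_right ?_
    have hp0 : 0 ≤ p := by nlinarith
    have hnn : 0 ≤ (r - h) * p := mul_nonneg (by linarith) hp0
    have : q ^ 2 ≤ ((r - h) * p) ^ 2 := by
      refine hq.trans ?_
      have e : (((r - h) * p) ^ 2 - (b2 * (N ^ 2 - p ^ 2) + (1 + h) ^ 2 * p ^ 2)) * (r - 1)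
          = (r - 1 - 2 * h) * ((r * p - N) * (r * p + N)) := by
        linear_combination (-(N ^ 2 - p ^ 2)) * hb
      have : 0 ≤ (r - 1 - 2 * h) * ((r * p - N) * (r * p + N)) :=
        mul_nonneg (by linarith) (mul_nonneg (by linarith) (by nlinarith))
      rw [← e] at this
      have := nonneg_of_mul_nonneg_left this hr1
      linarith
    linarith [(abs_le.1 (abs_le_of_sq_le_sq this hnn)).2]

/-- If a compact convex set contains an ellipsoid and a further point, it contains the ellipsoid
that is stretched towards this point. -/
lemma stretched_ellipsoid_subset {d k : ℕ} {K : Set (Vec d)} (hK : Convex ℝ K) (hKc : IsClosed K)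
    {c : Vec d} {A : Matrix (Fin d) (Fin k) ℝ} (hE : ellipsoid c A ⊆ K) {e : Vec k}
    (he : e ⬝ᵥ e = 1) {r h b : ℝ} (hx : c + A *ᵥ (r • e) ∈ K) (hr : 1 < r) (h0 : 0 ≤ h)
    (h1 : h ≤ 1) (hhr : 2 * h ≤ r - 1) (hb : b ^ 2 * (r - 1) = r - 1 - 2 * h) :
    ellipsoid (c + A *ᵥ (h • e))
      (A * (b • 1 + (1 + h - b) • Matrix.vecMulVec e e)) ⊆ K := by
  rintro z ⟨w, hw, rfl⟩
  by_contra hz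
  -- A point outside `K` is separated from it by a functional. This reduces the inclusion to one
  -- direction `v` in the coordinates of the ellipsoid, where `add_le_max_of_sq_le` applies.
  obtain ⟨f, s, hfK, hfz⟩ := geometric_hahn_banach_closed_point hK hKc hz
  set φ : Vec d := fun i => f (Pi.single i 1)
  have hf : ∀ y, f y = φ ⬝ᵥ y := by
    intro y
    conv_lhs => rw [pi_eq_sum_univ' y]
    simp [map_sum, dotProduct, φ, mul_comm]
  set v : Vec k := Aᵀ *ᵥ φ
  have hfA : ∀ u, f (c + A *ᵥ u) = f c + v ⬝ᵥ u := by
    intro u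
    rw [map_add, hf (A *ᵥ u), Matrix.dotProduct_mulVec, ← Matrix.mulVec_transpose]
  set N := euclNorm v
  set p := v ⬝ᵥ e
  have hN : f c + N < s := by
    rcases eq_or_ne N 0 with hN0 | hN0
    · rw [hN0, add_zero]
      have := hfK _ (hE ⟨0, by rw [euclNorm_zero]; exact zero_le_one, rfl⟩)
      simpa using this
    · have hNp : 0 < N := lt_of_le_of_ne (euclNorm_nonneg v) (Ne.symm hN0)
      have := hfK _ (hE ⟨N⁻¹ • v, by
        rw [euclNorm_smul, abs_of_pos (inv_pos.2 hNp), inv_mul_cancel₀ hN0], rfl⟩)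
      rw [hfA, dotProduct_smul, ← euclNorm_sq, smul_eq_mul, sq, inv_mul_cancel_left₀ hN0] at this
      exact this
  have hxs : f c + r * p < s := by
    have := hfK _ hx
    rwa [hfA, dotProduct_smul, smul_eq_mul] at this
  set D : Matrix (Fin k) (Fin k) ℝ := b • 1 + (1 + h - b) • Matrix.vecMulVec e e
  have hDv : ∀ y : Vec k, D *ᵥ y = b • y + ((1 + h - b) * (e ⬝ᵥ y)) • e := by
    intro y
    rw [Matrix.add_mulVec, Matrix.smul_mulVec, Matrix.smul_mulVec, Matrix.one_mulVec,
      vecMulVec_mulVec_self, smul_smul]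
  have hq : (v ⬝ᵥ (D *ᵥ w)) ^ 2 ≤ b ^ 2 * (N ^ 2 - p ^ 2) + (1 + h) ^ 2 * p ^ 2 := by
    have e1 : v ⬝ᵥ (D *ᵥ w) = (D *ᵥ v) ⬝ᵥ w := by
      rw [hDv, hDv, dotProduct_add, add_dotProduct, dotProduct_smul, dotProduct_smul,
        smul_dotProduct, smul_dotProduct, dotProduct_comm e v]
      simp only [smul_eq_mul]
      ring
    have e2 : (D *ᵥ v) ⬝ᵥ (D *ᵥ v) = b ^ 2 * (N ^ 2 - p ^ 2) + (1 + h) ^ 2 * p ^ 2 := by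
      rw [hDv]
      simp only [dotProduct_add, add_dotProduct, dotProduct_smul, smul_dotProduct, smul_eq_mul,
        he, dotProduct_comm e v]
      rw [euclNorm_sq]
      ring
    rw [e1, ← e2]
    refine (sq_dotProduct_le _ _).trans ?_
    have hw1 : w ⬝ᵥ w ≤ 1 := by
      rw [← euclNorm_sq]
      exact pow_le_one₀ (euclNorm_nonneg w) hw
    nlinarith [dotProduct_self_nonneg' (D *ᵥ v)]
  have hp : |p| ≤ N := by
    have := abs_dotProduct_le v e
    rwa [show euclNorm e = 1 by rw [euclNorm, he, Real.sqrt_one], mul_one] at this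
  have key := add_le_max_of_sq_le hr h0 h1 hhr hb hp hq
  have hz' : f (c + A *ᵥ (h • e) + (A * D) *ᵥ w) = f c + (h * p + v ⬝ᵥ (D *ᵥ w)) := by
    rw [← Matrix.mulVec_mulVec, add_assoc, ← Matrix.mulVec_add, hfA, dotProduct_add,
      dotProduct_smul, smul_eq_mul]
  rw [hz'] at hfz
  rcases max_cases N (r * p) with hm | hm <;> linarith

/-- The eigenvalue is `a` along `e` and `b` on the orthogonal complement. -/
lemma det_stretch {k : ℕ} {e : Vec k} (he : e ⬝ᵥ e = 1) {a b : ℝ} (hb : 0 < b) (hk : 0 < k) :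
    (b • (1 : Matrix (Fin k) (Fin k) ℝ) + (a - b) • Matrix.vecMulVec e e).det
      = b ^ (k - 1) * a := by
  have hd : (b • (1 : Matrix (Fin k) (Fin k) ℝ)).det = b ^ k := by simp
  have hi : (b • (1 : Matrix (Fin k) (Fin k) ℝ))⁻¹ = b⁻¹ • 1 := by
    apply Matrix.inv_eq_right_inv
    rw [Matrix.smul_mul, Matrix.mul_smul, smul_smul, mul_one, mul_inv_cancel₀ hb.ne', one_smul]
  rw [det_add_smul_vecMulVec (by rw [hd]; exact (pow_pos hb k).ne'.isUnit), hd, hi,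
    Matrix.smul_mulVec, Matrix.one_mulVec, dotProduct_smul, he]
  obtain ⟨m, rfl⟩ := Nat.exists_eq_succ_of_ne_zero hk.ne'
  simp only [Nat.succ_eq_add_one, Nat.add_sub_cancel, pow_succ, smul_eq_mul, mul_one]
  field_simp
  ring

/-- In finite dimensions the convex hull of a compact set is compact. -/
lemma isCompact_convexHull_of_isCompact {d : ℕ} {X : Set (Vec d)} (hX : IsCompact X) :
    IsCompact (convexHull ℝ X) := by
  rcases X.eq_empty_or_nonempty with rfl | ⟨x₀, hx₀⟩
  · simp
  have hK : IsCompact (stdSimplex ℝ (Fin (d + 1)) ×ˢ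
      (Set.univ.pi fun _ : Fin (d + 1) => X)) :=
    (isCompact_stdSimplex ℝ _).prod (isCompact_univ_pi fun _ => hX)
  have hcont : Continuous fun q : (Fin (d + 1) → ℝ) × (Fin (d + 1) → Vec d) =>
      ∑ i, q.1 i • q.2 i := by fun_prop
  convert hK.image hcont using 1
  ext y
  constructor
  · intro hy
    -- Carathéodory: affinely independent points number at most d + 1. Padded with weight zero at
    -- `x₀`, they exhibit the hull as a continuous image of a simplex times X^(d+1).
    obtain ⟨ι, _, z, w, hz, hind, hw, hw1, hwz⟩ := eq_pos_convex_span_of_mem_convexHull hy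
    have hcard : Fintype.card ι ≤ Fintype.card (Fin (d + 1)) := by
      have h : Module.finrank ℝ (vectorSpan ℝ (Set.range z)) ≤ d := by
        simpa using Submodule.finrank_le (vectorSpan ℝ (Set.range z))
      rw [Fintype.card_fin]
      exact hind.card_le_finrank_succ.trans (Nat.succ_le_succ h)
    obtain ⟨e⟩ := Function.Embedding.nonempty_of_card_le hcard
    have he := e.injective
    refine ⟨(Function.extend e w 0, Function.extend e z fun _ => x₀), ⟨⟨fun i => ?_, ?_⟩, ?_⟩, ?_⟩
    · rcases em (∃ a, e a = i) with ⟨a, rfl⟩ | h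
      · dsimp only; rw [he.extend_apply]; exact (hw a).le
      · dsimp only; rw [Function.extend_apply' _ _ _ h]; exact le_rfl
    · rw [← hw1]
      refine (Fintype.sum_of_injective e he _ _ (fun i hi => ?_) fun i => ?_).symm
      · dsimp only; rw [Function.extend_apply' _ _ _ hi]; rfl
      · dsimp only; rw [he.extend_apply]
    · intro i _
      rcases em (∃ a, e a = i) with ⟨a, rfl⟩ | h
      · dsimp only; rw [he.extend_apply]; exact hz ⟨a, rfl⟩
      · dsimp only; rw [Function.extend_apply' _ _ _ h]; exact hx₀
    · rw [← hwz]
      refine (Fintype.sum_of_injective e he _ _ (fun i hi => ?_) fun i => ?_).symm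
      · simp only [Function.extend_apply' _ _ _ hi]; simp
      · simp only [he.extend_apply]
  · rintro ⟨⟨w, z⟩, ⟨hw, hz⟩, rfl⟩
    exact (convex_convexHull ℝ X).sum_mem (fun i _ => hw.1 i) hw.2
      fun i _ => subset_convexHull ℝ X (hz i trivial)

/-- The convex hull is contained in the John ellipsoid stretched by its dimension. -/
lemma IsJohnCenter.exists_opposite {d : ℕ} {X : Set (Vec d)} (hX : X.Nonempty)
    (hXc : IsCompact X) {c : Vec d} (hc : IsJohnCenter X c) {x : Vec d} (hx : x ∈ X) :
    ∃ y ∈ convexHull ℝ X, ∃ k : ℝ, 0 ≤ k ∧ k ≤ d ∧ (k + 1) • c = x + k • y := by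
  obtain ⟨A, hA, hmax⟩ := hc
  obtain ⟨c₀, A₀, hA₀, hdet₀⟩ := exists_nondegenerate_ellipsoid hX
  have hdet := hdet₀.trans_le (hmax c₀ A₀ hA₀)
  have hrd : Module.finrank ℝ (vectorSpan ℝ X) ≤ d := by
    simpa using Submodule.finrank_le (vectorSpan ℝ X)
  have hcK : c ∈ convexHull ℝ X := hA ⟨0, by rw [euclNorm_zero]; exact zero_le_one, by simp⟩
  -- The columns of `A` are directions of the hull. Since `AᵀA` is nonsingular they span all of
  -- them, so every point of `X` has coordinates `u` with respect to the ellipsoid.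
  have hrange : LinearMap.range A.mulVecLin ≤ vectorSpan ℝ X := by
    rintro _ ⟨u, rfl⟩
    have hspan := convexHull_subset_affineSpan (𝕜 := ℝ) X
    rcases eq_or_ne (euclNorm u) 0 with h0 | h0
    · rw [euclNorm_eq_zero h0, map_zero]; exact zero_mem _
    · have hp : 0 < euclNorm u := lt_of_le_of_ne (euclNorm_nonneg u) (Ne.symm h0)
      have h1 := hspan (hA ⟨(euclNorm u)⁻¹ • u, by
        rw [euclNorm_smul, abs_of_pos (inv_pos.2 hp), inv_mul_cancel₀ h0], rfl⟩)
      have h2 := AffineSubspace.vsub_mem_direction h1 (hspan hcK)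
      rw [direction_affineSpan, vsub_eq_sub, add_sub_cancel_left, Matrix.mulVec_smul] at h2
      have := Submodule.smul_mem _ (euclNorm u) h2
      rwa [smul_smul, mul_inv_cancel₀ h0, one_smul] at this
  have hinj : Function.Injective A.mulVecLin := by
    rw [← LinearMap.ker_eq_bot, LinearMap.ker_eq_bot']
    intro u hu
    refine Matrix.eq_zero_of_mulVec_eq_zero hdet.ne' (v := u) ?_
    rw [← Matrix.mulVec_mulVec]
    have : A *ᵥ u = 0 := hu
    rw [this, Matrix.mulVec_zero]
  have hrange' : LinearMap.range A.mulVecLin = vectorSpan ℝ X := by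
    apply Submodule.eq_of_le_of_finrank_eq hrange
    rw [LinearMap.finrank_range_of_inj hinj]
    simp
  obtain ⟨u, hu⟩ : x - c ∈ LinearMap.range A.mulVecLin := by
    rw [hrange', ← direction_affineSpan]
    exact AffineSubspace.vsub_mem_direction (subset_affineSpan ℝ X hx)
      (convexHull_subset_affineSpan (𝕜 := ℝ) X hcK)
  have hxu : x = c + A *ᵥ u := by
    have : A *ᵥ u = x - c := hu
    rw [this]; abel
  clear hrange hrange' hinj hdet₀ hA₀
  generalize Module.finrank ℝ (vectorSpan ℝ X) = k at *
  -- A point at distance r > k in these coordinates would allow the ellipsoid to be stretched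
  -- towards it with a gain of volume.
  have huk : euclNorm u ≤ k := by
    by_contra! hr
    set r := euclNorm u
    have hk : 0 < k := by
      rcases Nat.eq_zero_or_pos k with rfl | hk
      · have : u = 0 := Subsingleton.elim _ _
        have h0 : r = 0 := by simp only [r, this]; exact euclNorm_zero
        simp [h0] at hr
      · exact hk
    have hk1 : (1 : ℝ) ≤ k := by exact_mod_cast hk
    have hr1 : 0 < r - 1 := by linarith
    have hr0 : r ≠ 0 := by linarith
    -- By Bernoulli the squared volume grows at least by (1 - 2hC)(1 + h)², which is 1 + 2h(1 - C)
    -- to first order, and C < 1 because r > k. Of the two bounds on `h` below, the first makes this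
    -- factor exceed 1 and the second keeps `b` positive.
    set C : ℝ := (k - 1) / (r - 1)
    have hC : C * (r - 1) = k - 1 := div_mul_cancel₀ _ hr1.ne'
    have hC0 : 0 ≤ C := div_nonneg (by linarith) hr1.le
    have hC1 : C < 1 := by rw [div_lt_one hr1]; linarith
    set h : ℝ := min ((1 - C) / 4) ((r - 1) / 4)
    have hh0 : 0 < h := lt_min (by linarith) (by linarith)
    have hh1 : h ≤ (1 - C) / 4 := min_le_left _ _
    have hh2 : h ≤ (r - 1) / 4 := min_le_right _ _
    set b : ℝ := √(1 - 2 * h / (r - 1))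
    have hb0 : 0 < 1 - 2 * h / (r - 1) := by
      rw [sub_pos, div_lt_one hr1]; linarith
    have hb : 0 < b := Real.sqrt_pos.2 hb0
    have hb2 : b ^ 2 = 1 - 2 * h / (r - 1) := Real.sq_sqrt hb0.le
    set e : Vec k := r⁻¹ • u
    have he : e ⬝ᵥ e = 1 := by
      simp only [e, dotProduct_smul, smul_dotProduct, smul_eq_mul]
      rw [← euclNorm_sq]
      change r⁻¹ * (r⁻¹ * r ^ 2) = 1
      field_simp
    have hre : r • e = u := by simp only [e]; rw [smul_smul, mul_inv_cancel₀ hr0, one_smul]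
    have hsub := stretched_ellipsoid_subset (convex_convexHull ℝ X) (isCompact_convexHull_of_isCompact hXc).isClosed hA he
      (r := r) (h := h) (b := b) (by rw [hre, ← hxu]; exact subset_convexHull ℝ X hx) (by linarith)
      hh0.le (by linarith) (by linarith) (by rw [hb2]; field_simp)
    have hle := hmax _ _ hsub
    rw [Matrix.transpose_mul, Matrix.mul_assoc, ← Matrix.mul_assoc Aᵀ, Matrix.det_mul,
      Matrix.det_mul, Matrix.det_transpose, det_stretch he hb hk] at hle
    have hgt : 1 < (b ^ (k - 1) * (1 + h)) ^ 2 := by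
      have h1 : (b ^ (k - 1) * (1 + h)) ^ 2 = (b ^ 2) ^ (k - 1) * (1 + h) ^ 2 := by ring
      have h2 : 1 - 2 * h * C ≤ (b ^ 2) ^ (k - 1) := by
        have := one_add_mul_le_pow (a := -(2 * h / (r - 1))) (by
          have : 2 * h / (r - 1) ≤ 1 := by linarith
          linarith) (k - 1)
        rw [← sub_eq_add_neg, ← hb2, Nat.cast_sub (by omega), Nat.cast_one] at this
        refine le_trans (le_of_eq ?_) this
        simp only [C]; ring
      have h3 : 1 < (1 - 2 * h * C) * (1 + h) ^ 2 := by
        have hhC : 2 * h * C ≤ 1 / 2 := by nlinarith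
        have : (1 - 2 * h * C) * (1 + 2 * h) ≤ (1 - 2 * h * C) * (1 + h) ^ 2 :=
          mul_le_mul_of_nonneg_left (by nlinarith) (by linarith)
        refine lt_of_lt_of_le ?_ this
        have : 2 * h * C < 1 - C := by nlinarith
        nlinarith
      rw [h1]
      exact h3.trans_le (mul_le_mul_of_nonneg_right h2 (sq_nonneg _))
    nlinarith
  rcases eq_or_ne (k : ℝ) 0 with hk0 | hk0
  · have hu0 : u = 0 := euclNorm_eq_zero (le_antisymm (hk0 ▸ huk) (euclNorm_nonneg u))
    refine ⟨c, hcK, 0, le_rfl, Nat.cast_nonneg _, ?_⟩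
    rw [hxu, hu0]; simp
  · have hkp : (0 : ℝ) < k := lt_of_le_of_ne (Nat.cast_nonneg k) (Ne.symm hk0)
    -- The reflected point, shrunk by `k`, lies in the ellipsoid.
    refine ⟨c + A *ᵥ (-((k : ℝ)⁻¹ • u)), hA ⟨_, ?_, rfl⟩, k, hkp.le, by exact_mod_cast hrd, ?_⟩
    · rw [← neg_smul, euclNorm_smul, abs_neg, abs_of_pos (inv_pos.2 hkp)]
      rw [inv_mul_le_iff₀ hkp, mul_one]; exact huk
    · rw [hxu, Matrix.mulVec_neg, Matrix.mulVec_smul, smul_add, smul_neg, smul_smul,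
        mul_inv_cancel₀ hk0, one_smul, add_smul, one_smul]
      abel

lemma convexHull_dotProduct_nonneg {d : ℕ} {X : Set (Vec d)} {θ : Vec d}
    (h : ∀ x ∈ X, 0 ≤ x ⬝ᵥ θ) {y : Vec d} (hy : y ∈ convexHull ℝ X) : 0 ≤ y ⬝ᵥ θ := by
  have hconv : Convex ℝ {y : Vec d | 0 ≤ y ⬝ᵥ θ} := by
    intro a ha b hb s t hs ht _
    simp only [Set.mem_ofPred_eq, add_dotProduct, smul_dotProduct, smul_eq_mul] at *
    positivity
  exact convexHull_min (fun x hx => h x hx) hconv hy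

/-- A linear reward that is nonnegative on `X` is at the John center at least a `(d + 1)`-th part
of its maximum. -/
theorem IsJohnCenter.dotProduct_le {d : ℕ} {X : Set (Vec d)} (hX : X.Nonempty)
    (hXc : IsCompact X) {c : Vec d} (hc : IsJohnCenter X c) {θ : Vec d}
    (hθ : ∀ x ∈ X, 0 ≤ x ⬝ᵥ θ) {x : Vec d} (hx : x ∈ X) : x ⬝ᵥ θ ≤ (d + 1) * (c ⬝ᵥ θ) := by
  obtain ⟨y, hy, k, hk0, hkd, h⟩ := hc.exists_opposite hX hXc hx
  have h1 := congrArg (· ⬝ᵥ θ) h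
  simp only [add_dotProduct, smul_dotProduct, smul_eq_mul] at h1
  have hy0 := convexHull_dotProduct_nonneg hθ hy
  have hcK : c ∈ convexHull ℝ X := by
    obtain ⟨A, hA, -⟩ := hc
    exact hA ⟨0, by rw [euclNorm_zero]; exact zero_le_one, by simp⟩
  have hc0 := convexHull_dotProduct_nonneg hθ hcK
  nlinarith

/-! ### Conditionally sub-Gaussian noise -/

/-- The law `ν` is `σ`-sub-Gaussian. -/
def IsSubgaussianLaw (σ : ℝ) (ν : Measure ℝ) : Prop :=
  ∀ ζ : ℝ, ∫⁻ y, ENNReal.ofReal (Real.exp (ζ * y)) ∂ν ≤ ENNReal.ofReal (Real.exp (σ ^ 2 * ζ ^ 2 / 2))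

/-- Fatou's lemma along rational approximations of ζ. For conditional laws the bound holds for each
ζ only off a null set, so just countably many ζ can be treated at once. -/
lemma isSubgaussianLaw_of_rat {σ : ℝ} {ν : Measure ℝ}
    (h : ∀ q : ℚ, ∫⁻ y, ENNReal.ofReal (Real.exp (q * y)) ∂ν
      ≤ ENNReal.ofReal (Real.exp (σ ^ 2 * (q : ℝ) ^ 2 / 2))) : IsSubgaussianLaw σ ν := by
  intro ζ
  obtain ⟨q, hq⟩ : ∃ q : ℕ → ℚ, Filter.Tendsto (fun n => (q n : ℝ)) Filter.atTop (nhds ζ) := by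
    obtain ⟨u, hu, hlim⟩ := mem_closure_iff_seq_limit.1 (Rat.denseRange_cast (𝕜 := ℝ) ζ)
    choose q hq using hu
    exact ⟨q, by simpa [hq] using hlim⟩
  have h1 : ∀ y : ℝ, Filter.Tendsto (fun n => ENNReal.ofReal (Real.exp (q n * y))) Filter.atTop
      (nhds (ENNReal.ofReal (Real.exp (ζ * y)))) := fun y =>
    ENNReal.tendsto_ofReal ((Real.continuous_exp.tendsto _).comp (hq.mul_const y))
  have h2 : Filter.Tendsto (fun n => ENNReal.ofReal (Real.exp (σ ^ 2 * (q n : ℝ) ^ 2 / 2)))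
      Filter.atTop (nhds (ENNReal.ofReal (Real.exp (σ ^ 2 * ζ ^ 2 / 2)))) :=
    ENNReal.tendsto_ofReal ((Real.continuous_exp.tendsto _).comp
      (((hq.pow 2).const_mul _).div_const _))
  calc ∫⁻ y, ENNReal.ofReal (Real.exp (ζ * y)) ∂ν
      = ∫⁻ y, Filter.liminf (fun n => ENNReal.ofReal (Real.exp (q n * y))) Filter.atTop ∂ν :=
        lintegral_congr fun y => (h1 y).liminf_eq.symm
    _ ≤ Filter.liminf (fun n => ∫⁻ y, ENNReal.ofReal (Real.exp (q n * y)) ∂ν) Filter.atTop :=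
        lintegral_liminf_le fun n => by fun_prop
    _ ≤ Filter.liminf (fun n => ENNReal.ofReal (Real.exp (σ ^ 2 * (q n : ℝ) ^ 2 / 2)))
          Filter.atTop := Filter.liminf_le_liminf (Filter.Eventually.of_forall fun n => h (q n))
    _ = _ := h2.liminf_eq

/-- Almost every conditional law of `η` given `X` is sub-Gaussian, so disintegration reduces a bound
for the joint law to one for each fixed sub-Gaussian law. -/
lemma lintegral_le_of_condSubgaussian_comap {Ω β : Type*} [mΩ : MeasurableSpace Ω]
    [mβ : MeasurableSpace β] {P : Measure Ω} [IsProbabilityMeasure P] {X : Ω → β}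
    (hX : Measurable X) {η : Ω → ℝ} (hη : Measurable η) {σ : ℝ}
    (hint : ∀ ζ : ℝ, Integrable (fun ω => Real.exp (ζ * η ω)) P)
    (hsub : ∀ ζ : ℝ, P[fun ω => Real.exp (ζ * η ω) | mβ.comap X]
      ≤ᵐ[P] fun _ => Real.exp (σ ^ 2 * ζ ^ 2 / 2))
    {F : β × ℝ → ENNReal} (hF : Measurable F) {h : β → ENNReal} (hh : Measurable h)
    (hFh : ∀ b, ∀ ν : Measure ℝ, IsProbabilityMeasure ν → IsSubgaussianLaw σ ν →
      ∫⁻ y, F (b, y) ∂ν ≤ h b) :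
    ∫⁻ ω, F (X ω, η ω) ∂P ≤ ∫⁻ ω, h (X ω) ∂P := by
  set κ := condDistrib η X P
  have hcomp : (P.map X) ⊗ₘ κ = P.map (fun ω => (X ω, η ω)) :=
    compProd_map_condDistrib hη.aemeasurable
  have hXη : Measurable fun ω => (X ω, η ω) := hX.prodMk hη
  have hlaw : ∀ᵐ b ∂(P.map X), IsSubgaussianLaw σ (κ b) := by
    have hq : ∀ q : ℚ, ∀ᵐ b ∂(P.map X), ∫⁻ y, ENNReal.ofReal (Real.exp (q * y)) ∂(κ b)
        ≤ ENNReal.ofReal (Real.exp (σ ^ 2 * (q : ℝ) ^ 2 / 2)) := by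
      intro q
      have hm : Measurable fun y : ℝ => ENNReal.ofReal (Real.exp (q * y)) := by fun_prop
      refine ae_le_of_forall_setLIntegral_le_of_sigmaFinite hm.lintegral_kernel ?_
      intro B hB _
      have e1 : ∫⁻ b in B, ∫⁻ y, ENNReal.ofReal (Real.exp (q * y)) ∂(κ b) ∂(P.map X)
          = ∫⁻ ω in X ⁻¹' B, ENNReal.ofReal (Real.exp (q * η ω)) ∂P := by
        have h1 := Measure.setLIntegral_compProd (μ := P.map X) (κ := κ)
          (f := fun p : β × ℝ => ENNReal.ofReal (Real.exp (q * p.2)))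
          (by fun_prop) hB MeasurableSet.univ
        simp only [Measure.restrict_univ] at h1
        rw [← h1, hcomp, setLIntegral_map (hB.prod MeasurableSet.univ) (by fun_prop) hXη]
        congr 2
        ext ω; simp
      have hBm : MeasurableSet[mβ.comap X] (X ⁻¹' B) := ⟨B, hB, rfl⟩
      rw [e1, setLIntegral_const, Measure.map_apply hX hB,
        ← ofReal_integral_eq_lintegral_ofReal (hint q).restrict
          (Filter.Eventually.of_forall fun ω => (Real.exp_pos _).le),
        ← setIntegral_condExp hX.comap_le (hint q) hBm]
      have h2 : ∫ ω in X ⁻¹' B, (P[fun ω => Real.exp (q * η ω) | mβ.comap X]) ω ∂P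
          ≤ ∫ ω in X ⁻¹' B, Real.exp (σ ^ 2 * (q : ℝ) ^ 2 / 2) ∂P :=
        setIntegral_mono_ae integrable_condExp.restrict (integrable_const _) (hsub q)
      refine (ENNReal.ofReal_le_ofReal h2).trans (le_of_eq ?_)
      rw [setIntegral_const, smul_eq_mul, mul_comm, ENNReal.ofReal_mul (Real.exp_pos _).le,
        measureReal_def, ENNReal.ofReal_toReal (measure_ne_top _ _)]
    filter_upwards [ae_all_iff.2 hq] with b hb
    exact isSubgaussianLaw_of_rat hb
  calc ∫⁻ ω, F (X ω, η ω) ∂P = ∫⁻ p, F p ∂((P.map X) ⊗ₘ κ) := by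
        rw [hcomp, lintegral_map hF hXη]
    _ = ∫⁻ b, ∫⁻ y, F (b, y) ∂(κ b) ∂(P.map X) := Measure.lintegral_compProd hF
    _ ≤ ∫⁻ b, h b ∂(P.map X) := by
        refine lintegral_mono_ae ?_
        filter_upwards [hlaw] with b hb
        exact hFh b (κ b) inferInstance hb
    _ = ∫⁻ ω, h (X ω) ∂P := lintegral_map hh hX

/-- Conditioning on `m` is conditioning on the identity map into `(Ω, m)`. Only the real variable
`η` needs a regular conditional law, so `Ω` may be arbitrary. -/
lemma lintegral_le_of_condSubgaussian {Ω : Type*} {m mΩ : MeasurableSpace Ω} (hm : m ≤ mΩ)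
    {P : Measure Ω} [IsProbabilityMeasure P] {η : Ω → ℝ} (hη : Measurable η) {σ : ℝ}
    (hint : ∀ ζ : ℝ, Integrable (fun ω => Real.exp (ζ * η ω)) P)
    (hsub : ∀ ζ : ℝ, P[fun ω => Real.exp (ζ * η ω) | m]
      ≤ᵐ[P] fun _ => Real.exp (σ ^ 2 * ζ ^ 2 / 2))
    {F : Ω × ℝ → ENNReal} (hF : Measurable[m.prod inferInstance] F) {h : Ω → ENNReal}
    (hh : Measurable[m] h)
    (hFh : ∀ b, ∀ ν : Measure ℝ, IsProbabilityMeasure ν → IsSubgaussianLaw σ ν →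
      ∫⁻ y, F (b, y) ∂ν ≤ h b) :
    ∫⁻ ω, F (ω, η ω) ∂P ≤ ∫⁻ ω, h ω ∂P := by
  refine @lintegral_le_of_condSubgaussian_comap Ω Ω mΩ m P _ id (measurable_id'' hm) η hη σ hint
    ?_ F hF h hh hFh
  rw [MeasurableSpace.comap_id]
  exact hsub

/-- Completing the square in ζ. On the right stand the weight of `y` averaged over the Gaussian
prior and the posterior density of ζ. -/
lemma gaussianPDFReal_mul_exp {σ u w : ℝ} (hσ : 0 < σ) (hw : 0 < w) (y ζ : ℝ) :
    gaussianPDFReal (u / σ ^ 2) (Real.toNNReal (w / σ ^ 2)) ζ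
        * Real.exp (ζ * y - σ ^ 2 * ζ ^ 2 / 2) =
      (√(1 + w))⁻¹ * Real.exp ((2 * y * u + y ^ 2 * w - u ^ 2) / (2 * σ ^ 2 * (1 + w)))
        * gaussianPDFReal ((u + w * y) / (σ ^ 2 * (1 + w)))
          (Real.toNNReal (w / (σ ^ 2 * (1 + w)))) ζ := by
  have hw1 : 0 < 1 + w := by linarith
  have hv : 0 ≤ w / σ ^ 2 := by positivity
  have hv' : 0 ≤ w / (σ ^ 2 * (1 + w)) := by positivity
  simp only [gaussianPDFReal, Real.coe_toNNReal _ hv, Real.coe_toNNReal _ hv']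
  have e1 : √(2 * Real.pi * (w / (σ ^ 2 * (1 + w)))) * √(1 + w)
      = √(2 * Real.pi * (w / σ ^ 2)) := by
    rw [← Real.sqrt_mul (by positivity)]
    congr 1
    field_simp
  rw [← e1, mul_inv]
  have e2 : Real.exp (-(ζ - u / σ ^ 2) ^ 2 / (2 * (w / σ ^ 2)))
      * Real.exp (ζ * y - σ ^ 2 * ζ ^ 2 / 2)
      = Real.exp ((2 * y * u + y ^ 2 * w - u ^ 2) / (2 * σ ^ 2 * (1 + w)))
        * Real.exp (-(ζ - (u + w * y) / (σ ^ 2 * (1 + w))) ^ 2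
          / (2 * (w / (σ ^ 2 * (1 + w))))) := by
    rw [← Real.exp_add, ← Real.exp_add]
    congr 1
    field_simp
    ring
  linear_combination (√(2 * Real.pi * (w / (σ ^ 2 * (1 + w)))))⁻¹ * (√(1 + w))⁻¹ * e2

/-- The one-step bound behind the self-normalized supermartingale. -/
lemma IsSubgaussianLaw.lintegral_update_le {σ u w : ℝ} (hσ : 0 < σ) (hw : 0 ≤ w)
    {ν : Measure ℝ} [IsProbabilityMeasure ν] (hν : IsSubgaussianLaw σ ν) :
    ∫⁻ y, ENNReal.ofReal ((√(1 + w))⁻¹ *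
      Real.exp ((2 * y * u + y ^ 2 * w - u ^ 2) / (2 * σ ^ 2 * (1 + w)))) ∂ν ≤ 1 := by
  have hexp : ∀ ζ : ℝ, ∫⁻ y, ENNReal.ofReal (Real.exp (ζ * y - σ ^ 2 * ζ ^ 2 / 2)) ∂ν ≤ 1 := by
    intro ζ
    have e : ∀ y : ℝ, ENNReal.ofReal (Real.exp (ζ * y - σ ^ 2 * ζ ^ 2 / 2))
        = ENNReal.ofReal (Real.exp (-(σ ^ 2 * ζ ^ 2 / 2))) * ENNReal.ofReal (Real.exp (ζ * y)) := by
      intro y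
      rw [← ENNReal.ofReal_mul (Real.exp_pos _).le, ← Real.exp_add]
      ring_nf
    simp_rw [e]
    rw [lintegral_const_mul _ (by fun_prop)]
    refine (mul_le_mul_right (hν ζ) _).trans (le_of_eq ?_)
    rw [← ENNReal.ofReal_mul (Real.exp_pos _).le, ← Real.exp_add]
    simp
  rcases hw.eq_or_lt with rfl | hw
  -- For w = 0 the prior degenerates to the point ζ = u/σ².
  · refine le_trans (le_of_eq (lintegral_congr fun y => ?_)) (hexp (u / σ ^ 2))
    congr 1
    rw [add_zero, Real.sqrt_one, inv_one, one_mul]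
    congr 1
    field_simp
    ring
  · have hv : Real.toNNReal (w / σ ^ 2) ≠ 0 := (Real.toNNReal_pos.2 (by positivity)).ne'
    have hv' : Real.toNNReal (w / (σ ^ 2 * (1 + w))) ≠ 0 :=
      (Real.toNNReal_pos.2 (by positivity)).ne'
    -- The update factor is a Gaussian mixture of the functions exp(ζy - σ²ζ²/2), each of which has
    -- mean at most 1; exchanging the integrals finishes the case.
    have e : ∀ y : ℝ, ENNReal.ofReal ((√(1 + w))⁻¹ *
        Real.exp ((2 * y * u + y ^ 2 * w - u ^ 2) / (2 * σ ^ 2 * (1 + w))))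
        = ∫⁻ ζ, gaussianPDF (u / σ ^ 2) (Real.toNNReal (w / σ ^ 2)) ζ
          * ENNReal.ofReal (Real.exp (ζ * y - σ ^ 2 * ζ ^ 2 / 2)) := by
      intro y
      have e1 : ∀ ζ : ℝ, gaussianPDF (u / σ ^ 2) (Real.toNNReal (w / σ ^ 2)) ζ
          * ENNReal.ofReal (Real.exp (ζ * y - σ ^ 2 * ζ ^ 2 / 2))
          = ENNReal.ofReal ((√(1 + w))⁻¹ *
            Real.exp ((2 * y * u + y ^ 2 * w - u ^ 2) / (2 * σ ^ 2 * (1 + w))))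
            * gaussianPDF ((u + w * y) / (σ ^ 2 * (1 + w)))
              (Real.toNNReal (w / (σ ^ 2 * (1 + w)))) ζ := by
        intro ζ
        rw [gaussianPDF, gaussianPDF, ← ENNReal.ofReal_mul (gaussianPDFReal_nonneg _ _ _),
          gaussianPDFReal_mul_exp hσ hw, ENNReal.ofReal_mul (by positivity)]
      simp_rw [e1]
      rw [lintegral_const_mul _ (measurable_gaussianPDF _ _),
        lintegral_gaussianPDF_eq_one _ hv', mul_one]
    simp_rw [e]
    rw [lintegral_lintegral_swap]
    · calc ∫⁻ ζ, ∫⁻ y, gaussianPDF (u / σ ^ 2) (Real.toNNReal (w / σ ^ 2)) ζ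
            * ENNReal.ofReal (Real.exp (ζ * y - σ ^ 2 * ζ ^ 2 / 2)) ∂ν
          ≤ ∫⁻ ζ, gaussianPDF (u / σ ^ 2) (Real.toNNReal (w / σ ^ 2)) ζ := by
            refine lintegral_mono fun ζ => ?_
            rw [lintegral_const_mul _ (by fun_prop)]
            exact (mul_le_mul_right (hexp ζ) _).trans (le_of_eq (mul_one _))
        _ = 1 := lintegral_gaussianPDF_eq_one _ hv
    · have : Measurable fun p : ℝ × ℝ => gaussianPDF (u / σ ^ 2) (Real.toNNReal (w / σ ^ 2)) p.2 :=
        (measurable_gaussianPDF _ _).comp measurable_snd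
      exact (this.mul (by fun_prop)).aemeasurable

/-- Ville's maximal inequality. -/
lemma mul_measure_exists_le {Ω : Type*} {mΩ : MeasurableSpace Ω} {P : Measure Ω}
    {ℱ : Filtration ℕ mΩ} {s N : ℕ} (hsN : s ≤ N) {f : ℕ → Ω → ENNReal}
    (hf : ∀ t, s ≤ t → t ≤ N → Measurable[ℱ t] (f t))
    (hsup : ∀ t, s ≤ t → t < N → ∀ A, MeasurableSet[ℱ t] A →
      ∫⁻ ω in A, f (t + 1) ω ∂P ≤ ∫⁻ ω in A, f t ω ∂P)
    (h0 : ∫⁻ ω, f s ω ∂P ≤ 1) (K : ENNReal) :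
    K * P {ω | ∃ t, s ≤ t ∧ t ≤ N ∧ K ≤ f t ω} ≤ 1 := by
  set A : ℕ → Set Ω := fun n => {ω | ∀ t, s ≤ t → t ≤ n → f t ω < K}
  have hA : ∀ n, s ≤ n → n ≤ N → MeasurableSet[ℱ n] (A n) := by
    intro n hn hnN
    have : A n = ⋂ t ∈ Set.Icc s n, {ω | f t ω < K} := by
      ext ω; simp [A]
    rw [this]
    refine MeasurableSet.biInter (Set.to_countable _) fun t ht => ?_
    exact (hf t ht.1 (ht.2.trans hnN)).mono (ℱ.mono ht.2) le_rfl measurableSet_Iio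
  -- The invariant adds `K` times the probability of having crossed to the mass of the paths that
  -- have not yet crossed. A path that crosses transfers at least `K` per unit of probability, and
  -- the supermartingale property does the rest.
  have key : ∀ n, s ≤ n → n ≤ N →
      K * P {ω | ∃ t, s ≤ t ∧ t ≤ n ∧ K ≤ f t ω} + ∫⁻ ω in A n, f n ω ∂P ≤ 1 := by
    intro n hn
    induction n, hn using Nat.le_induction with
    | base =>
      intro hN
      have hm := ℱ.le s _ (hA s le_rfl hN)
      have e : {ω | ∃ t, s ≤ t ∧ t ≤ s ∧ K ≤ f t ω} = (A s)ᶜ := by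
        ext ω
        simp only [A, Set.mem_compl_iff, Set.mem_ofPred_eq, not_forall, not_lt, exists_prop]
      rw [e, ← setLIntegral_const, add_comm]
      refine le_trans ?_ ((lintegral_add_compl (f s) hm).le.trans h0)
      refine add_le_add le_rfl (setLIntegral_mono' hm.compl fun ω hω => ?_)
      rw [← e] at hω
      obtain ⟨t, h1, h2, h3⟩ := hω
      rwa [le_antisymm h2 h1] at h3
    | succ n hn ih =>
      intro hN
      have hn' : n ≤ N := by omega
      have ih := ih hn'
      set B : Set Ω := {ω | K ≤ f (n + 1) ω}
      have hB : MeasurableSet B :=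
        ((hf (n + 1) (by omega) hN).mono (ℱ.le _) le_rfl) measurableSet_Ici
      have hm := ℱ.le n _ (hA n hn hn')
      have e1 : {ω | ∃ t, s ≤ t ∧ t ≤ n + 1 ∧ K ≤ f t ω}
          ⊆ {ω | ∃ t, s ≤ t ∧ t ≤ n ∧ K ≤ f t ω} ∪ (A n ∩ B) := by
        rintro ω ⟨t, h1, h2, h3⟩
        by_cases hω : ∃ t, s ≤ t ∧ t ≤ n ∧ K ≤ f t ω
        · exact Or.inl hω
        · right
          push Not at hω
          refine ⟨fun u hu hu' => hω u hu hu', ?_⟩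
          rcases Nat.lt_or_ge n t with h | h
          · have : t = n + 1 := by omega
            rw [this] at h3
            exact h3
          · exact absurd h3 (not_le.2 (hω t h1 h))
      have e2 : A (n + 1) ⊆ A n ∩ Bᶜ := fun ω hω =>
        ⟨fun t h1 h2 => hω t h1 (by omega), by
          have := hω (n + 1) (by omega) le_rfl
          simpa [B] using this⟩
      calc K * P {ω | ∃ t, s ≤ t ∧ t ≤ n + 1 ∧ K ≤ f t ω} + ∫⁻ ω in A (n + 1), f (n + 1) ω ∂P
          ≤ K * (P {ω | ∃ t, s ≤ t ∧ t ≤ n ∧ K ≤ f t ω} + P (A n ∩ B))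
            + ∫⁻ ω in A n ∩ Bᶜ, f (n + 1) ω ∂P := by
            gcongr
            exact (measure_mono e1).trans (measure_union_le _ _)
        _ = K * P {ω | ∃ t, s ≤ t ∧ t ≤ n ∧ K ≤ f t ω}
            + (K * P (A n ∩ B) + ∫⁻ ω in A n ∩ Bᶜ, f (n + 1) ω ∂P) := by ring
        _ ≤ K * P {ω | ∃ t, s ≤ t ∧ t ≤ n ∧ K ≤ f t ω}
            + (∫⁻ ω in A n ∩ B, f (n + 1) ω ∂P + ∫⁻ ω in A n ∩ Bᶜ, f (n + 1) ω ∂P) := by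
            gcongr
            rw [← setLIntegral_const]
            exact setLIntegral_mono' (hm.inter hB) fun ω hω => hω.2
        _ = K * P {ω | ∃ t, s ≤ t ∧ t ≤ n ∧ K ≤ f t ω} + ∫⁻ ω in A n, f (n + 1) ω ∂P := by
            rw [← Set.sdiff_eq, lintegral_inter_add_sdiff _ _ hB]
        _ ≤ K * P {ω | ∃ t, s ≤ t ∧ t ≤ n ∧ K ≤ f t ω} + ∫⁻ ω in A n, f n ω ∂P := by
            refine add_le_add le_rfl ?_
            exact hsup n hn (by omega) _ (hA n hn hn')
        _ ≤ 1 := ih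
  exact le_self_add.trans (key N hsN le_rfl)

/-! ### Self-normalized concentration -/

section Measurability

variable {Ω : Type*} {m : MeasurableSpace Ω} {k : ℕ}

lemma measurable_dotProduct {x y : Ω → Vec k} (hx : Measurable x) (hy : Measurable y) :
    Measurable fun ω => x ω ⬝ᵥ y ω :=
  Finset.measurable_sum _ fun i _ =>
    ((measurable_pi_apply i).comp hx).mul ((measurable_pi_apply i).comp hy)

lemma measurable_mulVec {A : Ω → Matrix (Fin k) (Fin k) ℝ}
    (hA : ∀ i j, Measurable fun ω => A ω i j) {x : Ω → Vec k} (hx : Measurable x) :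
    Measurable fun ω => A ω *ᵥ x ω :=
  measurable_pi_lambda _ fun i => by
    simp only [Matrix.mulVec]
    exact measurable_dotProduct (measurable_pi_lambda _ fun j => hA i j) hx

lemma measurable_det {A : Ω → Matrix (Fin k) (Fin k) ℝ}
    (hA : ∀ i j, Measurable fun ω => A ω i j) : Measurable fun ω => (A ω).det := by
  simp only [Matrix.det_apply]
  refine Finset.measurable_sum _ fun p _ => Measurable.const_smul ?_ _
  exact Finset.measurable_prod _ fun i _ => hA _ _

lemma measurable_inv_apply {A : Ω → Matrix (Fin k) (Fin k) ℝ}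
    (hA : ∀ i j, Measurable fun ω => A ω i j) (i j : Fin k) :
    Measurable fun ω => (A ω)⁻¹ i j := by
  -- Cramer's rule. The conventions for the inverse of zero agree, so singular matrices need no
  -- separate case.
  have e : ∀ ω, (A ω)⁻¹ i j = (A ω).det⁻¹ * ((A ω).updateRow j (Pi.single i 1)).det := by
    intro ω
    rw [Matrix.inv_def, Matrix.smul_apply, Matrix.adjugate_apply, Ring.inverse_eq_inv', smul_eq_mul]
  simp_rw [e]
  refine (measurable_det hA).inv.mul (measurable_det fun a b => ?_)
  simp only [Matrix.updateRow_apply]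
  split_ifs
  · exact measurable_const
  · exact hA a b

lemma measurable_vecMulVec_apply {x : Ω → Vec k} (hx : Measurable x) (i j : Fin k) :
    Measurable fun ω => Matrix.vecMulVec (x ω) (x ω) i j :=
  ((measurable_pi_apply i).comp hx).mul ((measurable_pi_apply j).comp hx)

lemma measurable_gramMatrix_apply {x : ℕ → Ω → Vec k} {s t : ℕ}
    (hx : ∀ i, s ≤ i → i < t → Measurable (x i)) (a b : Fin k) :
    Measurable fun ω => gramMatrix (fun i => x i ω) s t a b := by
  simp only [gramMatrix, Matrix.sum_apply]
  refine Finset.measurable_sum _ fun i hi => ?_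
  obtain ⟨h1, h2⟩ := Finset.mem_Ico.1 hi
  exact measurable_vecMulVec_apply (hx i h1 h2) a b

lemma measurable_responseSum {x : ℕ → Ω → Vec k} {y : ℕ → Ω → ℝ} {s t : ℕ}
    (hx : ∀ i, s ≤ i → i < t → Measurable (x i)) (hy : ∀ i, s ≤ i → i < t → Measurable (y i)) :
    Measurable fun ω => responseSum (fun i => x i ω) (fun i => y i ω) s t := by
  simp only [responseSum]
  refine Finset.measurable_sum _ fun i hi => ?_
  obtain ⟨h1, h2⟩ := Finset.mem_Ico.1 hi
  exact (hy i h1 h2).smul (hx i h1 h2)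

end Measurability

lemma gramMatrix_succ {k : ℕ} (x : ℕ → Vec k) {s t : ℕ} (h : s ≤ t) :
    gramMatrix x s (t + 1) = gramMatrix x s t + Matrix.vecMulVec (x t) (x t) :=
  Finset.sum_Ico_succ_top h _

lemma responseSum_succ {k : ℕ} (x : ℕ → Vec k) (y : ℕ → ℝ) {s t : ℕ} (h : s ≤ t) :
    responseSum x y s (t + 1) = responseSum x y s t + y t • x t :=
  Finset.sum_Ico_succ_top h _

lemma gramMatrix_self {k : ℕ} (x : ℕ → Vec k) (s : ℕ) : gramMatrix x s s = 0 := by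
  simp [gramMatrix]

lemma responseSum_self {k : ℕ} (x : ℕ → Vec k) (y : ℕ → ℝ) (s : ℕ) :
    responseSum x y s s = 0 := by
  simp [responseSum]

lemma posDef_add_gramMatrix {k : ℕ} {H : Matrix (Fin k) (Fin k) ℝ} (hH : H.PosDef)
    (x : ℕ → Vec k) (s t : ℕ) : (H + gramMatrix x s t).PosDef :=
  hH.add_posSemidef (gramMatrix_posSemidef x s t)

/-- The self-normalized process `√(det H / det V) exp(‖S‖²_{V⁻¹} / (2σ²))`, `V = H + ∑ xᵢxᵢᵀ`. -/
noncomputable def selfNormalized {k : ℕ} (σ : ℝ) (H : Matrix (Fin k) (Fin k) ℝ) (x : ℕ → Vec k)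
    (y : ℕ → ℝ) (s t : ℕ) : ℝ :=
  √(H.det / (H + gramMatrix x s t).det) *
    Real.exp (responseSum x y s t ⬝ᵥ ((H + gramMatrix x s t)⁻¹ *ᵥ responseSum x y s t)
      / (2 * σ ^ 2))

lemma selfNormalized_nonneg {k : ℕ} (σ : ℝ) (H : Matrix (Fin k) (Fin k) ℝ) (x : ℕ → Vec k)
    (y : ℕ → ℝ) (s t : ℕ) : 0 ≤ selfNormalized σ H x y s t :=
  mul_nonneg (Real.sqrt_nonneg _) (Real.exp_pos _).le

lemma selfNormalized_self {k : ℕ} (σ : ℝ) {H : Matrix (Fin k) (Fin k) ℝ} (hH : H.PosDef)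
    (x : ℕ → Vec k) (y : ℕ → ℝ) (s : ℕ) : selfNormalized σ H x y s s = 1 := by
  simp [selfNormalized, gramMatrix_self, responseSum_self, div_self hH.det_pos.ne']

lemma selfNormalized_succ {k : ℕ} {σ : ℝ} {H : Matrix (Fin k) (Fin k) ℝ}
    (hH : H.PosDef) (x : ℕ → Vec k) (y : ℕ → ℝ) {s t : ℕ} (h : s ≤ t) :
    selfNormalized σ H x y s (t + 1) = selfNormalized σ H x y s t *
      ((√(1 + x t ⬝ᵥ ((H + gramMatrix x s t)⁻¹ *ᵥ x t)))⁻¹ *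
      Real.exp ((2 * y t * (x t ⬝ᵥ ((H + gramMatrix x s t)⁻¹ *ᵥ responseSum x y s t))
        + y t ^ 2 * (x t ⬝ᵥ ((H + gramMatrix x s t)⁻¹ *ᵥ x t))
        - (x t ⬝ᵥ ((H + gramMatrix x s t)⁻¹ *ᵥ responseSum x y s t)) ^ 2)
        / (2 * σ ^ 2 * (1 + x t ⬝ᵥ ((H + gramMatrix x s t)⁻¹ *ᵥ x t))))) := by
  have hV := posDef_add_gramMatrix hH x s t
  have hw := quad_nonneg hV.inv.posSemidef (x t)
  rw [selfNormalized, selfNormalized, gramMatrix_succ x h, responseSum_succ x y h, ← add_assoc,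
    inv_quad_update hV, det_update hV, ← div_div, Real.sqrt_div' _ (by linarith), add_div,
    Real.exp_add, div_div, mul_comm (1 + _) (2 * σ ^ 2)]
  ring

section Bandit

variable {d : ℕ} {Ω : Type*} {mΩ : MeasurableSpace Ω} {P : Measure Ω}
  {ℱ : Filtration ℕ mΩ} {T : ℕ} {θ : Vec d} {σ : ℝ} {ρ : Vec d →₀ ℝ}
  {flag : ℕ → Ω → Bool} {sample arm : ℕ → Ω → Vec d} {reward : ℕ → Ω → ℝ}

lemma IsCoinSequence.sup_le (hc : IsCoinSequence P ℱ T ρ flag sample) {t : ℕ} (ht : t < T) :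
    ℱ t ⊔ coinInfo flag sample t ≤ ℱ (t + 1) :=
  _root_.sup_le (ℱ.mono (Nat.le_succ t)) (hc.adapted t ht)

lemma IsBanditInteraction.measurable_arm (hb : IsBanditInteraction P ℱ T θ σ flag sample arm reward)
    (hc : IsCoinSequence P ℱ T ρ flag sample) {i t : ℕ} (hit : i < t) (hi : i < T) :
    Measurable[ℱ t] (arm i) :=
  (hb.arm_measurable i hi).mono ((hc.sup_le hi).trans (ℱ.mono hit)) le_rfl

lemma IsBanditInteraction.measurable_reward
    (hb : IsBanditInteraction P ℱ T θ σ flag sample arm reward) {i t : ℕ} (hit : i < t)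
    (hi : i < T) : Measurable[ℱ t] (reward i) :=
  (hb.reward_measurable i hi).mono (ℱ.mono hit) le_rfl

lemma IsBanditInteraction.measurable_noise
    (hb : IsBanditInteraction P ℱ T θ σ flag sample arm reward)
    (hc : IsCoinSequence P ℱ T ρ flag sample) {i t : ℕ} (hit : i < t) (hi : i < T) :
    Measurable[ℱ t] fun ω => reward i ω - arm i ω ⬝ᵥ θ :=
  (hb.measurable_reward hit hi).sub
    (measurable_dotProduct (hb.measurable_arm hc hit hi) measurable_const)

variable {H : Ω → Matrix (Fin d) (Fin d) ℝ}

lemma measurable_selfNormalized (hb : IsBanditInteraction P ℱ T θ σ flag sample arm reward)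
    (hc : IsCoinSequence P ℱ T ρ flag sample) {s t : ℕ} (hst : s ≤ t) (htT : t ≤ T)
    (hH : ∀ i j, Measurable[ℱ s] fun ω => H ω i j) :
    Measurable[ℱ t] fun ω => selfNormalized σ (H ω) (fun i => arm i ω)
      (fun i => reward i ω - arm i ω ⬝ᵥ θ) s t := by
  have hH' : ∀ i j, Measurable[ℱ t] fun ω => H ω i j := fun i j =>
    (hH i j).mono (ℱ.mono hst) le_rfl
  have hV : ∀ i j, Measurable[ℱ t] fun ω => (H ω + gramMatrix (fun i => arm i ω) s t) i j :=
    fun i j => (hH' i j).add (measurable_gramMatrix_apply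
      (fun u _ hu => hb.measurable_arm hc hu (hu.trans_le htT)) i j)
  have hS := measurable_responseSum (m := ℱ t) (s := s)
    (fun u _ (hu : u < t) => hb.measurable_arm hc hu (hu.trans_le htT))
    (fun u _ hu => hb.measurable_noise hc hu (hu.trans_le htT))
  refine Measurable.mul ?_ ?_
  · exact ((measurable_det hH').div (measurable_det hV)).sqrt
  · exact ((measurable_dotProduct hS
      (measurable_mulVec (measurable_inv_apply hV) hS)).div_const _).exp

/-- The supermartingale property. Conditioning is on the past together with the coins of the round,
because the arm depends on both; after that only the noise is random and
`IsSubgaussianLaw.lintegral_update_le` bounds the mean of the new factor by 1. -/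
lemma setLIntegral_selfNormalized_succ_le [IsProbabilityMeasure P] (hσ : 0 < σ)
    (hb : IsBanditInteraction P ℱ T θ σ flag sample arm reward)
    (hc : IsCoinSequence P ℱ T ρ flag sample) {s t : ℕ} (hst : s ≤ t) (htT : t < T)
    (hH : ∀ i j, Measurable[ℱ s] fun ω => H ω i j) (hpos : ∀ ω, (H ω).PosDef) {A : Set Ω}
    (hA : MeasurableSet[ℱ t] A) :
    ∫⁻ ω in A, ENNReal.ofReal (selfNormalized σ (H ω) (fun i => arm i ω)
        (fun i => reward i ω - arm i ω ⬝ᵥ θ) s (t + 1)) ∂P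
      ≤ ∫⁻ ω in A, ENNReal.ofReal (selfNormalized σ (H ω) (fun i => arm i ω)
        (fun i => reward i ω - arm i ω ⬝ᵥ θ) s t) ∂P := by
  have hFm : ℱ t ≤ ℱ t ⊔ coinInfo flag sample t := le_sup_left
  have hm : ℱ t ⊔ coinInfo flag sample t ≤ mΩ := (hc.sup_le htT).trans (ℱ.le _)
  set η : Ω → ℝ := fun ω => reward t ω - arm t ω ⬝ᵥ θ
  have hη : Measurable[mΩ] η := (hb.measurable_noise hc (Nat.lt_succ_self t) htT).mono (ℱ.le _) le_rfl
  set Z : Ω → ℝ := fun ω => selfNormalized σ (H ω) (fun i => arm i ω)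
    (fun i => reward i ω - arm i ω ⬝ᵥ θ) s t
  have hZ : Measurable[ℱ t ⊔ coinInfo flag sample t] Z :=
    (measurable_selfNormalized hb hc hst htT.le hH).mono hFm le_rfl
  have hx : Measurable[ℱ t ⊔ coinInfo flag sample t] (arm t) := hb.arm_measurable t htT
  have hV : ∀ i j, Measurable[ℱ t ⊔ coinInfo flag sample t] fun ω => (H ω + gramMatrix (fun i => arm i ω) s t) i j :=
    fun i j => ((hH i j).mono ((ℱ.mono hst).trans hFm) le_rfl).add
      ((measurable_gramMatrix_apply
      (fun u _ hu => hb.measurable_arm hc hu (hu.trans htT)) i j).mono hFm le_rfl)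
  have hS : Measurable[ℱ t ⊔ coinInfo flag sample t] fun ω => responseSum (fun i => arm i ω)
      (fun i => reward i ω - arm i ω ⬝ᵥ θ) s t := (measurable_responseSum (m := ℱ t) (s := s)
    (fun u _ (hu : u < t) => hb.measurable_arm hc hu (hu.trans htT))
    (fun u _ hu => hb.measurable_noise hc hu (hu.trans htT))).mono hFm le_rfl
  set w : Ω → ℝ := fun ω =>
    arm t ω ⬝ᵥ ((H ω + gramMatrix (fun i => arm i ω) s t)⁻¹ *ᵥ arm t ω)
  have hw : Measurable[ℱ t ⊔ coinInfo flag sample t] w :=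
    measurable_dotProduct hx (measurable_mulVec (measurable_inv_apply hV) hx)
  set u : Ω → ℝ := fun ω =>
    arm t ω ⬝ᵥ ((H ω + gramMatrix (fun i => arm i ω) s t)⁻¹ *ᵥ responseSum (fun i => arm i ω)
      (fun i => reward i ω - arm i ω ⬝ᵥ θ) s t)
  have hu : Measurable[ℱ t ⊔ coinInfo flag sample t] u :=
    measurable_dotProduct hx (measurable_mulVec (measurable_inv_apply hV) hS)
  have hAm : MeasurableSet[ℱ t ⊔ coinInfo flag sample t] A := hFm _ hA
  set g : Ω → ENNReal := A.indicator fun ω => ENNReal.ofReal (Z ω)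
  have hg : Measurable[ℱ t ⊔ coinInfo flag sample t] g := hZ.ennreal_ofReal.indicator hAm
  set F : Ω × ℝ → ENNReal := fun p => g p.1 * ENNReal.ofReal ((√(1 + w p.1))⁻¹ *
    Real.exp ((2 * p.2 * u p.1 + p.2 ^ 2 * w p.1 - u p.1 ^ 2) / (2 * σ ^ 2 * (1 + w p.1))))
  have hF : Measurable[(ℱ t ⊔ coinInfo flag sample t).prod inferInstance] F := by
    have h1 : Measurable[(ℱ t ⊔ coinInfo flag sample t).prod inferInstance] (fun p : Ω × ℝ => w p.1) := hw.comp measurable_fst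
    have h2 : Measurable[(ℱ t ⊔ coinInfo flag sample t).prod inferInstance] (fun p : Ω × ℝ => u p.1) := hu.comp measurable_fst
    have h3 : Measurable[(ℱ t ⊔ coinInfo flag sample t).prod inferInstance] (fun p : Ω × ℝ => p.2) :=
      @measurable_snd Ω ℝ (ℱ t ⊔ coinInfo flag sample t) _
    have h4 : Measurable[(ℱ t ⊔ coinInfo flag sample t).prod inferInstance] (fun p : Ω × ℝ => g p.1) := hg.comp measurable_fst
    refine h4.mul (Measurable.ennreal_ofReal (Measurable.mul ?_ (Measurable.exp ?_)))
    · exact (h1.const_add 1).sqrt.inv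
    · exact ((((h3.const_mul 2).mul h2).add ((h3.pow_const 2).mul h1)).sub (h2.pow_const 2)).div
        ((h1.const_add 1).const_mul _)
  have key := lintegral_le_of_condSubgaussian hm hη (σ := σ) (hb.exp_integrable t htT)
    (hb.subgaussian t htT) hF hg fun b ν _ hν => by
      have hwb : 0 ≤ w b := quad_nonneg (posDef_add_gramMatrix (hpos b) _ s t).inv.posSemidef _
      simp only [F]
      rw [lintegral_const_mul _ (by fun_prop)]
      exact (mul_le_mul_right (hν.lintegral_update_le hσ hwb) _).trans (le_of_eq (mul_one _))
  have hA' : MeasurableSet[mΩ] A := ℱ.le _ _ hA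
  rw [← lintegral_indicator hA', ← lintegral_indicator hA']
  refine le_trans (le_of_eq (lintegral_congr fun ω => ?_)) key
  by_cases hω : ω ∈ A
  · simp only [Set.indicator_of_mem hω, F, g]
    rw [selfNormalized_succ (hpos ω) _ _ hst,
      ENNReal.ofReal_mul (selfNormalized_nonneg _ _ _ _ _ _)]
  · simp only [Set.indicator_of_notMem hω, F, g, zero_mul]

/-- The self-normalized tail bound with a random positive definite regularizer. -/
theorem measure_selfNormalized_le [IsProbabilityMeasure P] (hσ : 0 < σ)
    (hb : IsBanditInteraction P ℱ T θ σ flag sample arm reward)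
    (hc : IsCoinSequence P ℱ T ρ flag sample) {s : ℕ} (hsT : s ≤ T)
    (hH : ∀ i j, Measurable[ℱ s] fun ω => H ω i j) (hpos : ∀ ω, (H ω).PosDef) {L : ℝ} :
    P {ω | ∃ t, s ≤ t ∧ t ≤ T ∧ ∃ v : Vec d,
      σ ^ 2 * (2 * L + Real.log ((H ω + gramMatrix (fun i => arm i ω) s t).det / (H ω).det))
        * (v ⬝ᵥ ((H ω + gramMatrix (fun i => arm i ω) s t) *ᵥ v))
      < (responseSum (fun i => arm i ω) (fun i => reward i ω - arm i ω ⬝ᵥ θ) s t ⬝ᵥ v) ^ 2}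
      ≤ ENNReal.ofReal (Real.exp (-L)) := by
  set Z : ℕ → Ω → ENNReal := fun t ω => ENNReal.ofReal (selfNormalized σ (H ω) (fun i => arm i ω)
    (fun i => reward i ω - arm i ω ⬝ᵥ θ) s t)
  have hville := mul_measure_exists_le (P := P) (ℱ := ℱ) hsT (f := Z)
    (fun t h1 h2 => (measurable_selfNormalized hb hc h1 h2 hH).ennreal_ofReal)
    (fun t h1 h2 A hA => setLIntegral_selfNormalized_succ_le hσ hb hc h1 h2 hH hpos hA)
    (by simp [Z, selfNormalized_self _ (hpos _)]) (ENNReal.ofReal (Real.exp L))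
  have hsub : {ω | ∃ t, s ≤ t ∧ t ≤ T ∧ ∃ v : Vec d,
      σ ^ 2 * (2 * L + Real.log ((H ω + gramMatrix (fun i => arm i ω) s t).det / (H ω).det))
        * (v ⬝ᵥ ((H ω + gramMatrix (fun i => arm i ω) s t) *ᵥ v))
      < (responseSum (fun i => arm i ω) (fun i => reward i ω - arm i ω ⬝ᵥ θ) s t ⬝ᵥ v) ^ 2}
      ⊆ {ω | ∃ t, s ≤ t ∧ t ≤ T ∧ ENNReal.ofReal (Real.exp L) ≤ Z t ω} := by
    rintro ω ⟨t, h1, h2, v, hv⟩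
    refine ⟨t, h1, h2, ENNReal.ofReal_le_ofReal ?_⟩
    have hV := posDef_add_gramMatrix (hpos ω) (fun i => arm i ω) s t
    have hcs := sq_dotProduct_le_inv hV (responseSum (fun i => arm i ω)
      (fun i => reward i ω - arm i ω ⬝ᵥ θ) s t) v
    have hvv := quad_nonneg hV.posSemidef v
    rw [selfNormalized]
    set V := H ω + gramMatrix (fun i => arm i ω) s t
    set S := responseSum (fun i => arm i ω) (fun i => reward i ω - arm i ω ⬝ᵥ θ) s t
    -- A violation in a single direction forces the full norm of `S` in `V⁻¹` over the threshold,
    -- which says that the process has reached exp L.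
    have hlt : σ ^ 2 * (2 * L + Real.log (V.det / (H ω).det)) < S ⬝ᵥ (V⁻¹ *ᵥ S) := by
      by_contra! hle
      exact absurd hv (not_lt.2 (hcs.trans (mul_le_mul_of_nonneg_right hle hvv)))
    have hr : 0 < V.det / (H ω).det := div_pos hV.det_pos (hpos ω).det_pos
    have e1 : √((H ω).det / V.det) = Real.exp (-(Real.log (V.det / (H ω).det) / 2)) := by
      rw [← inv_div, Real.sqrt_inv, Real.exp_neg, Real.exp_half, Real.exp_log hr]
    rw [e1, ← Real.exp_add]
    refine Real.exp_le_exp.2 ?_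
    have : L + Real.log (V.det / (H ω).det) / 2 ≤ S ⬝ᵥ (V⁻¹ *ᵥ S) / (2 * σ ^ 2) := by
      rw [le_div_iff₀ (by positivity)]
      linarith
    linarith
  refine (measure_mono hsub).trans ?_
  rw [Real.exp_neg, ENNReal.ofReal_inv_of_pos (Real.exp_pos L), ENNReal.le_inv_iff_mul_le, mul_comm]
  exact hville

/-- The self-normalized tail bound with a positive semidefinite regularizer `H`, on the event that
the Gram matrix is at most `c H`. -/
theorem measure_selfNormalized_posSemidef_le [IsProbabilityMeasure P] (hσ : 0 < σ)
    (hb : IsBanditInteraction P ℱ T θ σ flag sample arm reward)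
    (hc : IsCoinSequence P ℱ T ρ flag sample) {s : ℕ} (hsT : s ≤ T)
    (hH : ∀ i j, Measurable[ℱ s] fun ω => H ω i j) (hpos : ∀ ω, (H ω).PosSemidef) {L c : ℝ}
    (hc0 : 0 ≤ c) :
    P {ω | ∃ t, s ≤ t ∧ t ≤ T ∧
      (∀ v, v ⬝ᵥ (gramMatrix (fun i => arm i ω) s t *ᵥ v) ≤ c * (v ⬝ᵥ (H ω *ᵥ v))) ∧
      ∃ v : Vec d, σ ^ 2 * (2 * L + d * Real.log (1 + c))
        * (v ⬝ᵥ (gramMatrix (fun i => arm i ω) s t *ᵥ v) + v ⬝ᵥ (H ω *ᵥ v))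
      < (responseSum (fun i => arm i ω) (fun i => reward i ω - arm i ω ⬝ᵥ θ) s t ⬝ᵥ v) ^ 2}
      ≤ ENNReal.ofReal (Real.exp (-L)) := by
  rcases lt_or_ge L 0 with hL | hL
  · refine prob_le_one.trans ?_
    rw [← ENNReal.ofReal_one]
    exact ENNReal.ofReal_le_ofReal (Real.one_le_exp (by linarith))
  set M : ℝ := σ ^ 2 * (2 * L + d * Real.log (1 + c))
  have hM : 0 ≤ M := by
    have := Real.log_nonneg (show 1 ≤ 1 + c by linarith)
    positivity
  -- The regularizers H + I/(j+1) are positive definite. The events increase with `j` and their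
  -- union contains the desired one, because the violated inequality is strict.
  set B : ℕ → Set Ω := fun j => {ω | ∃ t, s ≤ t ∧ t ≤ T ∧
      (∀ v, v ⬝ᵥ (gramMatrix (fun i => arm i ω) s t *ᵥ v) ≤ c * (v ⬝ᵥ (H ω *ᵥ v))) ∧
      ∃ v : Vec d, M * (v ⬝ᵥ (gramMatrix (fun i => arm i ω) s t *ᵥ v) + v ⬝ᵥ (H ω *ᵥ v)
        + 1 / ((j : ℝ) + 1) * (v ⬝ᵥ v))
      < (responseSum (fun i => arm i ω) (fun i => reward i ω - arm i ω ⬝ᵥ θ) s t ⬝ᵥ v) ^ 2}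
  have hBmono : Monotone B := by
    rintro i j hij ω ⟨t, h1, h2, h3, v, hv⟩
    refine ⟨t, h1, h2, h3, v, lt_of_le_of_lt ?_ hv⟩
    have : 1 / ((j : ℝ) + 1) ≤ 1 / ((i : ℝ) + 1) := by
      have : (i : ℝ) ≤ j := by exact_mod_cast hij
      gcongr
    have := mul_le_mul_of_nonneg_right this (dotProduct_self_nonneg' v)
    gcongr
  have hBle : ∀ j, P (B j) ≤ ENNReal.ofReal (Real.exp (-L)) := by
    intro j
    set ε : ℝ := 1 / ((j : ℝ) + 1)
    have hε : 0 < ε := by positivity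
    have hpos' : ∀ ω, (H ω + ε • (1 : Matrix (Fin d) (Fin d) ℝ)).PosDef := fun ω =>
      (Matrix.PosDef.one.smul hε).posSemidef_add (hpos ω)
    refine le_trans (measure_mono ?_) (measure_selfNormalized_le hσ hb hc hsT
      (H := fun ω => H ω + ε • (1 : Matrix (Fin d) (Fin d) ℝ))
      (fun i j => (hH i j).add measurable_const) hpos' (L := L))
    rintro ω ⟨t, h1, h2, h3, v, hv⟩
    refine ⟨t, h1, h2, v, lt_of_le_of_lt ?_ hv⟩
    have hV := posDef_add_gramMatrix (hpos' ω) (fun i => arm i ω) s t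
    set G := gramMatrix (fun i => arm i ω) s t
    set He := H ω + ε • (1 : Matrix (Fin d) (Fin d) ℝ)
    have e1 : v ⬝ᵥ (G *ᵥ v) + v ⬝ᵥ (H ω *ᵥ v) + ε * (v ⬝ᵥ v) = v ⬝ᵥ ((He + G) *ᵥ v) := by
      simp only [He, Matrix.add_mulVec, Matrix.smul_mulVec, Matrix.one_mulVec, dotProduct_add,
        dotProduct_smul, smul_eq_mul]
      ring
    rw [e1]
    refine mul_le_mul_of_nonneg_right ?_ (quad_nonneg hV.posSemidef v)
    refine mul_le_mul_of_nonneg_left ?_ (sq_nonneg σ)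
    -- From G ≤ cH the regularized matrix is at most (1 + c) times its regularizer; this replaces
    -- the random determinant ratio by a bound independent of `j`.
    have hdet : (He + G).det ≤ (1 + c) ^ d * He.det := by
      have h := det_le_det_of_quad_le hV (B := (1 + c) • He)
        (((hpos' ω).smul (by linarith : (0:ℝ) < 1 + c)).1) (fun u => by
          have := h3 u
          have h5 := mul_nonneg hc0 (mul_nonneg hε.le (dotProduct_self_nonneg' u))
          simp only [He, Matrix.add_mulVec, Matrix.smul_mulVec, Matrix.one_mulVec, dotProduct_add,
            dotProduct_smul, smul_eq_mul]
          linarith)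
      rwa [Matrix.det_smul, Fintype.card_fin] at h
    have hlog : Real.log ((He + G).det / He.det) ≤ d * Real.log (1 + c) := by
      rw [← Real.log_pow]
      refine Real.log_le_log (div_pos hV.det_pos (hpos' ω).det_pos) ?_
      rwa [div_le_iff₀ (hpos' ω).det_pos]
    linarith
  refine le_trans (measure_mono ?_) ((hBmono.measure_iUnion (μ := P)).le.trans (iSup_le hBle))
  rintro ω ⟨t, h1, h2, h3, v, hv⟩
  have hlim : Filter.Tendsto (fun j : ℕ => M * (v ⬝ᵥ (gramMatrix (fun i => arm i ω) s t *ᵥ v)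
      + v ⬝ᵥ (H ω *ᵥ v) + 1 / ((j : ℝ) + 1) * (v ⬝ᵥ v))) Filter.atTop
      (nhds (M * (v ⬝ᵥ (gramMatrix (fun i => arm i ω) s t *ᵥ v) + v ⬝ᵥ (H ω *ᵥ v)
        + 0 * (v ⬝ᵥ v)))) :=
    (((tendsto_one_div_add_atTop_nhds_zero_nat (𝕜 := ℝ)).mul_const _).const_add _).const_mul _
  rw [zero_mul, add_zero] at hlim
  obtain ⟨j, hj⟩ := (hlim.eventually (gt_mem_nhds hv)).exists
  exact Set.mem_iUnion.2 ⟨j, t, h1, h2, h3, v, hj⟩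

end Bandit

/-! ### The coins -/

section Coins

variable {d : ℕ} {Ω : Type*} {mΩ : MeasurableSpace Ω} {P : Measure Ω}
  {ℱ : Filtration ℕ mΩ} {T : ℕ} {ρ : Vec d →₀ ℝ}
  {flag : ℕ → Ω → Bool} {sample : ℕ → Ω → Vec d}

lemma measurable_flag_coinInfo (t : ℕ) : Measurable[coinInfo flag sample t] (flag t) :=
  measurable_iff_comap_le.2 le_sup_left

lemma measurable_sample_coinInfo (t : ℕ) : Measurable[coinInfo flag sample t] (sample t) :=
  measurable_iff_comap_le.2 le_sup_right

lemma IsCoinSequence.coinInfo_le (hc : IsCoinSequence P ℱ T ρ flag sample) {t : ℕ} (ht : t < T) :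
    coinInfo flag sample t ≤ mΩ := (hc.adapted t ht).trans (ℱ.le _)

lemma IsCoinSequence.measurableSet_coin (hc : IsCoinSequence P ℱ T ρ flag sample) {t : ℕ}
    (ht : t < T) (f : Bool) (z : Vec d) : MeasurableSet {ω | flag t ω = f ∧ sample t ω = z} :=
  hc.coinInfo_le ht _ ((measurable_flag_coinInfo (sample := sample) t
    (measurableSet_singleton f)).inter
    (measurable_sample_coinInfo (flag := flag) t (measurableSet_singleton z)))

lemma IsCoinSequence.measurableSet_flag (hc : IsCoinSequence P ℱ T ρ flag sample) {t : ℕ}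
    (ht : t < T) (f : Bool) : MeasurableSet {ω | flag t ω = f} :=
  hc.coinInfo_le ht _ (measurable_flag_coinInfo (sample := sample) t (measurableSet_singleton f))

lemma IsCoinSequence.half_le (hc : IsCoinSequence P ℱ T ρ flag sample) {X : Set (Vec d)}
    (hρ : IsDesign X ρ) {t : ℕ} (ht : t < T) (f : Bool) :
    P {ω | flag t ω = f ∧ sample t ω ∈ ρ.support} = 1 / 2 := by
  classical
  have e : {ω | flag t ω = f ∧ sample t ω ∈ ρ.support}
      = ⋃ z ∈ ρ.support, {ω | flag t ω = f ∧ sample t ω = z} := by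
    ext ω; simp
  rw [e, measure_biUnion_finset]
  · simp_rw [hc.law t ht]
    rw [← ENNReal.ofReal_sum_of_nonneg fun z _ => div_nonneg (hρ.nonneg z) zero_le_two,
      ← Finset.sum_div]
    have := hρ.sum_one
    rw [Finsupp.sum] at this
    rw [this, ENNReal.ofReal_div_of_pos two_pos]
    simp
  · intro a _ b _ hab
    refine Set.disjoint_left.2 fun ω ha hb => hab ?_
    exact ha.2.symm.trans hb.2
  · exact fun z _ => hc.measurableSet_coin ht f z

/-- The prescribed masses on the support of ρ already sum to 1. -/
lemma IsCoinSequence.ae_sample_mem [IsProbabilityMeasure P]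
    (hc : IsCoinSequence P ℱ T ρ flag sample) {X : Set (Vec d)}
    (hρ : IsDesign X ρ) {t : ℕ} (ht : t < T) : ∀ᵐ ω ∂P, sample t ω ∈ ρ.support := by
  have hm : ∀ f, MeasurableSet {ω | flag t ω = f ∧ sample t ω ∈ ρ.support} := by
    intro f
    have e : {ω | flag t ω = f ∧ sample t ω ∈ ρ.support}
        = ⋃ z ∈ ρ.support, {ω | flag t ω = f ∧ sample t ω = z} := by
      ext ω; simp
    rw [e]
    exact Finset.measurableSet_biUnion _ fun z _ => hc.measurableSet_coin ht f z
  have e : {ω | sample t ω ∈ ρ.support} = {ω | flag t ω = true ∧ sample t ω ∈ ρ.support}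
      ∪ {ω | flag t ω = false ∧ sample t ω ∈ ρ.support} := by
    ext ω
    simp only [Set.mem_union, Set.mem_ofPred_eq]
    cases flag t ω <;> simp
  have hP : P {ω | sample t ω ∈ ρ.support} = 1 := by
    rw [e, measure_union _ (hm false), hc.half_le hρ ht, hc.half_le hρ ht, one_div,
      ENNReal.inv_two_add_inv_two]
    exact Set.disjoint_left.2 fun ω h1 h2 => by
      have := h1.1.symm.trans h2.1
      simp at this
  have hms : MeasurableSet {ω | sample t ω ∈ ρ.support} := by rw [e]; exact (hm _).union (hm _)
  rw [ae_iff]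
  exact (prob_compl_eq_zero_iff hms).2 hP

lemma IsCoinSequence.measure_flag [IsProbabilityMeasure P]
    (hc : IsCoinSequence P ℱ T ρ flag sample) {X : Set (Vec d)}
    (hρ : IsDesign X ρ) {t : ℕ} (ht : t < T) (f : Bool) : P {ω | flag t ω = f} = 1 / 2 := by
  rw [← hc.half_le hρ ht f]
  refine measure_congr ?_
  filter_upwards [hc.ae_sample_mem hρ ht] with ω hω
  exact propext ⟨fun h => ⟨h, hω⟩, fun h => h.1⟩

/-- The number of flags `D` in the rounds `s ≤ i < n`. -/
def flagCount (flag : ℕ → Bool) (s n : ℕ) : ℕ := ((Finset.Ico s n).filter fun i => flag i).card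

lemma flagCount_succ (flag : ℕ → Bool) {s n : ℕ} (h : s ≤ n) :
    flagCount flag s (n + 1) = flagCount flag s n + if flag n then 1 else 0 := by
  rw [flagCount, flagCount, Finset.card_filter, Finset.card_filter, Finset.sum_Ico_succ_top h]

/-- Each centered flag is independent of the past and contributes a factor cosh(ζ/2) ≤ exp(ζ²/8).
Measurability is carried through the induction since the independence step uses it. -/
lemma IsCoinSequence.lintegral_exp_flagCount_le [IsProbabilityMeasure P]
    (hc : IsCoinSequence P ℱ T ρ flag sample) {X : Set (Vec d)}
    (hρ : IsDesign X ρ) (ζ : ℝ) {s n : ℕ} (hsn : s ≤ n) (hn : n ≤ T) :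
    (Measurable[ℱ n] fun ω => ENNReal.ofReal
        (Real.exp (ζ * ((n - s) / 2 - flagCount (fun i => flag i ω) s n)))) ∧
    ∫⁻ ω, ENNReal.ofReal (Real.exp (ζ * ((n - s) / 2 - flagCount (fun i => flag i ω) s n))) ∂P
      ≤ ENNReal.ofReal (Real.exp (ζ ^ 2 / 8 * (n - s))) := by
  induction n, hsn using Nat.le_induction with
  | base => simp [flagCount]
  | succ n hsn ih =>
    obtain ⟨ihm, ih⟩ := ih (by omega)
    have hnT : n < T := by omega
    set g : Ω → ENNReal := fun ω =>
      ENNReal.ofReal (Real.exp (ζ * (1 / 2 - if flag n ω then 1 else 0)))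
    have hg : Measurable[coinInfo flag sample n] g :=
      (measurable_of_countable (fun b : Bool =>
        ENNReal.ofReal (Real.exp (ζ * (1 / 2 - if b then 1 else 0))))).comp
        (measurable_flag_coinInfo n)
    have e : ∀ ω, ENNReal.ofReal (Real.exp (ζ * ((((n + 1 : ℕ) : ℝ) - s) / 2
        - flagCount (fun i => flag i ω) s (n + 1))))
        = g ω * ENNReal.ofReal (Real.exp (ζ * ((n - s) / 2 - flagCount (fun i => flag i ω) s n))) := by
      intro ω
      rw [← ENNReal.ofReal_mul (Real.exp_pos _).le, ← Real.exp_add, flagCount_succ _ hsn]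
      congr 2
      push_cast
      ring
    simp_rw [e]
    refine ⟨(hg.mono (hc.adapted n hnT) le_rfl).mul (ihm.mono (ℱ.mono (Nat.le_succ n)) le_rfl), ?_⟩
    rw [lintegral_mul_eq_lintegral_mul_lintegral_of_independent_measurableSpace
      (hc.coinInfo_le hnT) (ℱ.le n) (hc.indep n hnT) hg ihm]
    have hgi : ∫⁻ ω, g ω ∂P ≤ ENNReal.ofReal (Real.exp (ζ ^ 2 / 8)) := by
      have hm := hc.measurableSet_flag hnT true
      have hcompl : {ω | flag n ω = true}ᶜ = {ω | flag n ω = false} := by ext ω; simp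
      rw [← lintegral_add_compl g hm, hcompl,
        setLIntegral_congr_fun hm (g := fun _ => ENNReal.ofReal (Real.exp (-(ζ / 2))))
          (fun ω (hω : flag n ω = true) => by
            simp only [g, hω, if_true]; congr 2; ring),
        setLIntegral_congr_fun (hc.measurableSet_flag hnT false)
          (g := fun _ => ENNReal.ofReal (Real.exp (ζ / 2)))
          (fun ω (hω : flag n ω = false) => by
            simp only [g, hω]; congr 2; simp; ring),
        setLIntegral_const, setLIntegral_const, hc.measure_flag hρ hnT, hc.measure_flag hρ hnT,
        ← add_mul, ← ENNReal.ofReal_add (Real.exp_pos _).le (Real.exp_pos _).le]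
      have h2 : (1 / 2 : ENNReal) = ENNReal.ofReal (1 / 2) := by
        rw [ENNReal.ofReal_div_of_pos two_pos]; simp
      rw [h2, ← ENNReal.ofReal_mul (by positivity)]
      refine ENNReal.ofReal_le_ofReal ?_
      have := Real.cosh_le_exp_half_sq (ζ / 2)
      rw [Real.cosh_eq] at this
      refine le_trans (le_of_eq ?_) (this.trans (le_of_eq ?_))
      · ring
      · congr 1; ring
    calc (∫⁻ ω, g ω ∂P) * _ ≤ ENNReal.ofReal (Real.exp (ζ ^ 2 / 8))
          * ENNReal.ofReal (Real.exp (ζ ^ 2 / 8 * (n - s))) := mul_le_mul' hgi ih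
      _ = _ := by
        rw [← ENNReal.ofReal_mul (Real.exp_pos _).le, ← Real.exp_add]
        congr 2
        push_cast
        ring

/-- Hoeffding's inequality for the flags. -/
lemma IsCoinSequence.measure_flagCount_lt_le [IsProbabilityMeasure P]
    (hc : IsCoinSequence P ℱ T ρ flag sample) {X : Set (Vec d)}
    (hρ : IsDesign X ρ) {s n : ℕ} (hsn : s ≤ n) (hn : n ≤ T) :
    P {ω | (flagCount (fun i => flag i ω) s n : ℝ) < ((n : ℝ) - s) / 2 - ((n : ℝ) - s) / 7}
      ≤ ENNReal.ofReal (Real.exp (-(2 / 49 * ((n : ℝ) - s)))) := by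
  -- Per round the exponent is ζ²/8 - ζ/7, which is minimal at ζ = 4/7 with value -2/49.
  obtain ⟨hm, hle⟩ := hc.lintegral_exp_flagCount_le hρ (4 / 7) hsn hn
  have hmk := mul_meas_ge_le_lintegral (μ := P) (hm.mono (ℱ.le n) le_rfl)
    (ENNReal.ofReal (Real.exp (4 / 7 * (((n : ℝ) - s) / 7))))
  have h1 : P {ω | (flagCount (fun i => flag i ω) s n : ℝ) < ((n : ℝ) - s) / 2 - ((n : ℝ) - s) / 7}
      ≤ P {ω | ENNReal.ofReal (Real.exp (4 / 7 * (((n : ℝ) - s) / 7))) ≤ ENNReal.ofReal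
        (Real.exp (4 / 7 * (((n : ℝ) - s) / 2 - flagCount (fun i => flag i ω) s n)))} := by
    refine measure_mono fun ω hω => ?_
    have hω' : (flagCount (fun i => flag i ω) s n : ℝ) < ((n : ℝ) - s) / 2 - ((n : ℝ) - s) / 7 := hω
    refine ENNReal.ofReal_le_ofReal (Real.exp_le_exp.2 ?_)
    linarith
  refine h1.trans ?_
  have h3 : P {ω | ENNReal.ofReal (Real.exp (4 / 7 * (((n : ℝ) - s) / 7))) ≤ ENNReal.ofReal
        (Real.exp (4 / 7 * (((n : ℝ) - s) / 2 - flagCount (fun i => flag i ω) s n)))}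
      ≤ ENNReal.ofReal (Real.exp ((4 / 7) ^ 2 / 8 * (n - s)))
        / ENNReal.ofReal (Real.exp (4 / 7 * (((n : ℝ) - s) / 7))) := by
    rw [ENNReal.le_div_iff_mul_le (Or.inl (by simp [Real.exp_pos])) (Or.inl ENNReal.ofReal_ne_top),
      mul_comm]
    exact hmk.trans hle
  refine h3.trans (le_of_eq ?_)
  rw [← ENNReal.ofReal_div_of_pos (Real.exp_pos _), ← Real.exp_sub]
  congr 2
  ring

/-- The mean of a linear function of the drawn arm on the event of the flag `U`. -/
lemma IsCoinSequence.integral_sample [IsProbabilityMeasure P]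
    (hc : IsCoinSequence P ℱ T ρ flag sample) {X : Set (Vec d)}
    (hρ : IsDesign X ρ) {t : ℕ} (ht : t < T) (θ : Vec d) :
    Integrable (fun ω => if flag t ω then 0 else sample t ω ⬝ᵥ θ) P ∧
    ∫ ω, (if flag t ω then 0 else sample t ω ⬝ᵥ θ) ∂P
      = ((ρ.sum fun x w => w • x) ⬝ᵥ θ) / 2 := by
  classical
  set A : Vec d → Set Ω := fun z => {ω | flag t ω = false ∧ sample t ω = z}
  have hA : ∀ z, MeasurableSet (A z) := hc.measurableSet_coin ht false
  have e : (fun ω => if flag t ω then 0 else sample t ω ⬝ᵥ θ) =ᵐ[P]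
      fun ω => ∑ z ∈ ρ.support, (A z).indicator (fun _ => z ⬝ᵥ θ) ω := by
    filter_upwards [hc.ae_sample_mem hρ ht] with ω hω
    cases hf : flag t ω
    · rw [Finset.sum_eq_single_of_mem _ hω]
      · simp [A, hf]
      · intro z _ hz
        refine Set.indicator_of_notMem (fun h => hz ?_) _
        exact h.2.symm
    · simp [A, hf]
  have hint : ∀ z ∈ ρ.support, Integrable ((A z).indicator fun _ : Ω => z ⬝ᵥ θ) P := fun z _ =>
    (integrable_const _).indicator (hA z)
  refine ⟨(integrable_finsetSum _ hint).congr e.symm, ?_⟩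
  rw [integral_congr_ae e, integral_finsetSum _ hint, Finsupp.sum, sum_dotProduct,
    Finset.sum_div]
  refine Finset.sum_congr rfl fun z _ => ?_
  rw [integral_indicator_const _ (hA z), measureReal_def, hc.law t ht,
    ENNReal.toReal_ofReal (div_nonneg (hρ.nonneg z) zero_le_two), smul_dotProduct, smul_eq_mul,
    smul_eq_mul]
  ring

end Coins

/-! ### The round robin queue -/

/-- The number of remaining pulls of `z`. -/
noncomputable def remaining {d : ℕ} (z : Vec d) (q : List (Vec d × ℕ)) : ℕ :=
  (q.map fun p => if p.1 = z then p.2 else 0).sum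

/-- The number of remaining pulls of all arms. -/
def totalRemaining {d : ℕ} (q : List (Vec d × ℕ)) : ℕ := (q.map Prod.snd).sum

lemma remaining_le_total {d : ℕ} (z : Vec d) (q : List (Vec d × ℕ)) :
    remaining z q ≤ totalRemaining q := by
  refine List.sum_le_sum fun p _ => ?_
  split_ifs
  · exact le_rfl
  · exact Nat.zero_le _

lemma pos_of_mem_serveQueue {d : ℕ} {q : List (Vec d × ℕ)} (h : ∀ p ∈ q, 1 ≤ p.2) :
    ∀ p ∈ serveQueue q, 1 ≤ p.2 := by
  rcases q with _ | ⟨⟨z, c⟩, q⟩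
  · simp [serveQueue]
  · intro p hp
    rw [serveQueue] at hp
    split_ifs at hp with hc
    · exact h p (List.mem_cons_of_mem _ hp)
    · rcases List.mem_append.1 hp with hp | hp
      · exact h p (List.mem_cons_of_mem _ hp)
      · rw [List.mem_singleton] at hp
        rw [hp]
        dsimp only
        omega

lemma totalRemaining_serveQueue {d : ℕ} {q : List (Vec d × ℕ)} (h : ∀ p ∈ q, 1 ≤ p.2) :
    totalRemaining (serveQueue q) = totalRemaining q - 1 := by
  rcases q with _ | ⟨⟨z, c⟩, q⟩
  · rfl
  · have hc1 : 1 ≤ c := h _ List.mem_cons_self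
    rw [serveQueue]
    split_ifs with hc
    · simp [totalRemaining]; omega
    · simp [totalRemaining]; omega

lemma remaining_serveQueue {d : ℕ} {q : List (Vec d × ℕ)} (h : ∀ p ∈ q, 1 ≤ p.2) (z : Vec d) :
    remaining z q = remaining z (serveQueue q) +
      open scoped Classical in (if ∃ c q', q = (z, c) :: q' then 1 else 0) := by
  classical
  rcases q with _ | ⟨⟨y, c⟩, q⟩
  · simp [remaining, serveQueue]
  · have hc1 : 1 ≤ c := h _ List.mem_cons_self
    by_cases hy : y = z
    · have : ∃ c' q', (y, c) :: q = (z, c') :: q' := ⟨c, q, by rw [hy]⟩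
      rw [if_pos this, serveQueue]
      split_ifs with hc
      · simp [remaining, hy]; omega
      · simp [remaining, hy]; omega
    · have : ¬ ∃ c' q', (y, c) :: q = (z, c') :: q' := by
        rintro ⟨c', q', h⟩
        rw [List.cons.injEq, Prod.mk.injEq] at h
        exact hy h.1.1
      rw [if_neg this, serveQueue]
      split_ifs with hc
      · simp [remaining, hy]
      · simp [remaining, hy]

section Queue

variable {d : ℕ} {order : Finset (Vec d) → List (Vec d)} {l : Vec d →₀ ℝ} {n : ℕ}
  {flag : ℕ → Bool} {start : ℕ}

lemma pos_of_mem_queueAfter (h0 : ∀ p ∈ initialQueue order l n, 1 ≤ p.2) (j : ℕ) :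
    ∀ p ∈ queueAfter order l n flag start j, 1 ≤ p.2 := by
  induction j with
  | zero => exact h0
  | succ j ih =>
    rw [queueAfter]
    split_ifs
    · exact pos_of_mem_serveQueue ih
    · exact ih

/-- Each flag D uses up exactly one pull; truncated subtraction accounts for the flags shown after
the queue is empty. -/
lemma totalRemaining_queueAfter (h0 : ∀ p ∈ initialQueue order l n, 1 ≤ p.2) (j : ℕ) :
    totalRemaining (queueAfter order l n flag start j)
      = totalRemaining (initialQueue order l n) - flagCount flag start (start + j) := by
  induction j with
  | zero => simp [queueAfter, flagCount]
  | succ j ih =>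
    rw [queueAfter, ← add_assoc, flagCount_succ _ (Nat.le_add_right _ _)]
    split_ifs with hf
    · rw [totalRemaining_serveQueue (pos_of_mem_queueAfter h0 j), ih]; omega
    · rw [ih, add_zero]

/-- Only an inequality: a draw from ρ may also hit `z`, without touching the queue. -/
lemma remaining_queueAfter (h0 : ∀ p ∈ initialQueue order l n, 1 ≤ p.2) (sample arm : ℕ → Vec d)
    (z : Vec d) (j : ℕ)
    (harm : ∀ i < j, arm (start + i) = pulledArm (flag (start + i)) (sample (start + i))
      (queueAfter order l n flag start i)) :
    remaining z (initialQueue order l n) ≤ remaining z (queueAfter order l n flag start j)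
      + ((Finset.Ico start (start + j)).filter fun i => arm i = z).card := by
  classical
  induction j with
  | zero => simp [queueAfter]
  | succ j ih =>
    have ih := ih fun i hi => harm i (by omega)
    rw [Finset.card_filter] at ih ⊢
    rw [← add_assoc, Finset.sum_Ico_succ_top (Nat.le_add_right _ _), queueAfter]
    split_ifs with hf hz hz
    · have := remaining_serveQueue (pos_of_mem_queueAfter (flag := flag) (start := start) h0 j) z
      split_ifs at this <;> omega
    · have := remaining_serveQueue (pos_of_mem_queueAfter (flag := flag) (start := start) h0 j) z
      split_ifs at this with hq
      · obtain ⟨c, q', hq⟩ := hq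
        refine absurd ?_ hz
        rw [harm j (Nat.lt_succ_self j), hf, hq]
        rfl
      · omega
    · omega
    · omega

lemma remaining_initialQueue (ho : IsEnumeration order) {z : Vec d} (hz : z ∈ l.support) :
    remaining z (initialQueue order l n) = ⌈l z * n / 3⌉₊ := by
  classical
  obtain ⟨hnd, hmem⟩ := ho l.support
  rw [remaining, initialQueue, List.map_map]
  have h := List.sum_toFinset
    ((fun p : Vec d × ℕ => if p.1 = z then p.2 else 0) ∘ fun z => (z, ⌈l z * n / 3⌉₊)) hnd
  rw [← h, Finset.sum_eq_single z]
  · simp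
  · intro y _ hy
    simp [hy]
  · intro hz'
    exact absurd (List.mem_toFinset.2 ((hmem z).2 hz)) hz'

lemma totalRemaining_initialQueue (ho : IsEnumeration order) :
    totalRemaining (initialQueue order l n) = ∑ z ∈ l.support, ⌈l z * n / 3⌉₊ := by
  classical
  obtain ⟨hnd, hmem⟩ := ho l.support
  rw [totalRemaining, initialQueue, List.map_map]
  have h := List.sum_toFinset (Prod.snd ∘ fun z => (z, ⌈l z * n / 3⌉₊)) hnd
  rw [← h]
  refine Finset.sum_congr ?_ fun _ _ => rfl
  ext z
  rw [List.mem_toFinset, hmem]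

lemma pos_of_mem_initialQueue {S : Set (Vec d)} (ho : IsEnumeration order) (hl : IsDesign S l)
    (hn : 0 < n) : ∀ p ∈ initialQueue order l n, 1 ≤ p.2 := by
  intro p hp
  obtain ⟨z, hz, rfl⟩ := List.mem_map.1 hp
  have hz' := ((ho l.support).2 z).1 hz
  have : 0 < l z := lt_of_le_of_ne (hl.nonneg z) (Ne.symm (Finsupp.mem_support_iff.1 hz'))
  have hn' : (0 : ℝ) < n := by exact_mod_cast hn
  exact Nat.ceil_pos.2 (by positivity)

/-- Rounding up costs at most one pull per support point; here the bound on the size of the support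
enters. -/
lemma sum_ceil_le {S : Set (Vec d)} (hl : IsDOptimal S l) {c : ℝ} (hc : 0 ≤ c) :
    ((∑ z ∈ l.support, ⌈l z * c⌉₊ : ℕ) : ℝ) ≤ c + d * (d + 1) / 2 := by
  push_cast
  have h1 : ∀ z ∈ l.support, (⌈l z * c⌉₊ : ℝ) ≤ l z * c + 1 := fun z _ =>
    (Nat.ceil_lt_add_one (mul_nonneg (hl.design.nonneg z) hc)).le
  refine (Finset.sum_le_sum h1).trans ?_
  have hs : ∑ z ∈ l.support, l z = 1 := hl.design.sum_one
  rw [Finset.sum_add_distrib, ← Finset.sum_mul, hs, one_mul, Finset.sum_const, nsmul_eq_mul,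
    mul_one]
  have h2 : (l.support.card : ℝ) ≤ ((d * (d + 1) / 2 : ℕ) : ℝ) := by exact_mod_cast hl.card_le
  have h3 : ((d * (d + 1) / 2 : ℕ) : ℝ) ≤ ((d * (d + 1) : ℕ) : ℝ) / ((2 : ℕ) : ℝ) := Nat.cast_div_le
  push_cast at h3
  linarith

/-- If each support point `z` is pulled `l(z) c` times, the Gram matrix dominates `c U(l)`. -/
lemma mul_designMatrix_quad_le {arm : ℕ → Vec d} {s t : ℕ}
    {c : ℝ} (h : ∀ z ∈ l.support, l z * c ≤ 
      ((Finset.Ico s t).filter fun i => arm i = z).card) (v : Vec d) :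
    c * (v ⬝ᵥ (designMatrix l *ᵥ v)) ≤ v ⬝ᵥ (gramMatrix arm s t *ᵥ v) := by
  classical
  rw [designMatrix_mulVec_quad, gramMatrix_quad, Finsupp.sum, Finset.mul_sum]
  calc ∑ z ∈ l.support, c * (l z * (z ⬝ᵥ v) ^ 2)
      ≤ ∑ z ∈ l.support, ∑ i ∈ Finset.Ico s t, if arm i = z then (z ⬝ᵥ v) ^ 2 else 0 := by
        refine Finset.sum_le_sum fun z hz => ?_
        rw [← Finset.sum_filter, Finset.sum_const, nsmul_eq_mul]
        have := mul_le_mul_of_nonneg_right (h z hz) (sq_nonneg (z ⬝ᵥ v))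
        convert this using 1
        ring
    _ = ∑ i ∈ Finset.Ico s t, ∑ z ∈ l.support, if arm i = z then (z ⬝ᵥ v) ^ 2 else 0 :=
        Finset.sum_comm
    _ ≤ ∑ i ∈ Finset.Ico s t, (arm i ⬝ᵥ v) ^ 2 := by
        refine Finset.sum_le_sum fun i _ => ?_
        rw [Finset.sum_ite_eq]
        split_ifs
        · exact le_rfl
        · exact sq_nonneg _

/-- A call of `PullArms` with sufficiently many flags `D` makes the Gram matrix grow by at least
`n / 3` times the design matrix. -/
lemma pullArms_quad_le {S : Set (Vec d)} (ho : IsEnumeration order) (hl : IsDOptimal S l)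
    (hn : 0 < n) (hcount : (n : ℝ) / 3 + d * (d + 1) / 2 ≤ flagCount flag start (start + n))
    {sample arm : ℕ → Vec d}
    (harm : ∀ i < n, arm (start + i) = pulledArm (flag (start + i)) (sample (start + i))
      (queueAfter order l n flag start i)) (v : Vec d) :
    (n : ℝ) / 3 * (v ⬝ᵥ (designMatrix l *ᵥ v))
      ≤ v ⬝ᵥ (gramMatrix arm start (start + n) *ᵥ v) := by
  classical
  have h0 := pos_of_mem_initialQueue ho hl.design hn
  refine mul_designMatrix_quad_le (fun z hz => ?_) v
  have h1 := remaining_queueAfter h0 sample arm z n harm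
  have h2 := totalRemaining_queueAfter (flag := flag) (start := start) h0 n
  have h3 := remaining_le_total z (queueAfter order l n flag start n)
  have h4 : totalRemaining (initialQueue order l n) ≤ flagCount flag start (start + n) := by
    -- There are enough flags D to empty the queue, and once it is empty every support point has
    -- received its quota.
    have := sum_ceil_le hl (c := (n : ℝ) / 3) (by positivity)
    simp only [← mul_div_assoc] at this
    rw [totalRemaining_initialQueue ho]
    exact_mod_cast this.trans hcount
  rw [remaining_initialQueue ho hz] at h1
  have h5 : ⌈l z * n / 3⌉₊ ≤ ((Finset.Ico start (start + n)).filter fun i => arm i = z).card := by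
    omega
  rw [← mul_div_assoc]
  exact (Nat.le_ceil _).trans (by exact_mod_cast h5)

end Queue

/-! ### Rewards and estimation errors -/

lemma continuous_dotProduct_right {d : ℕ} (θ : Vec d) : Continuous fun x : Vec d => x ⬝ᵥ θ := by
  simp only [dotProduct]; fun_prop

lemma exists_maxReward_eq {d : ℕ} {S : Set (Vec d)} (hS : IsCompact S) (hne : S.Nonempty)
    (θ : Vec d) : ∃ x ∈ S, maxReward S θ = x ⬝ᵥ θ ∧ ∀ y ∈ S, y ⬝ᵥ θ ≤ x ⬝ᵥ θ := by
  obtain ⟨x, hx, hmax⟩ := hS.exists_isMaxOn hne (continuous_dotProduct_right θ).continuousOn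
  refine ⟨x, hx, ?_, fun y hy => hmax hy⟩
  refine IsGreatest.csSup_eq ⟨⟨x, hx, rfl⟩, ?_⟩
  rintro _ ⟨y, hy, rfl⟩
  exact hmax hy

lemma le_maxReward {d : ℕ} {S : Set (Vec d)} (hS : IsCompact S) (θ : Vec d) {y : Vec d}
    (hy : y ∈ S) : y ⬝ᵥ θ ≤ maxReward S θ := by
  obtain ⟨x, _, h, hmax⟩ := exists_maxReward_eq hS ⟨y, hy⟩ θ
  exact h ▸ hmax y hy

lemma abs_maxReward_sub_le {d : ℕ} {S : Set (Vec d)} (hS : IsCompact S) (hne : S.Nonempty)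
    {θ θ' : Vec d} {r : ℝ} (h : ∀ x ∈ S, |x ⬝ᵥ (θ' - θ)| ≤ r) :
    |maxReward S θ' - maxReward S θ| ≤ r := by
  obtain ⟨x, hx, ex, mx⟩ := exists_maxReward_eq hS hne θ
  obtain ⟨y, hy, ey, my⟩ := exists_maxReward_eq hS hne θ'
  have hx' := abs_le.1 (h x hx)
  have hy' := abs_le.1 (h y hy)
  rw [dotProduct_sub] at hx' hy'
  have := mx y hy
  have := my x hx
  rw [ex, ey, abs_le]
  constructor <;> linarith [hx'.1, hy'.2]

/-- The confidence radius `√(d² σ² log T / n)`. -/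
noncomputable def radius (d : ℕ) (σ : ℝ) (T : ℕ) (n : ℝ) : ℝ :=
  √(d ^ 2 * σ ^ 2 * Real.log T / n)

lemma radius_nonneg (d : ℕ) (σ : ℝ) (T : ℕ) (n : ℝ) : 0 ≤ radius d σ T n := Real.sqrt_nonneg _

lemma radius_sq (d : ℕ) (σ : ℝ) (T : ℕ) {n : ℝ} (hn : 0 ≤ n) :
    radius d σ T n ^ 2 = d ^ 2 * σ ^ 2 * Real.log T / n := by
  have := Real.log_natCast_nonneg T
  exact Real.sq_sqrt (by positivity)

lemma radius_le_mul_radius {d : ℕ} {σ : ℝ} {T : ℕ} {m n c : ℝ} (hm : 0 < m) (hn : 0 < n)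
    (hc : 0 ≤ c) (h : m ≤ c ^ 2 * n) : radius d σ T n ≤ c * radius d σ T m := by
  have hl := Real.log_natCast_nonneg T
  rw [radius, radius, ← Real.sqrt_sq hc, ← Real.sqrt_mul (sq_nonneg c)]
  refine Real.sqrt_le_sqrt ?_
  rw [mul_div_assoc', div_le_div_iff₀ hn hm]
  have : 0 ≤ (d : ℝ) ^ 2 * σ ^ 2 * Real.log T := by positivity
  nlinarith

/-- The error of the least squares estimate, in the norm of the Gram matrix. -/
lemma estimate_error_quad_le {d : ℕ} {arm : ℕ → Vec d} {reward : ℕ → ℝ} {θ : Vec d} {s t : ℕ}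
    {M : ℝ} (hM0 : 0 ≤ M) (hS : ∀ v : Vec d, (responseSum arm (fun i => reward i - arm i ⬝ᵥ θ) s t ⬝ᵥ v) ^ 2
      ≤ M * (v ⬝ᵥ (gramMatrix arm s t *ᵥ v))) :
    (estimate arm reward s t - θ) ⬝ᵥ (gramMatrix arm s t *ᵥ (estimate arm reward s t - θ)) ≤ M := by
  have hV := gramMatrix_mulVec_estimate arm reward s t
  rw [responseSum_decomp arm reward s t θ] at hV
  set Δ := estimate arm reward s t - θ
  have hΔ : gramMatrix arm s t *ᵥ Δ = responseSum arm (fun i => reward i - arm i ⬝ᵥ θ) s t := by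
    rw [Matrix.mulVec_sub, hV, add_sub_cancel_left]
  -- The noise is tested in the direction of the error itself: since the response of the noise is `V
  -- Δ`, this reads a² ≤ M a.
  have h := hS Δ
  rw [dotProduct_comm, ← hΔ] at h
  set a := Δ ⬝ᵥ (gramMatrix arm s t *ᵥ Δ)
  have ha : 0 ≤ a := quad_nonneg (gramMatrix_posSemidef arm s t) Δ
  rcases ha.eq_or_lt with h0 | h0
  · exact h0 ▸ hM0
  · by_contra! hM
    nlinarith

/-- Three inequalities are chained: x xᵀ ≤ d U, then c U ≤ V, then the error bound in the norm of V.
No inverse of V occurs. -/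
lemma sq_estimate_error_le {d : ℕ} {arm : ℕ → Vec d} {reward : ℕ → ℝ} {θ : Vec d} {s t : ℕ}
    {M c : ℝ} (hM0 : 0 ≤ M) (hS : ∀ v : Vec d, (responseSum arm (fun i => reward i - arm i ⬝ᵥ θ) s t ⬝ᵥ v) ^ 2
      ≤ M * (v ⬝ᵥ (gramMatrix arm s t *ᵥ v))) (hc : 0 < c) {U : Matrix (Fin d) (Fin d) ℝ}
    (hU : ∀ v : Vec d, c * (v ⬝ᵥ (U *ᵥ v)) ≤ v ⬝ᵥ (gramMatrix arm s t *ᵥ v)) {x : Vec d}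
    (hx : ∀ v : Vec d, (x ⬝ᵥ v) ^ 2 ≤ d * (v ⬝ᵥ (U *ᵥ v))) :
    (x ⬝ᵥ (estimate arm reward s t - θ)) ^ 2 ≤ d * M / c := by
  have h1 := estimate_error_quad_le hM0 hS
  have h2 := hU (estimate arm reward s t - θ)
  refine (hx _).trans ?_
  rw [mul_div_assoc]
  refine mul_le_mul_of_nonneg_left ?_ (Nat.cast_nonneg d)
  rw [le_div_iff₀ hc, mul_comm]
  exact h2.trans h1

/-! ### Phase I -/

/-- The horizon is large in comparison with the other parameters. -/
structure IsLargeHorizon (d : ℕ) (σ α₀ α₁ : ℝ) (T : ℕ) : Prop where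
  one_le_log : 1 ≤ Real.log T
  sq_le_log : (d : ℝ) ^ 2 ≤ Real.log T
  one_add_mul_le : 1 + (T : ℝ) * d ≤ (T : ℝ) ^ 2
  one_add_div_le : 1 + (T : ℝ) / (d * α₀) ≤ (T : ℝ) ^ 2
  reg_le : α₁ ≤ σ ^ 2 * Real.log T
  dim_le : 32 * ((d : ℝ) + 1) ≤ T
  log_le : 74 * Real.log T ≤ σ * √(T : ℝ)

/-- The favourable event: enough flags `D`, and the self-normalized bounds for the noise. -/
structure IsGoodPath {d : ℕ} (alg : PhaseTwo) (X : Set (Vec d)) (D : Set (Vec d) → (Vec d →₀ ℝ))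
    (order : Finset (Vec d) → List (Vec d)) (σ : ℝ) (T : ℕ) (θ : Vec d) (flag : ℕ → Bool)
    (arm : ℕ → Vec d) (reward : ℕ → ℝ) : Prop where
  flags : ∀ k, epochStart T (k + 1) ≤ T → (epochLength T k : ℝ) / 2 - epochLength T k / 7
    ≤ flagCount flag (epochStart T k) (epochStart T k + epochLength T k)
  phaseOne : ∀ t ≤ T,
    (∀ v, v ⬝ᵥ (gramMatrix arm 0 t *ᵥ v) ≤ T * d * (v ⬝ᵥ (designMatrix (D X) *ᵥ v))) →
    ∀ v, (responseSum arm (fun i => reward i - arm i ⬝ᵥ θ) 0 t ⬝ᵥ v) ^ 2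
      ≤ σ ^ 2 * (2 * Real.log T + d * Real.log (1 + T * d))
        * (v ⬝ᵥ (gramMatrix arm 0 t *ᵥ v) + v ⬝ᵥ (designMatrix (D X) *ᵥ v))
  linUCB : ∀ α, alg = PhaseTwo.linUCB α → ∀ t ≤ T, ∀ v,
    (responseSum arm (fun i => reward i - arm i ⬝ᵥ θ) 0 t ⬝ᵥ v) ^ 2
      ≤ σ ^ 2 * (2 * Real.log T + Real.log ((α • (1 : Matrix (Fin d) (Fin d) ℝ)
        + gramMatrix arm 0 t).det / (α • (1 : Matrix (Fin d) (Fin d) ℝ)).det))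
        * (v ⬝ᵥ ((α • (1 : Matrix (Fin d) (Fin d) ℝ) + gramMatrix arm 0 t) *ᵥ v))
  -- Phase I has at least one epoch, so it can end only at some `epochStart T (k + 1)`.
  linPE : alg = PhaseTwo.linPE → ∀ k e,
    let start := (episodeState X D order σ T (epochStart T (k + 1)) arm reward e).1
    let S := (episodeState X D order σ T (epochStart T (k + 1)) arm reward e).2
    let pulls := episodePulls order (D S) (episodeParam (epochStart T (k + 1)) e)
    start + pulls.length ≤ T → (∀ (j : ℕ) (h : j < pulls.length), arm (start + j) = pulls[j]) →
    ∀ v, (responseSum arm (fun i => reward i - arm i ⬝ᵥ θ) start (start + pulls.length) ⬝ᵥ v) ^ 2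
      ≤ σ ^ 2 * (8 * Real.log T + d * Real.log 4) * (4 / 3)
        * (v ⬝ᵥ (gramMatrix arm start (start + pulls.length) *ᵥ v))

lemma epochStart_succ (T k : ℕ) : epochStart T (k + 1) = epochStart T k + epochLength T k :=
  Finset.sum_range_succ _ _

lemma epochStart_zero (T : ℕ) : epochStart T 0 = 0 := rfl

/-- A geometric sum. An epoch that starts after n rounds therefore ends after 2n + ⌈72 log T⌉
rounds, so stopping only at epoch ends costs little more than a factor two. -/
lemma epochStart_add (T k : ℕ) : epochStart T k + ⌈72 * Real.log T⌉₊ = epochLength T k := by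
  induction k with
  | zero => simp [epochStart, epochLength]
  | succ k ih =>
    rw [epochStart_succ, add_right_comm, ih, epochLength, epochLength, pow_succ]
    ring

lemma epochStart_mono (T : ℕ) : Monotone (epochStart T) :=
  monotone_nat_of_le_succ fun k => by rw [epochStart_succ]; exact Nat.le_add_right _ _

lemma gramMatrix_add {d : ℕ} (arm : ℕ → Vec d) {a b c : ℕ} (hab : a ≤ b) (hbc : b ≤ c) :
    gramMatrix arm a b + gramMatrix arm b c = gramMatrix arm a c :=
  Finset.sum_Ico_consecutive _ hab hbc

lemma gramMatrix_quad_mono {d : ℕ} (arm : ℕ → Vec d) {a b c : ℕ} (hab : a ≤ b) (hbc : b ≤ c)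
    (v : Vec d) : v ⬝ᵥ (gramMatrix arm a b *ᵥ v) ≤ v ⬝ᵥ (gramMatrix arm a c *ᵥ v) := by
  rw [← gramMatrix_add arm hab hbc, Matrix.add_mulVec, dotProduct_add]
  exact le_add_of_nonneg_right (quad_nonneg (gramMatrix_posSemidef arm b c) v)

section PhaseOne

variable {d : ℕ} {σ α₀ α₁ : ℝ} {T : ℕ} {X : Set (Vec d)} {θ : Vec d} {alg : PhaseTwo}
  {D : Set (Vec d) → (Vec d →₀ ℝ)} {order : Finset (Vec d) → List (Vec d)}
  {flag : ℕ → Bool} {sample arm : ℕ → Vec d} {reward : ℕ → ℝ}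

lemma IsLargeHorizon.ceil_ge (hT : IsLargeHorizon d σ α₀ α₁ T) :
    (72 : ℝ) ≤ (⌈72 * Real.log T⌉₊ : ℝ) ∧ 72 * (d : ℝ) ^ 2 ≤ (⌈72 * Real.log T⌉₊ : ℝ) := by
  have h := Nat.le_ceil (72 * Real.log T)
  have h1 := hT.one_le_log
  have h2 := hT.sq_le_log
  constructor <;> linarith

lemma ceil_le_epochLength (T k : ℕ) : ⌈72 * Real.log T⌉₊ ≤ epochLength T k :=
  Nat.le_mul_of_pos_left _ (by positivity)

lemma ceil_le_epochStart_succ (T k : ℕ) : ⌈72 * Real.log T⌉₊ ≤ epochStart T (k + 1) := by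
  rw [epochStart_succ]
  exact (ceil_le_epochLength T k).trans (Nat.le_add_left _ _)

/-- At the end of each completed epoch the Gram matrix dominates a third of the number of rounds
times the design matrix. -/
lemma phaseOne_quad_le (hd : 0 < d) (hT : IsLargeHorizon d σ α₀ α₁ T) (hX : X.Nonempty)
    (hXc : IsCompact X) (hD : IsDesignOracle X D) (ho : IsEnumeration order)
    (hg : IsGoodPath alg X D order σ T θ flag arm reward)
    (hf : FollowsFairLinBandit alg X D order σ T flag sample arm reward) {k : ℕ}
    (hk : ∀ k' < k, PhaseOneContinues X σ T arm reward (epochStart T k'))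
    (hkT : epochStart T k ≤ T) (v : Vec d) :
    (epochStart T k : ℝ) / 3 * (v ⬝ᵥ (designMatrix (D X) *ᵥ v))
      ≤ v ⬝ᵥ (gramMatrix arm 0 (epochStart T k) *ᵥ v) := by
  induction k with
  | zero => simp [epochStart, gramMatrix]
  | succ k ih =>
    have ih := ih (fun k' h => hk k' (by omega))
      ((epochStart_mono T (Nat.le_succ k)).trans hkT)
    obtain ⟨h72, h72d⟩ := hT.ceil_ge
    have hL : (⌈72 * Real.log T⌉₊ : ℝ) ≤ epochLength T k := by
      exact_mod_cast ceil_le_epochLength T k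
    have hd1 : (1 : ℝ) ≤ d := by exact_mod_cast hd
    have hepoch := pullArms_quad_le (flag := flag) (start := epochStart T k) (n := epochLength T k)
      (sample := sample) (arm := arm) ho (hD X le_rfl hX hXc)
      (by
        have : (0 : ℝ) < epochLength T k := by linarith
        exact_mod_cast this)
      (by
        -- 1/2 - 1/7 exceeds 1/3 by 1/42, and n/42 covers the rounding term d(d+1)/2 because n ≥ 72
        -- d².
        have := hg.flags k hkT
        nlinarith)
      (fun j hj => hf.phaseOne k (fun k' h => hk k' (by omega)) j hj (by
        rw [epochStart_succ] at hkT; omega)) v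
    rw [epochStart_succ, ← gramMatrix_add arm (Nat.zero_le _) (Nat.le_add_right _ _),
      Matrix.add_mulVec, dotProduct_add]
    push_cast
    linarith

/-- The estimation error at the end of each completed epoch. -/
lemma phaseOne_error_le (hd : 0 < d) (hT : IsLargeHorizon d σ α₀ α₁ T) (hX : X.Nonempty)
    (hXc : IsCompact X) (hD : IsDesignOracle X D) (ho : IsEnumeration order)
    (hg : IsGoodPath alg X D order σ T θ flag arm reward)
    (hf : FollowsFairLinBandit alg X D order σ T flag sample arm reward)
    (harm : ∀ i < T, arm i ∈ X) {k : ℕ}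
    (hk : ∀ k' < k + 1, PhaseOneContinues X σ T arm reward (epochStart T k'))
    (hkT : epochStart T (k + 1) ≤ T) {x : Vec d} (hx : x ∈ X) :
    |x ⬝ᵥ (estimate arm reward 0 (epochStart T (k + 1)) - θ)|
      ≤ 4 * radius d σ T (epochStart T (k + 1)) := by
  have hopt := hD X le_rfl hX hXc
  have hV := phaseOne_quad_le hd hT hX hXc hD ho hg hf hk hkT
  have hn72 : (⌈72 * Real.log T⌉₊ : ℝ) ≤ (epochStart T (k + 1) : ℝ) := by
    exact_mod_cast ceil_le_epochStart_succ T k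
  have hnT : (epochStart T (k + 1) : ℝ) ≤ T := by exact_mod_cast hkT
  set n := epochStart T (k + 1)
  obtain ⟨h72, h72d⟩ := hT.ceil_ge
  have hn : (0 : ℝ) < n := by linarith
  have hlog := hT.one_le_log
  have hd1 : (1 : ℝ) ≤ d := by exact_mod_cast hd
  -- Every pulled arm satisfies x xᵀ ≤ d U, so the precondition of the noise bound in `IsGoodPath`
  -- holds along the whole path.
  have hup : ∀ v : Vec d, v ⬝ᵥ (gramMatrix arm 0 n *ᵥ v)
      ≤ T * d * (v ⬝ᵥ (designMatrix (D X) *ᵥ v)) := by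
    intro v
    rw [gramMatrix_quad]
    refine (Finset.sum_le_sum fun i hi => hopt.sq_dotProduct_le
      (harm i ((Finset.mem_Ico.1 hi).2.trans_le hkT)) v).trans ?_
    have := quad_nonneg (designMatrix_posSemidef hopt.design) v
    rw [Finset.sum_const, Nat.card_Ico, nsmul_eq_mul, Nat.sub_zero, mul_assoc]
    exact mul_le_mul_of_nonneg_right hnT (by positivity)
  have hlog2 : Real.log (1 + T * d) ≤ 2 * Real.log T := by
    have := Real.log_le_log (by positivity) hT.one_add_mul_le
    rwa [Real.log_pow] at this
  -- 4 d log T bounds 2 log T + d log(1 + Td). The factor 25/24 pays for the regularizer: U ≤ V/24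
  -- because n/3 ≥ 24. In the end d M / (n/3) = 12.5 d²σ² log T / n, below the 16 that is needed.
  set M : ℝ := σ ^ 2 * (4 * d * Real.log T) * (25 / 24)
  have hS : ∀ v : Vec d, (responseSum arm (fun i => reward i - arm i ⬝ᵥ θ) 0 n ⬝ᵥ v) ^ 2
      ≤ M * (v ⬝ᵥ (gramMatrix arm 0 n *ᵥ v)) := by
    intro v
    refine (hg.phaseOne n hkT hup v).trans ?_
    have h1 : 2 * Real.log T + d * Real.log (1 + T * d) ≤ 4 * d * Real.log T := by nlinarith
    have h2 : v ⬝ᵥ (gramMatrix arm 0 n *ᵥ v) + v ⬝ᵥ (designMatrix (D X) *ᵥ v)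
        ≤ 25 / 24 * (v ⬝ᵥ (gramMatrix arm 0 n *ᵥ v)) := by
      have h3 := hV v
      have h4 := quad_nonneg (designMatrix_posSemidef hopt.design) v
      nlinarith
    have h5 := quad_nonneg (gramMatrix_posSemidef arm 0 n) v
    have h6 := quad_nonneg (designMatrix_posSemidef hopt.design) v
    calc σ ^ 2 * (2 * Real.log T + d * Real.log (1 + T * d))
        * (v ⬝ᵥ (gramMatrix arm 0 n *ᵥ v) + v ⬝ᵥ (designMatrix (D X) *ᵥ v))
        ≤ σ ^ 2 * (4 * d * Real.log T) * (25 / 24 * (v ⬝ᵥ (gramMatrix arm 0 n *ᵥ v))) :=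
          mul_le_mul (mul_le_mul_of_nonneg_left h1 (sq_nonneg σ)) h2 (by positivity) (by positivity)
      _ = M * (v ⬝ᵥ (gramMatrix arm 0 n *ᵥ v)) := by ring
  have hsq := sq_estimate_error_le (by positivity) hS (by positivity : (0 : ℝ) < n / 3) hV
    (hopt.sq_dotProduct_le hx)
  refine abs_le_of_sq_le_sq (hsq.trans ?_) (by have := radius_nonneg d σ T n; positivity)
  rw [mul_pow, radius_sq _ _ _ hn.le, mul_div_assoc', div_le_div_iff₀ (by positivity) hn]
  have : 0 ≤ (d : ℝ) ^ 2 * σ ^ 2 * Real.log T * n := by positivity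
  simp only [M]
  nlinarith

/-- The failed second test says |m - √48 q| > 30 q. The negative branch contradicts m ≥ μ - 4p ≥
-4p, and the positive one gives m > 36.9 q. The constant 32 makes a gap of 16 radii at most half of
the best reward. -/
lemma le_of_stops (hX : X.Nonempty) (hXc : IsCompact X)
    (hθ : ∀ x ∈ X, 0 ≤ x ⬝ᵥ θ) {n : ℕ} (hn : 72 ≤ n)
    (herr : ∀ x ∈ X, |x ⬝ᵥ (estimate arm reward 0 n - θ)| ≤ 4 * radius d σ T n)
    (hended : ¬ PhaseOneContinues X σ T arm reward n) :
    32 * radius d σ T n ≤ maxReward X θ := by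
  have hm := abs_le.1 (abs_maxReward_sub_le hXc hX herr)
  have hμ : 0 ≤ maxReward X θ := by
    obtain ⟨x, hx⟩ := hX
    exact (hθ x hx).trans (le_maxReward hXc θ hx)
  simp only [PhaseOneContinues, not_or, not_le] at hended
  obtain ⟨h1, h2⟩ := hended
  set m := maxReward X (estimate arm reward 0 n)
  set p := radius d σ T n
  set q := radius d σ T ((n : ℝ) + 1)
  have hn' : (72 : ℝ) ≤ n := by exact_mod_cast hn
  have hp : 0 ≤ p := radius_nonneg _ _ _ _
  have hq : 0 ≤ q := radius_nonneg _ _ _ _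
  -- The test uses t = n + 1 while the error bound uses n; for n ≥ 72 the two radii differ by less
  -- than one percent.
  have hpq : p ≤ 101 / 100 * q :=
    radius_le_mul_radius (by linarith) (by linarith) (by norm_num) (by linarith)
  have hqs : q ^ 2 = d ^ 2 * σ ^ 2 * Real.log T / ((n : ℝ) + 1) := radius_sq _ _ _ (by linarith)
  have hκ : d ^ 2 * σ ^ 2 * Real.log T = ((n : ℝ) + 1) * q ^ 2 := by
    rw [hqs, mul_div_cancel₀ _ (by linarith)]
  have hsqrt : √(48 * σ ^ 2 * d ^ 2 * Real.log T / ((n : ℝ) + 1)) = √48 * q := by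
    have : 48 * σ ^ 2 * d ^ 2 * Real.log T / ((n : ℝ) + 1)
      = 48 * (d ^ 2 * σ ^ 2 * Real.log T / ((n : ℝ) + 1)) := by ring
    rw [this, Real.sqrt_mul (by norm_num)]
    rfl
  have h48 : (69 / 10 : ℝ) ≤ √48 ∧ √48 ≤ 7 := by
    constructor
    · exact Real.le_sqrt_of_sq_le (by norm_num)
    · rw [Real.sqrt_le_left (by norm_num)]; norm_num
  rw [hsqrt] at h2
  have h2' : (30 * q) ^ 2 < (m - √48 * q) ^ 2 := by
    have : ((n : ℝ) + 1) * (30 * q) ^ 2 < ((n : ℝ) + 1) * (m - √48 * q) ^ 2 := by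
      refine lt_of_le_of_lt (le_of_eq ?_) h2
      linear_combination (-900) * hκ
    exact lt_of_mul_lt_mul_left this (by linarith)
  have habs := sq_lt_sq.1 h2'
  rw [abs_of_nonneg (by positivity)] at habs
  rcases lt_abs.1 habs with h | h <;> nlinarith [h48.1, h48.2]

/-- Either test bounds the estimated maximum by (30 + 7) radii, and the estimation error adds four.
-/
lemma maxReward_le_of_continues (hX : X.Nonempty) (hXc : IsCompact X) {n : ℕ} (hn : 0 < n)
    (herr : ∀ x ∈ X, |x ⬝ᵥ (estimate arm reward 0 n - θ)| ≤ 4 * radius d σ T n)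
    (hcont : PhaseOneContinues X σ T arm reward n) :
    maxReward X θ ≤ 41 * radius d σ T n := by
  have hm := abs_le.1 (abs_maxReward_sub_le hXc hX herr)
  simp only [PhaseOneContinues] at hcont
  set m := maxReward X (estimate arm reward 0 n)
  set p := radius d σ T n
  set q := radius d σ T ((n : ℝ) + 1)
  have hn' : (0 : ℝ) < n := by exact_mod_cast hn
  have hq : 0 ≤ q := radius_nonneg _ _ _ _
  have hqp : q ≤ 1 * p :=
    radius_le_mul_radius hn' (by linarith) (by norm_num) (by linarith)
  have hqs : q ^ 2 = d ^ 2 * σ ^ 2 * Real.log T / ((n : ℝ) + 1) := radius_sq _ _ _ (by linarith)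
  have hκ : d ^ 2 * σ ^ 2 * Real.log T = ((n : ℝ) + 1) * q ^ 2 := by
    rw [hqs, mul_div_cancel₀ _ (by linarith)]
  have hsqrt : √(48 * σ ^ 2 * d ^ 2 * Real.log T / ((n : ℝ) + 1)) = √48 * q := by
    have : 48 * σ ^ 2 * d ^ 2 * Real.log T / ((n : ℝ) + 1)
      = 48 * (d ^ 2 * σ ^ 2 * Real.log T / ((n : ℝ) + 1)) := by ring
    rw [this, Real.sqrt_mul (by norm_num)]
    rfl
  have h48 : √48 ≤ 7 := by
    rw [Real.sqrt_le_left (by norm_num)]; norm_num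
  rw [hsqrt] at hcont
  have hmq : m ≤ 37 * q := by
    rcases hcont with h | h
    · have : m ^ 2 ≤ (7 * q) ^ 2 := by
        have : ((n : ℝ) + 1) * m ^ 2 ≤ ((n : ℝ) + 1) * (7 * q) ^ 2 := by
          nlinarith [sq_nonneg q]
        exact le_of_mul_le_mul_left this (by linarith)
      have := abs_le_of_sq_le_sq' this (by positivity)
      linarith [this.2]
    · have : (m - √48 * q) ^ 2 ≤ (30 * q) ^ 2 := by
        have : ((n : ℝ) + 1) * (m - √48 * q) ^ 2 ≤ ((n : ℝ) + 1) * (30 * q) ^ 2 := by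
          refine h.trans (le_of_eq ?_)
          linear_combination 900 * hκ
        exact le_of_mul_le_mul_left this (by linarith)
      have := abs_le_of_sq_le_sq' this (by positivity)
      nlinarith [this.2]
  linarith [hm.1]

/-- Without data the estimate is 0 and the first test holds trivially, so Phase I is never empty. -/
lemma phaseOneContinues_zero (hX : X.Nonempty) : PhaseOneContinues X σ T arm reward 0 := by
  have hest : estimate arm reward 0 0 = 0 := by
    have : ∃ θ : Vec d, gramMatrix arm 0 0 *ᵥ θ = responseSum arm reward 0 0
        ∧ θ ∈ LinearMap.range (gramMatrix arm 0 0).mulVecLin :=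
      ⟨0, by simp [gramMatrix_self, responseSum_self], zero_mem _⟩
    obtain ⟨u, hu⟩ := (Classical.epsilon_spec this).2
    have h0 : (gramMatrix arm 0 0).mulVecLin u = 0 := by simp [gramMatrix_self]
    exact hu.symm.trans h0
  have hmax : maxReward X (0 : Vec d) = 0 := by
    rw [maxReward]
    simp [hX.image_const]
  left
  have := Real.log_natCast_nonneg T
  rw [hest, hmax, zero_pow two_ne_zero, mul_zero]
  positivity

lemma le_epochStart (hL : 0 < ⌈72 * Real.log T⌉₊) (k : ℕ) : k ≤ epochStart T k := by
  induction k with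
  | zero => exact Nat.zero_le _
  | succ k ih =>
    rw [epochStart_succ]
    have := ceil_le_epochLength T k
    omega

/-- Every round belongs to an epoch of Phase I or to Phase II. -/
lemma phase_cases (hX : X.Nonempty) (hL : 0 < ⌈72 * Real.log T⌉₊) (i : ℕ) :
    (∃ k, (∀ k' ≤ k, PhaseOneContinues X σ T arm reward (epochStart T k')) ∧
      epochStart T k ≤ i ∧ i < epochStart T (k + 1)) ∨
    ∃ k, (∀ k' < k + 1, PhaseOneContinues X σ T arm reward (epochStart T k')) ∧
      ¬ PhaseOneContinues X σ T arm reward (epochStart T (k + 1)) ∧ epochStart T (k + 1) ≤ i := by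
  have hex : ∃ k, i < epochStart T (k + 1) := ⟨i, lt_of_lt_of_le (Nat.lt_succ_self i) (le_epochStart hL _)⟩
  classical
  set k := Nat.find hex
  have hk : i < epochStart T (k + 1) := Nat.find_spec hex
  have hki : epochStart T k ≤ i := by
    rcases Nat.eq_zero_or_pos k with h0 | h0
    · rw [h0]; exact Nat.zero_le _
    · have := Nat.find_min hex (m := k - 1) (by omega)
      rw [Nat.sub_add_cancel h0] at this
      omega
  by_cases hall : ∀ k' ≤ k, PhaseOneContinues X σ T arm reward (epochStart T k')
  · exact Or.inl ⟨k, hall, hki, hk⟩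
  · right
    push Not at hall
    have hex2 : ∃ k', ¬ PhaseOneContinues X σ T arm reward (epochStart T k') := by
      obtain ⟨k', _, h⟩ := hall
      exact ⟨k', h⟩
    set j := Nat.find hex2
    have hj : ¬ PhaseOneContinues X σ T arm reward (epochStart T j) := Nat.find_spec hex2
    have hj0 : j ≠ 0 := by
      intro h0
      rw [h0, epochStart_zero] at hj
      exact hj (phaseOneContinues_zero hX)
    obtain ⟨j', hj'⟩ := Nat.exists_eq_succ_of_ne_zero hj0
    rw [Nat.succ_eq_add_one] at hj'
    refine ⟨j', fun k' h => ?_, hj' ▸ hj, ?_⟩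
    · by_contra hc
      exact Nat.find_min hex2 (m := k') (by omega) hc
    · obtain ⟨k', hk', h⟩ := hall
      have : j ≤ k' := Nat.find_min' hex2 h
      rw [← hj']
      exact (epochStart_mono T (this.trans hk')).trans hki

/-- The number of rounds after which Phase I has ended on the favourable event. -/
noncomputable def phaseOneBound (d : ℕ) (σ : ℝ) (T : ℕ) (μ : ℝ) : ℝ :=
  3362 * (d ^ 2 * σ ^ 2 * Real.log T / μ ^ 2) + 72 * Real.log T + 1

/-- If a new epoch starts after n rounds, then μ is at most 41 radii, that is n ≤ 41² d²σ² log T /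
μ². The epoch ends after 2n + ⌈72 log T⌉ rounds, and 3362 = 2 · 41². -/
lemma lt_phaseOneBound (hd : 0 < d) (hT : IsLargeHorizon d σ α₀ α₁ T) (hX : X.Nonempty)
    (hXc : IsCompact X) (hD : IsDesignOracle X D) (ho : IsEnumeration order)
    (hg : IsGoodPath alg X D order σ T θ flag arm reward)
    (hf : FollowsFairLinBandit alg X D order σ T flag sample arm reward)
    (harm : ∀ i < T, arm i ∈ X) (hμ : 0 < maxReward X θ) {k : ℕ}
    (hk : ∀ k' ≤ k, PhaseOneContinues X σ T arm reward (epochStart T k'))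
    (hkT : epochStart T k ≤ T) :
    (epochStart T (k + 1) : ℝ) < phaseOneBound d σ T (maxReward X θ) := by
  have hlog := hT.one_le_log
  have hceil : (⌈72 * Real.log T⌉₊ : ℝ) < 72 * Real.log T + 1 :=
    Nat.ceil_lt_add_one (by positivity)
  have e : (epochStart T (k + 1) : ℝ) = 2 * epochStart T k + ⌈72 * Real.log T⌉₊ := by
    rw [epochStart_succ, ← epochStart_add]; push_cast; ring
  have hk0 : (epochStart T k : ℝ) ≤ 1681 * (d ^ 2 * σ ^ 2 * Real.log T / maxReward X θ ^ 2) := by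
    rcases k with _ | k
    · rw [epochStart_zero, Nat.cast_zero]
      positivity
    · have hn72 : (⌈72 * Real.log T⌉₊ : ℝ) ≤ (epochStart T (k + 1) : ℝ) := by
        exact_mod_cast ceil_le_epochStart_succ T k
      have hn : (0 : ℝ) < epochStart T (k + 1) := by linarith [hT.ceil_ge.1]
      have h1 := maxReward_le_of_continues hX hXc (by exact_mod_cast hn)
        (fun x hx => phaseOne_error_le hd hT hX hXc hD ho hg hf harm
          (fun k' h => hk k' (by omega)) hkT hx) (hk (k + 1) le_rfl)
      have h2 : maxReward X θ ^ 2 ≤ (41 * radius d σ T (epochStart T (k + 1))) ^ 2 :=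
        pow_le_pow_left₀ hμ.le h1 2
      rw [mul_pow, radius_sq _ _ _ hn.le, mul_div_assoc', le_div_iff₀ hn] at h2
      rw [mul_div_assoc', le_div_iff₀ (by positivity)]
      linarith
  rw [e, phaseOneBound]
  linarith

end PhaseOne

/-! ### Phase II: LinUCB -/

section LinUCB

variable {d : ℕ} {σ α₀ α₁ α : ℝ} {T : ℕ} {X : Set (Vec d)} {θ : Vec d}
  {arm : ℕ → Vec d} {reward : ℕ → ℝ}

/-- The regularized Gram matrix `α I + ∑ xᵢ xᵢᵀ` of the rounds before `t`. -/
noncomputable def ridgeMatrix (α : ℝ) (arm : ℕ → Vec d) (t : ℕ) : Matrix (Fin d) (Fin d) ℝ :=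
  α • (1 : Matrix (Fin d) (Fin d) ℝ) + gramMatrix arm 0 t

lemma ridge_posDef (hα : 0 < α) : (α • (1 : Matrix (Fin d) (Fin d) ℝ)).PosDef :=
  Matrix.PosDef.one.smul hα

lemma ridgeMatrix_posDef (hα : 0 < α) (arm : ℕ → Vec d) (t : ℕ) : (ridgeMatrix α arm t).PosDef :=
  posDef_add_gramMatrix (ridge_posDef hα) arm 0 t

lemma ridgeMatrix_quad (α : ℝ) (arm : ℕ → Vec d) (t : ℕ) (v : Vec d) :
    v ⬝ᵥ (ridgeMatrix α arm t *ᵥ v) = α * (v ⬝ᵥ v) + v ⬝ᵥ (gramMatrix arm 0 t *ᵥ v) := by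
  rw [ridgeMatrix, Matrix.add_mulVec, Matrix.smul_mulVec, Matrix.one_mulVec, dotProduct_add,
    dotProduct_smul, smul_eq_mul]

/-- The squared width `xᵀ V⁻¹ x` of the confidence interval of `x`. -/
noncomputable def width (α : ℝ) (arm : ℕ → Vec d) (t : ℕ) (x : Vec d) : ℝ :=
  x ⬝ᵥ ((ridgeMatrix α arm t)⁻¹ *ᵥ x)

lemma width_nonneg (hα : 0 < α) (arm : ℕ → Vec d) (t : ℕ) (x : Vec d) :
    0 ≤ width α arm t x :=
  quad_nonneg (ridgeMatrix_posDef hα arm t).inv.posSemidef x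

/-- The determinant lemma telescopes: the potential counts the squared widths of the arms actually
pulled. -/
lemma log_det_ratio_eq_sum (hα : 0 < α) (arm : ℕ → Vec d) (t : ℕ) :
    Real.log ((ridgeMatrix α arm t).det / (α • (1 : Matrix (Fin d) (Fin d) ℝ)).det)
      = ∑ i ∈ Finset.range t, Real.log (1 + width α arm i (arm i)) := by
  have hd0 := (ridge_posDef (d := d) hα).det_pos
  induction t with
  | zero => simp [ridgeMatrix, gramMatrix_self]
  | succ t ih =>
    have hpos := (ridgeMatrix_posDef hα arm t)
    have hw := width_nonneg hα arm t (arm t)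
    have e : (ridgeMatrix α arm (t + 1)).det
        = (ridgeMatrix α arm t).det * (1 + width α arm t (arm t)) := by
      rw [ridgeMatrix, gramMatrix_succ arm (Nat.zero_le t), ← add_assoc]
      exact det_update hpos (arm t)
    rw [Finset.sum_range_succ, ← ih, e, mul_div_right_comm,
      Real.log_mul (div_pos hpos.det_pos hd0).ne' (by linarith)]

/-- The determinant is at most (trace/d)^d by the arithmetic-geometric mean, and the trace at most
dα + t because arms have length at most 1. -/
lemma log_det_ratio_le (hd : 0 < d) (hα : 0 < α) {t : ℕ}
    (harm : ∀ i < t, euclNorm (arm i) ≤ 1) :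
    Real.log ((ridgeMatrix α arm t).det / (α • (1 : Matrix (Fin d) (Fin d) ℝ)).det)
      ≤ d * Real.log (1 + t / (d * α)) := by
  have hd' : (0 : ℝ) < d := by exact_mod_cast hd
  have hpos := (ridgeMatrix_posDef hα arm t)
  have hd0 := (ridge_posDef (d := d) hα).det_pos
  rw [← Real.log_pow]
  refine Real.log_le_log (div_pos hpos.det_pos hd0) ?_
  have e : (α • (1 : Matrix (Fin d) (Fin d) ℝ)).det = α ^ d := by simp
  rw [e, div_le_iff₀ (pow_pos hα d), ← mul_pow]
  refine (det_le_trace_div_pow hd hpos.posSemidef).trans ?_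
  have htr : (ridgeMatrix α arm t).trace ≤ d * α + t := by
    rw [ridgeMatrix, Matrix.trace_add, Matrix.trace_smul, Matrix.trace_one, gramMatrix,
      Matrix.trace_sum, Fintype.card_fin, smul_eq_mul, mul_comm α]
    refine add_le_add le_rfl ?_
    have : ∀ i ∈ Finset.Ico 0 t, (Matrix.vecMulVec (arm i) (arm i)).trace ≤ 1 := by
      intro i hi
      rw [Matrix.trace_vecMulVec, ← euclNorm_sq]
      exact pow_le_one₀ (euclNorm_nonneg _) (harm i (Finset.mem_Ico.1 hi).2)
    refine (Finset.sum_le_sum this).trans ?_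
    simp
  refine pow_le_pow_left₀ (div_nonneg hpos.posSemidef.trace_nonneg hd'.le) ?_ d
  rw [div_le_iff₀ hd']
  refine htr.trans (le_of_eq ?_)
  field_simp

/-- The confidence parameter of LinUCB. -/
noncomputable def ucbBeta (d : ℕ) (σ α : ℝ) (T n : ℕ) : ℝ :=
  σ * √(d * Real.log (1 + n / (d * α)) + 2 * Real.log T) + √α

/-- The confidence intervals of LinUCB are valid. -/
lemma abs_ridge_error_le (hd : 0 < d) (hσ : 0 < σ) (hα : 0 < α) (hθ : euclNorm θ ≤ 1) {t : ℕ}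
    (harm : ∀ i < t, euclNorm (arm i) ≤ 1)
    (hS : ∀ v, (responseSum arm (fun i => reward i - arm i ⬝ᵥ θ) 0 t ⬝ᵥ v) ^ 2
      ≤ σ ^ 2 * (2 * Real.log T + Real.log ((ridgeMatrix α arm t).det
        / (α • (1 : Matrix (Fin d) (Fin d) ℝ)).det)) * (v ⬝ᵥ (ridgeMatrix α arm t *ᵥ v)))
    (x : Vec d) :
    |x ⬝ᵥ ((ridgeMatrix α arm t)⁻¹ *ᵥ responseSum arm reward 0 t) - x ⬝ᵥ θ|
      ≤ ucbBeta d σ α T t * √(width α arm t x) := by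
  have hpos := ridgeMatrix_posDef hα arm t
  set V := ridgeMatrix α arm t
  set S := responseSum arm (fun i => reward i - arm i ⬝ᵥ θ) 0 t
  set v : Vec d := V⁻¹ *ᵥ x
  have hVv : V *ᵥ v = x := mulVec_inv_mulVec hpos x
  have hw : v ⬝ᵥ (V *ᵥ v) = width α arm t x := by
    rw [hVv, dotProduct_comm]; rfl
  have hwn := width_nonneg hα arm t x
  have hV : V *ᵥ θ = α • θ + gramMatrix arm 0 t *ᵥ θ := by
    simp only [V]
    rw [ridgeMatrix, Matrix.add_mulVec, Matrix.smul_mulVec, Matrix.one_mulVec]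
  -- The error is a noise term minus the bias α ⟨v, θ⟩ of the regularization.
  have e : x ⬝ᵥ (V⁻¹ *ᵥ responseSum arm reward 0 t) - x ⬝ᵥ θ = S ⬝ᵥ v - α * (v ⬝ᵥ θ) := by
    have h1 : x ⬝ᵥ (V⁻¹ *ᵥ responseSum arm reward 0 t) = v ⬝ᵥ responseSum arm reward 0 t :=
      dotProduct_mulVec_symm hpos.inv.1 _ _
    have h2 : x ⬝ᵥ θ = v ⬝ᵥ (V *ᵥ θ) := by
      rw [dotProduct_mulVec_symm hpos.1, hVv]
    rw [h1, h2, hV, responseSum_decomp arm reward 0 t θ]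
    simp only [dotProduct_add, dotProduct_smul, smul_eq_mul]
    rw [dotProduct_comm v S]
    ring
  have hlogT := Real.log_natCast_nonneg T
  have hL : 2 * Real.log T + Real.log (V.det / (α • (1 : Matrix (Fin d) (Fin d) ℝ)).det)
      ≤ d * Real.log (1 + t / (d * α)) + 2 * Real.log T := by
    linarith [log_det_ratio_le hd hα harm]
  have hl0 : 0 ≤ d * Real.log (1 + t / (d * α)) + 2 * Real.log T := by
    have : 0 ≤ Real.log (1 + t / (d * α)) :=
      Real.log_nonneg (le_add_of_nonneg_right (by positivity))
    positivity
  have h1 : |S ⬝ᵥ v| ≤ σ * √(d * Real.log (1 + t / (d * α)) + 2 * Real.log T)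
      * √(width α arm t x) := by
    refine abs_le_of_sq_le_sq ((hS v).trans ?_) (by positivity)
    rw [hw, mul_pow, mul_pow, Real.sq_sqrt hl0, Real.sq_sqrt hwn]
    exact mul_le_mul_of_nonneg_right (mul_le_mul_of_nonneg_left hL (sq_nonneg σ)) hwn
  have h2 : |α * (v ⬝ᵥ θ)| ≤ √α * √(width α arm t x) := by
    refine abs_le_of_sq_le_sq ?_ (by positivity)
    rw [mul_pow, mul_pow, Real.sq_sqrt hα.le, Real.sq_sqrt hwn]
    have h3 : (v ⬝ᵥ θ) ^ 2 ≤ v ⬝ᵥ v := by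
      refine (sq_dotProduct_le v θ).trans ?_
      have : θ ⬝ᵥ θ ≤ 1 := by
        rw [← euclNorm_sq]; exact pow_le_one₀ (euclNorm_nonneg θ) hθ
      nlinarith [dotProduct_self_nonneg' v]
    have h4 : α * (v ⬝ᵥ v) ≤ width α arm t x := by
      rw [← hw, ridgeMatrix_quad]
      exact le_add_of_nonneg_right (quad_nonneg (gramMatrix_posSemidef arm 0 t) v)
    have h5 := mul_le_mul_of_nonneg_left h3 (sq_nonneg α)
    nlinarith
  rw [e, ucbBeta, add_mul]
  exact (abs_sub _ _).trans (add_le_add h1 h2)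

lemma ucbIndex_eq (σ α : ℝ) (T : ℕ) (arm : ℕ → Vec d) (reward : ℕ → ℝ) (n : ℕ) (z : Vec d) :
    ucbIndex σ α T arm reward n z
      = z ⬝ᵥ ((ridgeMatrix α arm n)⁻¹ *ᵥ responseSum arm reward 0 n)
        + ucbBeta d σ α T n * √(width α arm n z) := by
  simp only [ucbIndex, width, weightedNorm, ucbBeta, ridgeMatrix, add_comm (gramMatrix arm 0 n)]

/-- For large T the bias √α ≤ √α₁ is dominated by the noise term, and the logarithm is controlled
through α₀ alone; this gives uniformity in α. -/
lemma ucbBeta_le (hd : 0 < d) (hσ : 0 < σ) (hα₀ : 0 < α₀) (h0 : α₀ ≤ α) (h1 : α ≤ α₁)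
    (hT : IsLargeHorizon d σ α₀ α₁ T) {n : ℕ} (hn : n ≤ T) :
    ucbBeta d σ α T n ≤ 3 * (σ * √(d * Real.log T)) := by
  have hd' : (1 : ℝ) ≤ d := by exact_mod_cast hd
  have hlog := hT.one_le_log
  have hα : 0 < α := hα₀.trans_le h0
  have hn' : (n : ℝ) ≤ T := by exact_mod_cast hn
  have hl : Real.log (1 + n / (d * α)) ≤ 2 * Real.log T := by
    have h2 : 1 + n / (d * α) ≤ (T : ℝ) ^ 2 := by
      refine le_trans ?_ hT.one_add_div_le
      gcongr
    have := Real.log_le_log (by positivity) h2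
    rwa [Real.log_pow] at this
  have e1 : √(d * Real.log (1 + n / (d * α)) + 2 * Real.log T) ≤ 2 * √(d * Real.log T) := by
    rw [Real.sqrt_le_left (by positivity), mul_pow, Real.sq_sqrt (by positivity)]
    nlinarith
  have e2 : √α ≤ σ * √(d * Real.log T) := by
    rw [Real.sqrt_le_left (by positivity), mul_pow, Real.sq_sqrt (by positivity)]
    have := hT.reg_le
    have h3 : σ ^ 2 * Real.log T ≤ σ ^ 2 * (d * Real.log T) :=
      mul_le_mul_of_nonneg_left (by nlinarith) (sq_nonneg σ)
    linarith
  rw [ucbBeta]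
  nlinarith

/-- The regret of LinUCB after sufficient exploration. -/
lemma linUCB_regret (hd : 0 < d) (hσ : 0 < σ) (hα₀ : 0 < α₀) (h0 : α₀ ≤ α) (h1 : α ≤ α₁)
    (hT : IsLargeHorizon d σ α₀ α₁ T) (hX : X.Nonempty) (hXc : IsCompact X)
    (hX1 : ∀ x ∈ X, euclNorm x ≤ 1) (hθ : euclNorm θ ≤ 1) (harm : ∀ i < T, arm i ∈ X)
    (hS : ∀ t ≤ T, ∀ v, (responseSum arm (fun i => reward i - arm i ⬝ᵥ θ) 0 t ⬝ᵥ v) ^ 2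
      ≤ σ ^ 2 * (2 * Real.log T + Real.log ((ridgeMatrix α arm t).det
        / (α • (1 : Matrix (Fin d) (Fin d) ℝ)).det)) * (v ⬝ᵥ (ridgeMatrix α arm t *ᵥ v)))
    {τ : ℕ} (hτ : 72 * (d : ℝ) ^ 2 ≤ τ) {U : Matrix (Fin d) (Fin d) ℝ}
    (hV : ∀ v : Vec d, (τ : ℝ) / 3 * (v ⬝ᵥ (U *ᵥ v)) ≤ v ⬝ᵥ (gramMatrix arm 0 τ *ᵥ v))
    (hU : ∀ x ∈ X, ∀ v : Vec d, (x ⬝ᵥ v) ^ 2 ≤ d * (v ⬝ᵥ (U *ᵥ v)))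
    (hf : FollowsLinUCB X σ α T τ arm reward) :
    (∀ i, τ ≤ i → i < T → maxReward X θ - arm i ⬝ᵥ θ ≤ 16 * radius d σ T τ) ∧
    ∑ i ∈ Finset.Ico τ T, (maxReward X θ - arm i ⬝ᵥ θ) ≤ 12 * (σ * d * Real.log T * √(T : ℝ)) := by
  have hα : 0 < α := hα₀.trans_le h0
  have hd' : (1 : ℝ) ≤ d := by exact_mod_cast hd
  have hτ0 : (72 : ℝ) ≤ τ := by nlinarith
  have hlog := hT.one_le_log
  set B : ℝ := 3 * (σ * √(d * Real.log T))
  have hB : 0 ≤ B := by positivity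
  -- Optimism: the index of the pulled arm is at least that of the best arm, hence at least the
  -- maximal reward, and it exceeds its own mean by at most two widths.
  have hreg : ∀ i, τ ≤ i → i < T →
      maxReward X θ - arm i ⬝ᵥ θ ≤ 2 * B * √(width α arm i (arm i)) := by
    intro i hi hiT
    obtain ⟨-, hopt⟩ := hf i hi hiT
    obtain ⟨z, hz, ez, -⟩ := exists_maxReward_eq hXc hX θ
    have herr := fun x => abs_le.1 (abs_ridge_error_le (x := x) hd hσ hα hθ
      (fun j hj => hX1 _ (harm j (hj.trans hiT))) (hS i hiT.le))
    have hz' := hopt z hz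
    rw [ucbIndex_eq, ucbIndex_eq] at hz'
    have hβ := mul_le_mul_of_nonneg_right (ucbBeta_le hd hσ hα₀ h0 h1 hT hiT.le)
      (Real.sqrt_nonneg (width α arm i (arm i)))
    rw [ez]
    linarith [(herr z).1, (herr (arm i)).2]
  -- With v = V⁻¹x and width w, the exploration of Phase I gives w² = ⟨x, v⟩² ≤ d ⟨v, Uv⟩ ≤ (3d/τ)
  -- w.
  have hwid : ∀ i, τ ≤ i → i < T → width α arm i (arm i) ≤ 3 * d / τ := by
    intro i hi hiT
    have hpos := ridgeMatrix_posDef hα arm i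
    set v : Vec d := (ridgeMatrix α arm i)⁻¹ *ᵥ arm i
    have hw : v ⬝ᵥ (ridgeMatrix α arm i *ᵥ v) = width α arm i (arm i) := by
      rw [mulVec_inv_mulVec hpos, dotProduct_comm]; rfl
    have hxv : arm i ⬝ᵥ v = width α arm i (arm i) := rfl
    have h2 := hU _ (harm i hiT) v
    rw [hxv] at h2
    have h3 := hV v
    have h4 := gramMatrix_quad_mono arm (Nat.zero_le τ) hi v
    have h5 : v ⬝ᵥ (gramMatrix arm 0 i *ᵥ v) ≤ width α arm i (arm i) := by
      rw [← hw, ridgeMatrix_quad]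
      have := dotProduct_self_nonneg' v
      exact le_add_of_nonneg_left (by positivity)
    have hwn := width_nonneg hα arm i (arm i)
    rw [le_div_iff₀ (by linarith)]
    rcases hwn.eq_or_lt with h | h
    · rw [← h]; simp
    · have h6 : (τ : ℝ) / 3 * width α arm i (arm i) ^ 2 ≤ d * width α arm i (arm i) := by
        have := mul_le_mul_of_nonneg_left h2 (by positivity : (0 : ℝ) ≤ τ / 3)
        nlinarith
      have : (width α arm i (arm i) * (width α arm i (arm i) * τ))
          ≤ width α arm i (arm i) * (3 * d) := by nlinarith
      exact le_of_mul_le_mul_left this h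
  refine ⟨fun i hi hiT => ?_, ?_⟩
  · refine (hreg i hi hiT).trans ?_
    have hwn := width_nonneg hα arm i (arm i)
    -- Squared, 2B√(3d/τ) is 4 · 9 · 3 = 108 squared radii, below 16².
    refine (abs_le_of_sq_le_sq' ?_ (by have := radius_nonneg d σ T τ; positivity)).2
    have hB2 : B ^ 2 = 3 ^ 2 * (σ ^ 2 * (d * Real.log T)) := by
      simp only [B]
      rw [mul_pow, mul_pow, Real.sq_sqrt (by positivity)]
    rw [mul_pow (2 * B), mul_pow 2 B, Real.sq_sqrt hwn, hB2, mul_pow 16,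
      radius_sq _ _ _ (by linarith)]
    have := mul_le_mul_of_nonneg_left (hwid i hi hiT)
      (by positivity : (0 : ℝ) ≤ 2 ^ 2 * (3 ^ 2 * (σ ^ 2 * (d * Real.log T))))
    refine this.trans ?_
    rw [mul_div_assoc', mul_div_assoc']
    refine div_le_div_of_nonneg_right ?_ (by linarith)
    have : 0 ≤ (d : ℝ) ^ 2 * σ ^ 2 * Real.log T := by positivity
    nlinarith
  · have hsumw : ∑ i ∈ Finset.Ico τ T, width α arm i (arm i) ≤ 4 * (d * Real.log T) := by
      -- Phase I has made the widths at most 1, and w ≤ 2 log(1 + w) on [0, 1]; the sum is thus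
      -- bounded by the potential.
      have h2 : ∀ i ∈ Finset.Ico τ T, width α arm i (arm i)
          ≤ 2 * Real.log (1 + width α arm i (arm i)) := by
        intro i hi
        obtain ⟨hi, hiT⟩ := Finset.mem_Ico.1 hi
        have hwn := width_nonneg hα arm i (arm i)
        have hw1 : width α arm i (arm i) ≤ 1 := by
          refine (hwid i hi hiT).trans ?_
          rw [div_le_one (by linarith)]
          nlinarith
        have h3 := Real.one_sub_inv_le_log_of_pos (show 0 < 1 + width α arm i (arm i) by linarith)
        have h4 : width α arm i (arm i) / 2 ≤ 1 - (1 + width α arm i (arm i))⁻¹ := by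
          rw [inv_eq_one_div, one_sub_div (by linarith), div_le_div_iff₀ two_pos (by linarith)]
          nlinarith
        linarith
      refine (Finset.sum_le_sum h2).trans ?_
      rw [← Finset.mul_sum]
      have h3 : ∑ i ∈ Finset.Ico τ T, Real.log (1 + width α arm i (arm i))
          ≤ ∑ i ∈ Finset.range T, Real.log (1 + width α arm i (arm i)) := by
        refine Finset.sum_le_sum_of_subset_of_nonneg ?_ fun i _ _ =>
          Real.log_nonneg (by linarith [width_nonneg hα arm i (arm i)])
        intro i hi
        exact Finset.mem_range.2 (Finset.mem_Ico.1 hi).2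
      rw [← log_det_ratio_eq_sum hα] at h3
      have h4 := log_det_ratio_le (arm := arm) (t := T) hd hα fun i hi => hX1 _ (harm i hi)
      have h5 : Real.log (1 + T / (d * α)) ≤ 2 * Real.log T := by
        have h6 : 1 + T / (d * α) ≤ (T : ℝ) ^ 2 := by
          refine le_trans ?_ hT.one_add_div_le
          gcongr
        have := Real.log_le_log (by positivity) h6
        rwa [Real.log_pow] at this
      have h7 := mul_le_mul_of_nonneg_left h5 (by linarith : (0 : ℝ) ≤ d)
      linarith
    -- Cauchy-Schwarz over the rounds.
    have hsq : ∑ i ∈ Finset.Ico τ T, √(width α arm i (arm i))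
        ≤ √(T : ℝ) * (2 * √(d * Real.log T)) := by
      refine (abs_le_of_sq_le_sq' ?_ (by positivity)).2
      refine (sq_sum_le_card_mul_sum_sq).trans ?_
      rw [mul_pow, Real.sq_sqrt (Nat.cast_nonneg T), mul_pow, Real.sq_sqrt (by positivity),
        Nat.card_Ico]
      refine mul_le_mul (by exact_mod_cast Nat.sub_le T τ) ?_
        (Finset.sum_nonneg fun i _ => sq_nonneg _) (Nat.cast_nonneg T)
      refine le_trans (le_of_eq ?_) (hsumw.trans (le_of_eq ?_))
      · exact Finset.sum_congr rfl fun i _ => Real.sq_sqrt (width_nonneg hα arm i (arm i))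
      · ring
    calc ∑ i ∈ Finset.Ico τ T, (maxReward X θ - arm i ⬝ᵥ θ)
        ≤ ∑ i ∈ Finset.Ico τ T, 2 * B * √(width α arm i (arm i)) :=
          Finset.sum_le_sum fun i hi => hreg i (Finset.mem_Ico.1 hi).1 (Finset.mem_Ico.1 hi).2
      _ = 2 * B * ∑ i ∈ Finset.Ico τ T, √(width α arm i (arm i)) := by rw [Finset.mul_sum]
      _ ≤ 2 * B * (√(T : ℝ) * (2 * √(d * Real.log T))) :=
          mul_le_mul_of_nonneg_left hsq (by positivity)
      _ = 12 * (σ * (√(d * Real.log T) * √(d * Real.log T)) * √(T : ℝ)) := by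
          simp only [B]; ring
      _ = 12 * (σ * d * Real.log T * √(T : ℝ)) := by
          rw [Real.mul_self_sqrt (by positivity)]; ring

end LinUCB

/-! ### Phase II: LinPE -/

lemma survivors_subset {d : ℕ} (S : Set (Vec d)) (σ : ℝ) (T : ℕ) (θ : Vec d) (n : ℝ) :
    survivors S σ T θ n ⊆ S := fun _ hx => hx.1

lemma isCompact_survivors {d : ℕ} {S : Set (Vec d)} (hS : IsCompact S) (σ : ℝ) (T : ℕ)
    (θ : Vec d) (n : ℝ) : IsCompact (survivors S σ T θ n) :=
  hS.inter_right (isClosed_Ici.preimage (continuous_dotProduct_right θ))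

lemma survivors_nonempty {d : ℕ} {S : Set (Vec d)} (hS : IsCompact S) (hne : S.Nonempty) (σ : ℝ)
    (T : ℕ) (θ : Vec d) (n : ℝ) : (survivors S σ T θ n).Nonempty := by
  obtain ⟨x, hx, e, -⟩ := exists_maxReward_eq hS hne θ
  refine ⟨x, hx, ?_⟩
  rw [e]
  have := Real.sqrt_nonneg (d ^ 2 * σ ^ 2 * Real.log T / n)
  linarith

/-- If the estimation error is at most four radii, the best arm survives, and all survivors are
almost optimal. -/
lemma survivors_of_error {d : ℕ} {S : Set (Vec d)} (hS : IsCompact S) {σ : ℝ} {T : ℕ}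
    {θ θ' : Vec d} {n : ℝ} (herr : ∀ x ∈ S, |x ⬝ᵥ (θ' - θ)| ≤ 4 * radius d σ T n) {z : Vec d}
    (hz : z ∈ S) (hmax : ∀ y ∈ S, y ⬝ᵥ θ ≤ z ⬝ᵥ θ) :
    z ∈ survivors S σ T θ' n ∧
      ∀ x ∈ survivors S σ T θ' n, z ⬝ᵥ θ - x ⬝ᵥ θ ≤ 16 * radius d σ T n := by
  obtain ⟨y, hy, ey, my⟩ := exists_maxReward_eq hS ⟨z, hz⟩ θ'
  have h1 := abs_le.1 (herr z hz)
  have h2 := abs_le.1 (herr y hy)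
  rw [dotProduct_sub] at h1 h2
  have h3 := hmax y hy
  have h4 := my z hz
  refine ⟨⟨hz, ?_⟩, fun x hx => ?_⟩
  · change maxReward S θ' - 8 * radius d σ T n ≤ z ⬝ᵥ θ'
    rw [ey]
    linarith [h1.1, h2.2]
  · have h5 := abs_le.1 (herr x hx.1)
    rw [dotProduct_sub] at h5
    have h6 : maxReward S θ' - 8 * radius d σ T n ≤ x ⬝ᵥ θ' := hx.2
    rw [ey] at h6
    linarith [h1.1, h5.2]

/-! ### The pulls within one LinPE episode -/

section Pulls

variable {d : ℕ} {order : Finset (Vec d) → List (Vec d)} {l : Vec d →₀ ℝ} {c : ℝ}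

lemma sum_map_episodePulls {M : Type*} [AddCommMonoid M] (ho : IsEnumeration order)
    (f : Vec d → M) :
    ((episodePulls order l c).map f).sum = ∑ a ∈ l.support, ⌈l a * c⌉₊ • f a := by
  classical
  obtain ⟨hnd, hmem⟩ := ho l.support
  have h1 : ∀ L : List (Vec d), ((L.flatMap fun a => List.replicate ⌈l a * c⌉₊ a).map f).sum
      = (L.map fun a => ⌈l a * c⌉₊ • f a).sum := by
    intro L
    induction L with
    | nil => simp
    | cons a L ih =>
      rw [List.flatMap_cons, List.map_append, List.sum_append, ih, List.map_replicate,
        List.sum_replicate, List.map_cons, List.sum_cons]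
  rw [episodePulls, h1, ← List.sum_toFinset _ hnd]
  refine Finset.sum_congr ?_ fun _ _ => rfl
  ext z
  rw [List.mem_toFinset, hmem]

lemma length_episodePulls (ho : IsEnumeration order) :
    (episodePulls order l c).length = ∑ a ∈ l.support, ⌈l a * c⌉₊ := by
  have := sum_map_episodePulls (l := l) (c := c) ho fun _ => (1 : ℕ)
  simpa using this

lemma mem_support_of_mem_episodePulls (ho : IsEnumeration order) {a : Vec d}
    (ha : a ∈ episodePulls order l c) : a ∈ l.support := by
  obtain ⟨b, hb, hab⟩ := List.mem_flatMap.1 ha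
  rw [List.eq_of_mem_replicate hab]
  exact ((ho l.support).2 b).1 hb

lemma length_episodePulls_pos (ho : IsEnumeration order) {S : Set (Vec d)} (hl : IsDesign S l)
    (hc : 0 < c) : 0 < (episodePulls order l c).length := by
  have hne : l.support.Nonempty := by
    rw [Finset.nonempty_iff_ne_empty]
    intro h
    have := hl.sum_one
    rw [Finsupp.sum, h, Finset.sum_empty] at this
    exact zero_ne_one this
  obtain ⟨a, ha⟩ := hne
  have hla : 0 < l a := lt_of_le_of_ne (hl.nonneg a) (Ne.symm (Finsupp.mem_support_iff.1 ha))
  rw [length_episodePulls ho]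
  exact (Nat.ceil_pos.2 (mul_pos hla hc)).trans_le
    (Finset.single_le_sum (f := fun a => ⌈l a * c⌉₊) (fun _ _ => Nat.zero_le _) ha)

lemma sum_episode_eq {M : Type*} [AddCommMonoid M] (ho : IsEnumeration order) {arm : ℕ → Vec d}
    {s : ℕ} (harm : ∀ (j : ℕ) (h : j < (episodePulls order l c).length),
      arm (s + j) = (episodePulls order l c)[j]) (f : Vec d → M) :
    ∑ i ∈ Finset.Ico s (s + (episodePulls order l c).length), f (arm i)
      = ∑ a ∈ l.support, ⌈l a * c⌉₊ • f a := by
  rw [← sum_map_episodePulls ho, Finset.sum_Ico_eq_sum_range, Nat.add_sub_cancel_left,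
    Finset.sum_range, ← Fin.sum_univ_fun_getElem]
  exact Finset.sum_congr rfl fun j _ => by rw [harm j j.2]

lemma episode_quad_le (ho : IsEnumeration order) {arm : ℕ → Vec d}
    {s : ℕ} (harm : ∀ (j : ℕ) (h : j < (episodePulls order l c).length),
      arm (s + j) = (episodePulls order l c)[j]) (v : Vec d) :
    c * (v ⬝ᵥ (designMatrix l *ᵥ v))
      ≤ v ⬝ᵥ (gramMatrix arm s (s + (episodePulls order l c).length) *ᵥ v) := by
  rw [designMatrix_mulVec_quad, gramMatrix_quad, Finsupp.sum, Finset.mul_sum,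
    sum_episode_eq ho harm fun x => (x ⬝ᵥ v) ^ 2]
  refine Finset.sum_le_sum fun a _ => ?_
  rw [nsmul_eq_mul]
  have := mul_le_mul_of_nonneg_right (Nat.le_ceil (l a * c)) (sq_nonneg (a ⬝ᵥ v))
  linarith

end Pulls

section LinPE

variable {d : ℕ} {σ α₀ α₁ : ℝ} {T τ : ℕ} {X : Set (Vec d)} {θ : Vec d}
  {D : Set (Vec d) → (Vec d →₀ ℝ)} {order : Finset (Vec d) → List (Vec d)}
  {arm : ℕ → Vec d} {reward : ℕ → ℝ}

lemma episodeState_set (hX : X.Nonempty) (hXc : IsCompact X) (e : ℕ) :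
    (episodeState X D order σ T τ arm reward e).2 ⊆ X ∧
    (episodeState X D order σ T τ arm reward e).2.Nonempty ∧
    IsCompact (episodeState X D order σ T τ arm reward e).2 := by
  induction e with
  | zero => exact ⟨survivors_subset _ _ _ _ _, survivors_nonempty hXc hX _ _ _ _,
      isCompact_survivors hXc _ _ _ _⟩
  | succ e ih => exact ⟨(survivors_subset _ _ _ _ _).trans ih.1,
      survivors_nonempty ih.2.2 ih.2.1 _ _ _ _, isCompact_survivors ih.2.2 _ _ _ _⟩

lemma episodeState_isDOptimal (hX : X.Nonempty) (hXc : IsCompact X) (hD : IsDesignOracle X D)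
    (e : ℕ) : IsDOptimal (episodeState X D order σ T τ arm reward e).2
      (D (episodeState X D order σ T τ arm reward e).2) :=
  have h := episodeState_set hX hXc (D := D) (order := order) (σ := σ) (T := T) (τ := τ)
    (arm := arm) (reward := reward) e
  hD _ h.1 h.2.1 h.2.2

lemma episodeParam_pos (hτ : 0 < τ) (e : ℕ) : 0 < episodeParam τ e := by
  have : (0 : ℝ) < τ := by exact_mod_cast hτ
  rw [episodeParam]; positivity

lemma episodeParam_succ (τ e : ℕ) : episodeParam τ (e + 1) = 2 * episodeParam τ e := by
  rw [episodeParam, episodeParam, pow_succ]; ring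

lemma episodeStart_succ (e : ℕ) : (episodeState X D order σ T τ arm reward (e + 1)).1
    = (episodeState X D order σ T τ arm reward e).1
      + (episodePulls order (D (episodeState X D order σ T τ arm reward e).2)
        (episodeParam τ e)).length := rfl

lemma episodeStart_strictMono (hX : X.Nonempty) (hXc : IsCompact X) (hD : IsDesignOracle X D)
    (ho : IsEnumeration order) (hτ : 0 < τ) :
    StrictMono fun e => (episodeState X D order σ T τ arm reward e).1 := by
  refine strictMono_nat_of_lt_succ fun e => ?_
  rw [episodeStart_succ]
  have := length_episodePulls_pos ho (episodeState_isDOptimal (σ := σ) (T := T) (τ := τ)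
    (arm := arm) (reward := reward) (order := order) hX hXc hD e).design (episodeParam_pos hτ e)
  omega

lemma exists_episode (hX : X.Nonempty) (hXc : IsCompact X) (hD : IsDesignOracle X D)
    (ho : IsEnumeration order) (hτ : 0 < τ) {i : ℕ} (hi : τ ≤ i) :
    ∃ e, (episodeState X D order σ T τ arm reward e).1 ≤ i ∧
      i < (episodeState X D order σ T τ arm reward (e + 1)).1 := by
  have hmono := episodeStart_strictMono (σ := σ) (T := T) (arm := arm) (reward := reward)
    hX hXc hD ho hτ
  have hex : ∃ e, i < (episodeState X D order σ T τ arm reward (e + 1)).1 :=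
    ⟨i, lt_of_lt_of_le (Nat.lt_succ_self i) (hmono.le_apply (x := i + 1))⟩
  classical
  refine ⟨Nat.find hex, ?_, Nat.find_spec hex⟩
  rcases Nat.eq_zero_or_pos (Nat.find hex) with h0 | h0
  · rw [h0]; exact hi
  · have := Nat.find_min hex (m := Nat.find hex - 1) (by omega)
    rw [Nat.sub_add_cancel h0] at this
    omega

lemma linPE_arm_mem_episode (ho : IsEnumeration order) (hX : X.Nonempty) (hXc : IsCompact X)
    (hD : IsDesignOracle X D) (hf : FollowsLinPE X D order σ T τ arm reward) {e i : ℕ}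
    (h1 : (episodeState X D order σ T τ arm reward e).1 ≤ i)
    (h2 : i < (episodeState X D order σ T τ arm reward (e + 1)).1) (hiT : i < T) :
    arm i ∈ (episodeState X D order σ T τ arm reward e).2 := by
  obtain ⟨j, rfl⟩ := Nat.exists_eq_add_of_le h1
  rw [episodeStart_succ] at h2
  rw [hf e j (by omega) hiT]
  exact (episodeState_isDOptimal hX hXc hD e).design.mem _
    (mem_support_of_mem_episodePulls ho (List.getElem_mem _))

lemma linPE_arm_mem (hX : X.Nonempty) (hXc : IsCompact X) (hD : IsDesignOracle X D)
    (ho : IsEnumeration order) (hτ : 0 < τ) (hf : FollowsLinPE X D order σ T τ arm reward)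
    {i : ℕ} (hi : τ ≤ i) (hiT : i < T) : arm i ∈ X := by
  obtain ⟨e, h1, h2⟩ := exists_episode (σ := σ) (T := T) (arm := arm) (reward := reward)
    hX hXc hD ho hτ hi
  exact (episodeState_set hX hXc e).1 (linPE_arm_mem_episode ho hX hXc hD hf h1 h2 hiT)

/-- Rounding at most doubles an episode, since T' ≥ 48 d², and the parameters double, so the starts
stay below 4T'. Hence the sample size of an episode is comparable with the index of each of its
rounds. -/
lemma episodeStart_succ_le (hX : X.Nonempty) (hXc : IsCompact X) (hD : IsDesignOracle X D)
    (ho : IsEnumeration order) (hτ : 72 * (d : ℝ) ^ 2 ≤ τ) (hd : 0 < d) (e : ℕ) :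
    ((episodeState X D order σ T τ arm reward (e + 1)).1 : ℝ) ≤ 6 * episodeParam τ e := by
  have hd' : (1 : ℝ) ≤ d := by exact_mod_cast hd
  have hτ0 : 0 < τ := by
    have : (0 : ℝ) < τ := by nlinarith
    exact_mod_cast this
  have hlen : ∀ e, ((episodePulls order (D (episodeState X D order σ T τ arm reward e).2)
      (episodeParam τ e)).length : ℝ) ≤ 2 * episodeParam τ e := by
    intro e
    have hp := episodeParam_pos hτ0 e
    rw [length_episodePulls ho]
    refine (sum_ceil_le (episodeState_isDOptimal hX hXc hD e) hp.le).trans ?_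
    have h1 : 2 / 3 * (τ : ℝ) ≤ episodeParam τ e := by
      rw [episodeParam]
      have : (1 : ℝ) ≤ 2 ^ e := one_le_pow₀ (by norm_num)
      have h3 : (0 : ℝ) ≤ 2 / 3 * τ := by positivity
      nlinarith
    nlinarith
  have key : ∀ e, ((episodeState X D order σ T τ arm reward e).1 : ℝ) ≤ 4 * episodeParam τ e := by
    intro e
    induction e with
    | zero =>
      change (τ : ℝ) ≤ _
      rw [episodeParam]
      have : (0 : ℝ) ≤ τ := Nat.cast_nonneg τ
      linarith
    | succ e ih =>
      rw [episodeStart_succ, episodeParam_succ]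
      push_cast
      linarith [hlen e]
  rw [episodeStart_succ]
  push_cast
  linarith [hlen e, key e]

/-- The error of the estimate at the end of a completed episode. -/
lemma episode_error_le (hd : 0 < d) (hT : IsLargeHorizon d σ α₀ α₁ T) (hX : X.Nonempty)
    (hXc : IsCompact X) (hD : IsDesignOracle X D) (ho : IsEnumeration order) (hτ : 0 < τ)
    (hf : FollowsLinPE X D order σ T τ arm reward) {e : ℕ}
    (heT : (episodeState X D order σ T τ arm reward (e + 1)).1 ≤ T)
    (hS : ∀ v, (responseSum arm (fun i => reward i - arm i ⬝ᵥ θ)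
        (episodeState X D order σ T τ arm reward e).1
        (episodeState X D order σ T τ arm reward (e + 1)).1 ⬝ᵥ v) ^ 2
      ≤ σ ^ 2 * (8 * Real.log T + d * Real.log 4) * (4 / 3)
        * (v ⬝ᵥ (gramMatrix arm (episodeState X D order σ T τ arm reward e).1
        (episodeState X D order σ T τ arm reward (e + 1)).1 *ᵥ v)))
    {x : Vec d} (hx : x ∈ (episodeState X D order σ T τ arm reward e).2) :
    |x ⬝ᵥ (estimate arm reward (episodeState X D order σ T τ arm reward e).1
        (episodeState X D order σ T τ arm reward (e + 1)).1 - θ)|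
      ≤ 4 * radius d σ T (episodeParam τ e) := by
  have hopt := episodeState_isDOptimal (σ := σ) (T := T) (τ := τ)
    (arm := arm) (reward := reward) (order := order) hX hXc hD e
  have hp := episodeParam_pos hτ e
  have hd' : (1 : ℝ) ≤ d := by exact_mod_cast hd
  have hlog := hT.one_le_log
  have hlog4 : Real.log 4 ≤ 2 := by
    have : Real.log 4 = 2 * Real.log 2 := by
      rw [show (4 : ℝ) = 2 ^ 2 by norm_num, Real.log_pow]; norm_num
    rw [this]
    linarith [Real.log_two_lt_d9]
  have hlog40 : 0 ≤ Real.log 4 := Real.log_nonneg (by norm_num)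
  have hV := episode_quad_le (l := D (episodeState X D order σ T τ arm reward e).2)
    (c := episodeParam τ e) (arm := arm) (s := (episodeState X D order σ T τ arm reward e).1) ho
    (fun j h => hf e j h (by
      rw [episodeStart_succ] at heT
      exact lt_of_lt_of_le (Nat.add_lt_add_left h _) heT))
  rw [← episodeStart_succ] at hV
  have hsq := sq_estimate_error_le (by positivity) hS hp hV (hopt.sq_dotProduct_le hx)
  refine abs_le_of_sq_le_sq (hsq.trans ?_)
    (by have := radius_nonneg d σ T (episodeParam τ e); positivity)
  rw [mul_pow, radius_sq _ _ _ hp.le, show (4 : ℝ) ^ 2 * (d ^ 2 * σ ^ 2 * Real.log T / episodeParam τ e)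
    = (4 ^ 2 * (d ^ 2 * σ ^ 2 * Real.log T)) / episodeParam τ e by ring]
  refine div_le_div_of_nonneg_right ?_ hp.le
  -- As log 4 ≤ 2 log T, the left side is at most (10 + 2/3 + (2 + 2/3) d) log T ≤ (13 + 1/3) d log
  -- T.
  have h1 : (8 * Real.log T + d * Real.log 4) * (4 / 3) ≤ 16 * d * Real.log T := by
    have : Real.log 4 ≤ 2 * Real.log T := by linarith
    nlinarith
  have h2 := mul_le_mul_of_nonneg_left h1 (by positivity : (0 : ℝ) ≤ d * σ ^ 2)
  nlinarith

/-- Each summand is at most 2(√(i+1) - √i), so the sum telescopes. -/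
lemma sum_inv_sqrt_le (T : ℕ) : ∑ i ∈ Finset.range T, 1 / √((i : ℝ) + 1) ≤ 2 * √(T : ℝ) := by
  induction T with
  | zero => simp
  | succ T ih =>
    rw [Finset.sum_range_succ]
    have h1 : 1 / √((T : ℝ) + 1) ≤ 2 * (√((T : ℝ) + 1) - √(T : ℝ)) := by
      have hp : 0 < √((T : ℝ) + 1) := Real.sqrt_pos.2 (by positivity)
      rw [div_le_iff₀ hp]
      have h2 := Real.mul_self_sqrt (by positivity : (0 : ℝ) ≤ (T : ℝ) + 1)
      have h3 := Real.mul_self_sqrt (Nat.cast_nonneg (α := ℝ) T)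
      nlinarith [sq_nonneg (√((T : ℝ) + 1) - √(T : ℝ))]
    push_cast
    linarith

/-- The regret of LinPE after sufficient exploration. -/
lemma linPE_regret (hd : 0 < d) (hσ : 0 < σ) (hT : IsLargeHorizon d σ α₀ α₁ T) (hX : X.Nonempty)
    (hXc : IsCompact X) (hD : IsDesignOracle X D) (ho : IsEnumeration order)
    (hτ : 72 * (d : ℝ) ^ 2 ≤ τ) (hf : FollowsLinPE X D order σ T τ arm reward)
    (hone : ∀ x ∈ X, |x ⬝ᵥ (estimate arm reward 0 τ - θ)| ≤ 4 * radius d σ T τ)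
    (hS : ∀ e, (episodeState X D order σ T τ arm reward (e + 1)).1 ≤ T →
      ∀ v, (responseSum arm (fun i => reward i - arm i ⬝ᵥ θ)
        (episodeState X D order σ T τ arm reward e).1
        (episodeState X D order σ T τ arm reward (e + 1)).1 ⬝ᵥ v) ^ 2
      ≤ σ ^ 2 * (8 * Real.log T + d * Real.log 4) * (4 / 3)
        * (v ⬝ᵥ (gramMatrix arm (episodeState X D order σ T τ arm reward e).1
        (episodeState X D order σ T τ arm reward (e + 1)).1 *ᵥ v))) :
    (∀ i, τ ≤ i → i < T → maxReward X θ - arm i ⬝ᵥ θ ≤ 16 * radius d σ T τ) ∧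
    ∑ i ∈ Finset.Ico τ T, (maxReward X θ - arm i ⬝ᵥ θ)
      ≤ 112 * (σ * d * Real.log T * √(T : ℝ)) := by
  have hd' : (1 : ℝ) ≤ d := by exact_mod_cast hd
  have hτ1 : (0 : ℝ) < τ := by nlinarith
  have hτ0 : 0 < τ := by exact_mod_cast hτ1
  have hlog := hT.one_le_log
  obtain ⟨z, hz, ez, hmax⟩ := exists_maxReward_eq hXc hX θ
  have hsub := fun e => (episodeState_set (σ := σ) (T := T) (τ := τ) (D := D) (order := order)
    (arm := arm) (reward := reward) hX hXc e)
  have hmono := episodeStart_strictMono (σ := σ) (T := T) (τ := τ) (arm := arm) (reward := reward)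
    hX hXc hD ho hτ0
  have h0 := survivors_of_error hXc hone hz hmax
  -- The best arm of `X` is never eliminated, so the maximum over the survivors remains the global
  -- one.
  have hzmem : ∀ e, (episodeState X D order σ T τ arm reward e).1 ≤ T →
      z ∈ (episodeState X D order σ T τ arm reward e).2 := by
    intro e
    induction e with
    | zero => exact fun _ => h0.1
    | succ e ih =>
      intro heT
      have hz' := ih ((hmono (Nat.lt_succ_self e)).le.trans heT)
      exact (survivors_of_error (hsub e).2.2
        (fun x hx => episode_error_le hd hT hX hXc hD ho hτ0 hf heT (hS e heT) hx) hz'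
        fun y hy => hmax y ((hsub e).1 hy)).1
  have hset0 : ∀ e, (episodeState X D order σ T τ arm reward e).2
      ⊆ (episodeState X D order σ T τ arm reward 0).2 := by
    intro e
    induction e with
    | zero => exact le_rfl
    | succ e ih => exact (survivors_subset _ _ _ _ _).trans ih
  have hreg0 : ∀ i, τ ≤ i → i < T → maxReward X θ - arm i ⬝ᵥ θ ≤ 16 * radius d σ T τ := by
    intro i hi hiT
    obtain ⟨e, h1, h2⟩ := exists_episode (σ := σ) (T := T) (arm := arm) (reward := reward)
      hX hXc hD ho hτ0 hi
    rw [ez]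
    exact h0.2 _ (hset0 e (linPE_arm_mem_episode ho hX hXc hD hf h1 h2 hiT))
  refine ⟨hreg0, ?_⟩
  -- The survivors in episode e + 1 are within 16 radii at sample size T', and i + 1 ≤ 12 T' ≤
  -- (7/2)² T' there; in episode 0 even i + 1 ≤ 4τ. This gives 16 · 7/2 = 56.
  have hreg : ∀ i, τ ≤ i → i < T →
      maxReward X θ - arm i ⬝ᵥ θ ≤ 56 * radius d σ T ((i : ℝ) + 1) := by
    intro i hi hiT
    obtain ⟨e, h1, h2⟩ := exists_episode (σ := σ) (T := T) (arm := arm) (reward := reward)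
      hX hXc hD ho hτ0 hi
    have hi1 : ((i : ℝ) + 1) ≤ 6 * episodeParam τ e := by
      refine le_trans ?_ (episodeStart_succ_le (σ := σ) (T := T) (arm := arm) (reward := reward)
        hX hXc hD ho hτ hd e)
      exact_mod_cast h2
    rcases e with _ | e
    · refine (hreg0 i hi hiT).trans ?_
      have := radius_le_mul_radius (d := d) (σ := σ) (T := T) (m := (i : ℝ) + 1) (n := τ)
        (c := 7 / 2) (by positivity) hτ1 (by norm_num) (by
          rw [episodeParam] at hi1
          linarith)
      linarith
    · have heT := h1.trans hiT.le
      have hz' := hzmem e ((hmono (Nat.lt_succ_self e)).le.trans heT)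
      have hmem := linPE_arm_mem_episode ho hX hXc hD hf h1 h2 hiT
      have h3 := (survivors_of_error (hsub e).2.2
        (fun x hx => episode_error_le hd hT hX hXc hD ho hτ0 hf heT (hS e heT) hx) hz'
        fun y hy => hmax y ((hsub e).1 hy)).2 _ hmem
      rw [episodeParam_succ] at hi1
      have := radius_le_mul_radius (d := d) (σ := σ) (T := T) (m := (i : ℝ) + 1)
        (n := episodeParam τ e) (c := 7 / 2) (by positivity) (episodeParam_pos hτ0 e)
        (by norm_num) (by linarith [episodeParam_pos hτ0 e])
      rw [ez]
      linarith
  have hrad : ∀ i : ℕ, radius d σ T ((i : ℝ) + 1) = σ * d * √(Real.log T) * (1 / √((i : ℝ) + 1)) := by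
    intro i
    rw [radius, Real.sqrt_div' _ (by positivity), Real.sqrt_mul (by positivity), ← mul_pow,
      Real.sqrt_sq (by positivity)]
    ring
  have hsqlog : √(Real.log T) ≤ Real.log T := by
    rw [Real.sqrt_le_left (by linarith)]
    nlinarith
  calc ∑ i ∈ Finset.Ico τ T, (maxReward X θ - arm i ⬝ᵥ θ)
      ≤ ∑ i ∈ Finset.Ico τ T, 56 * radius d σ T ((i : ℝ) + 1) :=
        Finset.sum_le_sum fun i hi => hreg i (Finset.mem_Ico.1 hi).1 (Finset.mem_Ico.1 hi).2
    _ ≤ ∑ i ∈ Finset.range T, 56 * radius d σ T ((i : ℝ) + 1) := by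
        refine Finset.sum_le_sum_of_subset_of_nonneg ?_ fun i _ _ => ?_
        · intro i hi
          exact Finset.mem_range.2 (Finset.mem_Ico.1 hi).2
        · exact mul_nonneg (by norm_num) (radius_nonneg _ _ _ _)
    _ = 56 * (σ * d * √(Real.log T)) * ∑ i ∈ Finset.range T, 1 / √((i : ℝ) + 1) := by
        rw [Finset.mul_sum]
        exact Finset.sum_congr rfl fun i _ => by rw [hrad]; ring
    _ ≤ 56 * (σ * d * Real.log T) * (2 * √(T : ℝ)) := by
        have := sum_inv_sqrt_le T
        have h1 : 0 ≤ ∑ i ∈ Finset.range T, 1 / √((i : ℝ) + 1) :=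
          Finset.sum_nonneg fun i _ => by positivity
        gcongr
    _ = 112 * (σ * d * Real.log T * √(T : ℝ)) := by ring

end LinPE

/-! ### Regret on the favourable event -/

section Path

variable {d : ℕ} {σ α₀ α₁ : ℝ} {T : ℕ} {X : Set (Vec d)} {θ : Vec d} {alg : PhaseTwo}
  {D : Set (Vec d) → (Vec d →₀ ℝ)} {order : Finset (Vec d) → List (Vec d)}
  {flag : ℕ → Bool} {sample arm : ℕ → Vec d} {reward : ℕ → ℝ}

lemma fst_mem_of_mem_queueAfter {l : Vec d →₀ ℝ} {n start : ℕ} (ho : IsEnumeration order) (j : ℕ) :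
    ∀ p ∈ queueAfter order l n flag start j, p.1 ∈ l.support := by
  induction j with
  | zero =>
    intro p hp
    obtain ⟨z, hz, rfl⟩ := List.mem_map.1 hp
    exact ((ho l.support).2 z).1 hz
  | succ j ih =>
    rw [queueAfter]
    split_ifs
    · generalize queueAfter order l n flag start j = q at ih ⊢
      rcases q with _ | ⟨⟨z, c⟩, q⟩
      · simp [serveQueue]
      · rw [serveQueue]
        intro p hp
        split_ifs at hp
        · exact ih p (List.mem_cons_of_mem _ hp)
        · rcases List.mem_append.1 hp with h | h
          · exact ih p (List.mem_cons_of_mem _ h)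
          · rw [List.mem_singleton.1 h]
            exact ih (z, c) List.mem_cons_self
    · exact ih

lemma pulledArm_mem {S : Set (Vec d)} {f : Bool} {u : Vec d} {q : List (Vec d × ℕ)} (hu : u ∈ S)
    (hq : ∀ p ∈ q, p.1 ∈ S) : pulledArm f u q ∈ S := by
  rcases f with _ | _
  · exact hu
  · rcases q with _ | ⟨⟨z, c⟩, q⟩
    · exact hu
    · exact hq (z, c) List.mem_cons_self

lemma arm_mem (hlog : 0 < ⌈72 * Real.log T⌉₊) (hX : X.Nonempty) (hXc : IsCompact X)
    (hD : IsDesignOracle X D) (ho : IsEnumeration order)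
    (hf : FollowsFairLinBandit alg X D order σ T flag sample arm reward)
    (hs : ∀ i < T, sample i ∈ X) {i : ℕ} (hi : i < T) : arm i ∈ X := by
  rcases phase_cases (σ := σ) (arm := arm) (reward := reward) hX hlog i with
    ⟨k, hk, h1, h2⟩ | ⟨k, hk, hended, hτ⟩
  · obtain ⟨j, rfl⟩ := Nat.exists_eq_add_of_le h1
    rw [epochStart_succ] at h2
    rw [hf.phaseOne k hk j (by omega) hi]
    exact pulledArm_mem (hs _ hi) fun p hp =>
      (hD X le_rfl hX hXc).design.mem _ (fst_mem_of_mem_queueAfter ho j p hp)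
  · have h2 := hf.phaseTwo (k + 1) hk hended
    rcases alg with _ | α
    · exact linPE_arm_mem hX hXc hD ho (hlog.trans_le (ceil_le_epochStart_succ T k)) h2 hτ hi
    · exact (h2 i hτ hi).1

/-- Both algorithms stay within 16 radii of the best reward, and the end of Phase I certifies that
32 radii are at most that reward. -/
lemma phaseTwo_regret (hd : 0 < d) (hσ : 0 < σ) (hα₀ : 0 < α₀)
    (halg : alg = PhaseTwo.linPE ∨ ∃ α, α₀ ≤ α ∧ α ≤ α₁ ∧ alg = PhaseTwo.linUCB α)
    (hT : IsLargeHorizon d σ α₀ α₁ T) (hX : X.Nonempty) (hXc : IsCompact X)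
    (hX1 : ∀ x ∈ X, euclNorm x ≤ 1) (hθ : euclNorm θ ≤ 1) (hθ0 : ∀ x ∈ X, 0 ≤ x ⬝ᵥ θ)
    (hD : IsDesignOracle X D) (ho : IsEnumeration order)
    (hg : IsGoodPath alg X D order σ T θ flag arm reward)
    (hf : FollowsFairLinBandit alg X D order σ T flag sample arm reward)
    (harm : ∀ i < T, arm i ∈ X) {k : ℕ}
    (hk : ∀ k' < k + 1, PhaseOneContinues X σ T arm reward (epochStart T k'))
    (hended : ¬ PhaseOneContinues X σ T arm reward (epochStart T (k + 1)))
    (hkT : epochStart T (k + 1) ≤ T) :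
    (∀ i, epochStart T (k + 1) ≤ i → i < T → maxReward X θ / 2 ≤ arm i ⬝ᵥ θ) ∧
    ∑ i ∈ Finset.Ico (epochStart T (k + 1)) T, (maxReward X θ - arm i ⬝ᵥ θ)
      ≤ 112 * (σ * d * Real.log T * √(T : ℝ)) := by
  have hone := fun x hx => phaseOne_error_le hd hT hX hXc hD ho hg hf harm hk hkT (x := x) hx
  have hV := phaseOne_quad_le hd hT hX hXc hD ho hg hf hk hkT
  have h2 := hf.phaseTwo (k + 1) hk hended
  have hn72 : (⌈72 * Real.log T⌉₊ : ℝ) ≤ (epochStart T (k + 1) : ℝ) := by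
    exact_mod_cast ceil_le_epochStart_succ T k
  obtain ⟨h72, h72d⟩ := hT.ceil_ge
  have hrad := le_of_stops hX hXc hθ0 (by exact_mod_cast h72.trans hn72) hone hended
  have hlog := hT.one_le_log
  suffices h : (∀ i, epochStart T (k + 1) ≤ i → i < T →
      maxReward X θ - arm i ⬝ᵥ θ ≤ 16 * radius d σ T (epochStart T (k + 1))) ∧
      ∑ i ∈ Finset.Ico (epochStart T (k + 1)) T, (maxReward X θ - arm i ⬝ᵥ θ)
      ≤ 112 * (σ * d * Real.log T * √(T : ℝ)) from
    ⟨fun i hi hiT => by linarith [h.1 i hi hiT], h.2⟩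
  rcases halg with rfl | ⟨α, h0, h1, rfl⟩
  · refine linPE_regret hd hσ hT hX hXc hD ho (h72d.trans hn72) h2 hone fun e heT v => ?_
    exact hg.linPE rfl k e heT (fun j h => h2 e j h (by
      rw [episodeStart_succ] at heT
      omega)) v
  · obtain ⟨ha, hb⟩ := linUCB_regret hd hσ hα₀ h0 h1 hT hX hXc hX1 hθ harm
      (fun t ht v => hg.linUCB α rfl t ht v) (h72d.trans hn72) hV
      (fun x hx => (hD X le_rfl hX hXc).sq_dotProduct_le hx) h2
    refine ⟨ha, hb.trans ?_⟩
    have : 0 ≤ σ * d * Real.log T * √(T : ℝ) := by positivity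
    linarith

/-- On the favourable event, all rounds that do not pull a random arm in a short initial phase are
almost optimal up to a factor two, and the regret after the initial phase is small. -/
lemma goodPath_regret (hd : 0 < d) (hσ : 0 < σ) (hα₀ : 0 < α₀)
    (halg : alg = PhaseTwo.linPE ∨ ∃ α, α₀ ≤ α ∧ α ≤ α₁ ∧ alg = PhaseTwo.linUCB α)
    (hT : IsLargeHorizon d σ α₀ α₁ T) (hX : X.Nonempty) (hXc : IsCompact X)
    (hX1 : ∀ x ∈ X, euclNorm x ≤ 1) (hθ : euclNorm θ ≤ 1) (hθ0 : ∀ x ∈ X, 0 ≤ x ⬝ᵥ θ)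
    (hD : IsDesignOracle X D) (ho : IsEnumeration order)
    (hg : IsGoodPath alg X D order σ T θ flag arm reward)
    (hf : FollowsFairLinBandit alg X D order σ T flag sample arm reward)
    (harm : ∀ i < T, arm i ∈ X) (hμ : 0 < maxReward X θ) :
    (∀ i < T, maxReward X θ / 2 ≤ arm i ⬝ᵥ θ ∨
      ((i : ℝ) < phaseOneBound d σ T (maxReward X θ) ∧ (flag i = false → arm i = sample i))) ∧
    ∑ i ∈ Finset.range T, (if phaseOneBound d σ T (maxReward X θ) ≤ i then
      maxReward X θ - arm i ⬝ᵥ θ else 0) ≤ 112 * (σ * d * Real.log T * √(T : ℝ)) := by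
  have hlog := hT.one_le_log
  have hL : 0 < ⌈72 * Real.log T⌉₊ := Nat.ceil_pos.2 (by linarith)
  constructor
  · intro i hi
    rcases phase_cases (σ := σ) (arm := arm) (reward := reward) hX hL i with
      ⟨k, hk, h1, h2⟩ | ⟨k, hk, hended, hτ⟩
    · refine Or.inr ⟨lt_trans (by exact_mod_cast h2)
        (lt_phaseOneBound hd hT hX hXc hD ho hg hf harm hμ hk (h1.trans hi.le)), fun hfl => ?_⟩
      obtain ⟨j, rfl⟩ := Nat.exists_eq_add_of_le h1
      rw [epochStart_succ] at h2
      rw [hf.phaseOne k hk j (by omega) hi, hfl]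
      rfl
    · exact Or.inl ((phaseTwo_regret hd hσ hα₀ halg hT hX hXc hX1 hθ hθ0 hD ho hg hf harm hk hended
        (hτ.trans hi.le)).1 i hτ hi)
  · have hgap : ∀ i < T, 0 ≤ maxReward X θ - arm i ⬝ᵥ θ := fun i hi =>
      sub_nonneg.2 (le_maxReward hXc θ (harm i hi))
    have hzero : ∀ {k : ℕ}, (epochStart T (k + 1) : ℝ) < phaseOneBound d σ T (maxReward X θ) →
        ∀ i < epochStart T (k + 1), ¬ phaseOneBound d σ T (maxReward X θ) ≤ i := by
      intro k h i hi
      have : (i : ℝ) < epochStart T (k + 1) := by exact_mod_cast hi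
      linarith
    -- Either Phase I is still running at the horizon, and no round contributes to the sum, or all
    -- contributing rounds belong to Phase II.
    rcases phase_cases (σ := σ) (arm := arm) (reward := reward) hX hL T with
      ⟨k, hk, h1, h2⟩ | ⟨k, hk, hended, hτ⟩
    · have hb := lt_phaseOneBound hd hT hX hXc hD ho hg hf harm hμ hk h1
      rw [Finset.sum_eq_zero fun i hi =>
        if_neg (hzero hb i ((Finset.mem_range.1 hi).trans h2))]
      positivity
    · have hb := lt_phaseOneBound hd hT hX hXc hD ho hg hf harm hμ
        (fun k' h => hk k' (Nat.lt_succ_of_le h)) ((epochStart_mono T (Nat.le_succ k)).trans hτ)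
      refine le_trans ?_ (phaseTwo_regret hd hσ hα₀ halg hT hX hXc hX1 hθ hθ0 hD ho hg hf harm hk
        hended hτ).2
      rw [Finset.range_eq_Ico, ← Finset.sum_Ico_consecutive _ (Nat.zero_le _) hτ,
        Finset.sum_eq_zero fun i hi => if_neg (hzero hb i (Finset.mem_Ico.1 hi).2), zero_add]
      refine Finset.sum_le_sum fun i hi => ?_
      split_ifs
      · exact le_rfl
      · exact hgap i (Finset.mem_Ico.1 hi).2

end Path

/-! ### Probability of the favourable event -/

/-! ### Dependence of LinPE episodes on the past -/

section Causality

variable {d : ℕ} {σ : ℝ} {T τ : ℕ} {X : Set (Vec d)} {D : Set (Vec d) → (Vec d →₀ ℝ)}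
  {order : Finset (Vec d) → List (Vec d)} {arm arm' : ℕ → Vec d} {reward reward' : ℕ → ℝ}

lemma estimate_congr {m n : ℕ} (ha : ∀ i < n, arm i = arm' i)
    (hr : ∀ i < n, reward i = reward' i) : estimate arm reward m n = estimate arm' reward' m n := by
  have h1 : gramMatrix arm m n = gramMatrix arm' m n :=
    Finset.sum_congr rfl fun i hi => by rw [ha i (Finset.mem_Ico.1 hi).2]
  have h2 : responseSum arm reward m n = responseSum arm' reward' m n :=
    Finset.sum_congr rfl fun i hi => by
      rw [ha i (Finset.mem_Ico.1 hi).2, hr i (Finset.mem_Ico.1 hi).2]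
  rw [estimate, estimate, h1, h2]

/-- An episode that starts by round `s` is determined by the rounds before `s`. Its schedule can
thus be computed from a truncated path. -/
lemma episodeState_congr {s : ℕ} (ha : ∀ i < s, arm i = arm' i)
    (hr : ∀ i < s, reward i = reward' i) {e : ℕ}
    (hs : (episodeState X D order σ T τ arm reward e).1 ≤ s) :
    episodeState X D order σ T τ arm' reward' e = episodeState X D order σ T τ arm reward e := by
  induction e with
  | zero =>
    have hs : τ ≤ s := hs
    rw [episodeState, episodeState, estimate_congr (fun i hi => (ha i (hi.trans_le hs)).symm)
      (fun i hi => (hr i (hi.trans_le hs)).symm)]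
  | succ e ih =>
    have h1 := ih ((Nat.le_add_right _ _).trans hs)
    rw [episodeStart_succ] at hs
    rw [episodeState, episodeState, h1]
    refine Prod.ext rfl ?_
    change survivors _ _ _ _ _ = survivors _ _ _ _ _
    rw [estimate_congr (fun i hi => (ha i (lt_of_lt_of_le hi hs)).symm)
      (fun i hi => (hr i (lt_of_lt_of_le hi hs)).symm)]

/-- The sum of `f` over the pulls of an episode, padded by zeros. -/
lemma sum_getD_eq {M : Type*} [AddCommMonoid M] {f : Vec d → M} (hf : f 0 = 0)
    {pulls : List (Vec d)} {s n : ℕ} (hn : pulls.length ≤ n)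
    (harm : ∀ (j : ℕ) (h : j < pulls.length), arm (s + j) = pulls[j]) :
    ∑ j ∈ Finset.range n, f (pulls.getD j 0)
      = ∑ i ∈ Finset.Ico s (s + pulls.length), f (arm i) := by
  rw [Finset.sum_Ico_eq_sum_range, Nat.add_sub_cancel_left]
  symm
  refine Finset.sum_subset_zero_on_sdiff (Finset.range_mono hn) (fun j hj => ?_) fun j hj => ?_
  · have : pulls.length ≤ j := by simpa using (Finset.mem_sdiff.1 hj).2
    rw [List.getD_eq_default _ _ this, hf]
  · have hj := Finset.mem_range.1 hj
    rw [harm j hj, List.getD_eq_getElem _ _ hj]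

end Causality

/-- Episodes are functions of whole trajectories, of which only the rounds before `s` are known at
time `s`; setting the others to 0 yields a measurable substitute. -/
lemma measurable_truncate {d : ℕ} {Ω : Type*} {m : MeasurableSpace Ω} {arm : ℕ → Ω → Vec d}
    {reward : ℕ → Ω → ℝ} {s : ℕ} (ha : ∀ i < s, Measurable (arm i))
    (hr : ∀ i < s, Measurable (reward i)) :
    Measurable fun ω => ((fun i => if i < s then arm i ω else 0 : ℕ → Vec d),
      (fun i => if i < s then reward i ω else 0 : ℕ → ℝ)) := by
  refine Measurable.prodMk (measurable_pi_lambda _ fun i => ?_)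
    (measurable_pi_lambda _ fun i => ?_)
  · by_cases hi : i < s
    · simpa only [hi, if_true] using ha i hi
    · simp only [hi, if_false]
      exact measurable_const
  · by_cases hi : i < s
    · simpa only [hi, if_true] using hr i hi
    · simp only [hi, if_false]
      exact measurable_const

section GoodEvent

variable {d : ℕ} {Ω : Type*} {mΩ : MeasurableSpace Ω} {P : Measure Ω}
  {ℱ : Filtration ℕ mΩ} {T : ℕ} {θ : Vec d} {σ α₀ α₁ : ℝ} {ρ : Vec d →₀ ℝ}
  {flag : ℕ → Ω → Bool} {sample arm : ℕ → Ω → Vec d} {reward : ℕ → Ω → ℝ}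
  {X : Set (Vec d)} {D : Set (Vec d) → (Vec d →₀ ℝ)} {order : Finset (Vec d) → List (Vec d)}

lemma measure_biUnion_range_le {A : ℕ → Set Ω} {n : ℕ} {c : ENNReal}
    (h : ∀ k < n, P (A k) ≤ c) : P {ω | ∃ k < n, ω ∈ A k} ≤ n * c := by
  have e : {ω | ∃ k < n, ω ∈ A k} = ⋃ k ∈ Finset.range n, A k := by
    ext ω; simp
  rw [e]
  refine (measure_biUnion_finset_le _ _).trans ?_
  refine (Finset.sum_le_card_nsmul _ _ c fun k hk => h k (Finset.mem_range.1 hk)).trans ?_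
  rw [Finset.card_range, nsmul_eq_mul]

lemma exp_neg_mul_log (hT : 0 < T) (m : ℕ) :
    Real.exp (-(m * Real.log T)) = 1 / (T : ℝ) ^ m := by
  rw [Real.exp_neg, ← Real.log_pow, Real.exp_log (by positivity), one_div]

lemma natCast_mul_ofReal (hT : 0 < T) (m : ℕ) :
    (T : ENNReal) * ENNReal.ofReal (1 / (T : ℝ) ^ (m + 1)) = ENNReal.ofReal (1 / (T : ℝ) ^ m) := by
  have : (0 : ℝ) < T := by exact_mod_cast hT
  rw [← ENNReal.ofReal_natCast, ← ENNReal.ofReal_mul (by positivity)]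
  congr 1
  field_simp
  ring

lemma measure_flags_le [IsProbabilityMeasure P] (hlog : 1 ≤ Real.log T) (hT0 : 0 < T)
    (hc : IsCoinSequence P ℱ T ρ flag sample) (hρ : IsDesign X ρ) :
    P {ω | ¬ ∀ k, epochStart T (k + 1) ≤ T → (epochLength T k : ℝ) / 2 - epochLength T k / 7
      ≤ flagCount (fun i => flag i ω) (epochStart T k) (epochStart T k + epochLength T k)}
      ≤ ENNReal.ofReal (1 / T) := by
  have hL : 0 < ⌈72 * Real.log T⌉₊ := Nat.ceil_pos.2 (by linarith)
  set A : ℕ → Set Ω := fun k => {ω | epochStart T (k + 1) ≤ T ∧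
    (flagCount (fun i => flag i ω) (epochStart T k) (epochStart T k + epochLength T k) : ℝ)
      < (epochLength T k : ℝ) / 2 - epochLength T k / 7}
  have hA : ∀ k < T, P (A k) ≤ ENNReal.ofReal (1 / (T : ℝ) ^ 2) := by
    intro k _
    by_cases hk : epochStart T (k + 1) ≤ T
    · rw [epochStart_succ] at hk
      have h := hc.measure_flagCount_lt_le hρ (Nat.le_add_right (epochStart T k) (epochLength T k)) hk
      rw [Nat.cast_add, add_sub_cancel_left] at h
      refine (measure_mono fun ω hω => hω.2).trans (h.trans ?_)
      rw [← exp_neg_mul_log hT0]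
      -- 72 · 2/49 > 2, so an epoch fails with probability at most T⁻², which leaves room for a
      -- union over T epochs.
      refine ENNReal.ofReal_le_ofReal (Real.exp_le_exp.2 ?_)
      have h1 : 72 * Real.log T ≤ epochLength T k :=
        (Nat.le_ceil _).trans (by exact_mod_cast ceil_le_epochLength T k)
      push_cast
      linarith
    · have : A k = ∅ := Set.eq_empty_of_forall_notMem fun ω hω => hk hω.1
      rw [this, measure_empty]
      exact zero_le
  refine (measure_mono ?_).trans ((measure_biUnion_range_le hA).trans
    (le_of_eq (by simpa using natCast_mul_ofReal hT0 1)))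
  intro ω hω
  simp only [Set.mem_ofPred_eq, not_forall, not_le] at hω
  obtain ⟨k, hk, h⟩ := hω
  exact ⟨k, (le_epochStart hL (k + 1)).trans hk, hk, h⟩

lemma measure_phaseOne_le [IsProbabilityMeasure P] (hσ : 0 < σ) (hT0 : 0 < T)
    (hb : IsBanditInteraction P ℱ T θ σ flag sample arm reward)
    (hc : IsCoinSequence P ℱ T ρ flag sample) {l : Vec d →₀ ℝ} (hl : IsDesign X l) :
    P {ω | ¬ ∀ t ≤ T, (∀ v, v ⬝ᵥ (gramMatrix (fun i => arm i ω) 0 t *ᵥ v)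
        ≤ T * d * (v ⬝ᵥ (designMatrix l *ᵥ v))) →
      ∀ v, (responseSum (fun i => arm i ω) (fun i => reward i ω - arm i ω ⬝ᵥ θ) 0 t ⬝ᵥ v) ^ 2
      ≤ σ ^ 2 * (2 * Real.log T + d * Real.log (1 + T * d))
        * (v ⬝ᵥ (gramMatrix (fun i => arm i ω) 0 t *ᵥ v) + v ⬝ᵥ (designMatrix l *ᵥ v))}
      ≤ ENNReal.ofReal (1 / T) := by
  have h := measure_selfNormalized_posSemidef_le (L := Real.log T) (c := T * d) hσ hb hc
    (Nat.zero_le T) (H := fun _ => designMatrix l) (fun i j => measurable_const)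
    (fun _ => designMatrix_posSemidef hl) (by positivity)
  have e := exp_neg_mul_log hT0 1
  rw [Nat.cast_one, one_mul, pow_one] at e
  rw [e] at h
  refine (measure_mono ?_).trans h
  intro ω hω
  simp only [Set.mem_ofPred_eq, not_forall, not_le] at hω
  obtain ⟨t, ht, hup, v, hv⟩ := hω
  exact ⟨t, Nat.zero_le t, ht, hup, v, hv⟩

lemma measure_linUCB_le [IsProbabilityMeasure P] (hσ : 0 < σ) (hT0 : 0 < T)
    (hb : IsBanditInteraction P ℱ T θ σ flag sample arm reward)
    (hc : IsCoinSequence P ℱ T ρ flag sample) {α : ℝ} (hα : 0 < α) :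
    P {ω | ¬ ∀ t ≤ T, ∀ v,
      (responseSum (fun i => arm i ω) (fun i => reward i ω - arm i ω ⬝ᵥ θ) 0 t ⬝ᵥ v) ^ 2
      ≤ σ ^ 2 * (2 * Real.log T + Real.log ((α • (1 : Matrix (Fin d) (Fin d) ℝ)
        + gramMatrix (fun i => arm i ω) 0 t).det / (α • (1 : Matrix (Fin d) (Fin d) ℝ)).det))
        * (v ⬝ᵥ ((α • (1 : Matrix (Fin d) (Fin d) ℝ) + gramMatrix (fun i => arm i ω) 0 t) *ᵥ v))}
      ≤ ENNReal.ofReal (1 / T) := by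
  have h := measure_selfNormalized_le (L := Real.log T) hσ hb hc
    (Nat.zero_le T) (H := fun _ => α • (1 : Matrix (Fin d) (Fin d) ℝ))
    (fun i j => measurable_const) (fun _ => ridge_posDef hα)
  have e := exp_neg_mul_log hT0 1
  rw [Nat.cast_one, one_mul, pow_one] at e
  rw [e] at h
  refine (measure_mono ?_).trans h
  intro ω hω
  simp only [Set.mem_ofPred_eq, not_forall, not_le] at hω
  obtain ⟨t, ht, v, hv⟩ := hω
  exact ⟨t, Nat.zero_le t, ht, v, hv⟩

/-- The self-normalized bound for one episode of LinPE that starts in round `s`. -/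
lemma measure_episode_le [IsProbabilityMeasure P] (hσ : 0 < σ) (hT0 : 0 < T)
    (hb : IsBanditInteraction P ℱ T θ σ flag sample arm reward)
    (hc : IsCoinSequence P ℱ T ρ flag sample)
    (hm : IsMeasurableLinPE X D order σ T) (τ e : ℕ) {s : ℕ} (hs : s ≤ T) :
    P {ω | (episodeState X D order σ T τ (fun i => arm i ω) (fun i => reward i ω) e).1 = s ∧
      ∃ pulls, pulls = episodePulls order (D (episodeState X D order σ T τ (fun i => arm i ω)
        (fun i => reward i ω) e).2) (episodeParam τ e) ∧ s + pulls.length ≤ T ∧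
      (∀ (j : ℕ) (h : j < pulls.length), arm (s + j) ω = pulls[j]) ∧
      ∃ v, σ ^ 2 * (8 * Real.log T + d * Real.log 4) * (4 / 3)
        * (v ⬝ᵥ (gramMatrix (fun i => arm i ω) s (s + pulls.length) *ᵥ v))
        < (responseSum (fun i => arm i ω) (fun i => reward i ω - arm i ω ⬝ᵥ θ) s
          (s + pulls.length) ⬝ᵥ v) ^ 2} ≤ ENNReal.ofReal (1 / (T : ℝ) ^ 4) := by
  set past : Ω → (ℕ → Vec d) × (ℕ → ℝ) := fun ω =>
    (fun i => if i < s then arm i ω else 0, fun i => if i < s then reward i ω else 0)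
  have hpast : Measurable[ℱ s] past := measurable_truncate
    (fun i hi => hb.measurable_arm hc hi (hi.trans_le hs))
    fun i hi => hb.measurable_reward hi (hi.trans_le hs)
  set x : ℕ → Ω → Vec d := fun j ω => (episodePulls order (D (episodeState X D order σ T τ
    (past ω).1 (past ω).2 e).2) (episodeParam τ e)).getD j 0
  have hx : ∀ j, Measurable[ℱ s] (x j) := fun j => (hm.pulls τ e j).comp hpast
  -- The Gram matrix of the scheduled pulls is known when the episode starts. Padding by the zero
  -- vector up to length `T` does not change it and fixes the index range.
  set H : Ω → Matrix (Fin d) (Fin d) ℝ := fun ω => (1 / 3 : ℝ) • gramMatrix (fun i => x i ω) 0 T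
  have hH : ∀ i j, Measurable[ℱ s] fun ω => H ω i j := fun i j =>
    (measurable_gramMatrix_apply (m := ℱ s) (fun u _ _ => hx u) i j).const_mul _
  have hpos : ∀ ω, (H ω).PosSemidef := fun ω =>
    (gramMatrix_posSemidef _ _ _).smul (by norm_num)
  -- If the episode is carried out, then V = 3H: so c = 3, which gives log 4, and V + H = (4/3) V.
  -- The tail T⁻⁴ allows a union over three indices below T.
  have h := measure_selfNormalized_posSemidef_le (L := 4 * Real.log T) (c := 3) hσ hb hc hs hH hpos
    (by norm_num)
  have ee := exp_neg_mul_log hT0 4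
  rw [Nat.cast_ofNat] at ee
  rw [ee] at h
  refine (measure_mono ?_).trans h
  rintro ω ⟨hstart, pulls, hp, hlen, harm, v, hv⟩
  have hstate : episodeState X D order σ T τ (past ω).1 (past ω).2 e
      = episodeState X D order σ T τ (fun i => arm i ω) (fun i => reward i ω) e :=
    episodeState_congr (s := s) (fun i hi => by simp [past, hi]) (fun i hi => by simp [past, hi])
      hstart.le
  have hG : ∀ u, u ⬝ᵥ (H ω *ᵥ u)
      = 1 / 3 * (u ⬝ᵥ (gramMatrix (fun i => arm i ω) s (s + pulls.length) *ᵥ u)) := by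
    intro u
    simp only [H, Matrix.smul_mulVec, dotProduct_smul, smul_eq_mul]
    congr 3
    rw [gramMatrix, ← Finset.range_eq_Ico, gramMatrix,
      ← sum_getD_eq (f := fun y : Vec d => Matrix.vecMulVec y y) (arm := fun i => arm i ω)
        (n := T) (by simp) (by omega) harm]
    refine Finset.sum_congr rfl fun j _ => ?_
    simp only [x, hstate, ← hp]
  refine ⟨s + pulls.length, Nat.le_add_right _ _, hlen, fun u => ?_, v, lt_of_le_of_lt ?_ hv⟩
  · rw [hG]
    linarith
  · rw [hG, show (1 : ℝ) + 3 = 4 by norm_num]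
    refine le_of_eq ?_
    ring

/-- A union over the end of Phase I, the episode, and the random round in which the episode starts.
All three indices are below T, as the starts increase strictly from at least k + 1. -/
lemma measure_linPE_le [IsProbabilityMeasure P] (hσ : 0 < σ) (hT0 : 0 < T)
    (hlog : 1 ≤ Real.log T)
    (hb : IsBanditInteraction P ℱ T θ σ flag sample arm reward)
    (hc : IsCoinSequence P ℱ T ρ flag sample) (hX : X.Nonempty) (hXc : IsCompact X)
    (hD : IsDesignOracle X D) (ho : IsEnumeration order) (hm : IsMeasurableLinPE X D order σ T) :
    P {ω | ¬ ∀ k e,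
      let start := (episodeState X D order σ T (epochStart T (k + 1)) (fun i => arm i ω)
        (fun i => reward i ω) e).1
      let S := (episodeState X D order σ T (epochStart T (k + 1)) (fun i => arm i ω)
        (fun i => reward i ω) e).2
      let pulls := episodePulls order (D S) (episodeParam (epochStart T (k + 1)) e)
      start + pulls.length ≤ T → (∀ (j : ℕ) (h : j < pulls.length), arm (start + j) ω = pulls[j]) →
      ∀ v, (responseSum (fun i => arm i ω) (fun i => reward i ω - arm i ω ⬝ᵥ θ) start
          (start + pulls.length) ⬝ᵥ v) ^ 2
        ≤ σ ^ 2 * (8 * Real.log T + d * Real.log 4) * (4 / 3)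
        * (v ⬝ᵥ (gramMatrix (fun i => arm i ω) start (start + pulls.length) *ᵥ v))}
      ≤ ENNReal.ofReal (1 / T) := by
  have hL : 0 < ⌈72 * Real.log T⌉₊ := Nat.ceil_pos.2 (by linarith)
  have h1 := fun k e => measure_biUnion_range_le (P := P) (n := T) fun s hs =>
    measure_episode_le (D := D) hσ hT0 hb hc hm (epochStart T (k + 1)) e (le_of_lt hs)
  have h2 := fun k => measure_biUnion_range_le (P := P) (n := T) fun e _ => h1 k e
  have h3 := measure_biUnion_range_le (P := P) (n := T) fun k _ => h2 k
  rw [natCast_mul_ofReal hT0 3, natCast_mul_ofReal hT0 2, natCast_mul_ofReal hT0 1, pow_one] at h3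
  refine (measure_mono ?_).trans h3
  intro ω hω
  simp only [Set.mem_ofPred_eq, not_forall, not_le] at hω
  obtain ⟨k, e, hlen, harm, v, hv⟩ := hω
  have hτ : 0 < epochStart T (k + 1) := hL.trans_le (ceil_le_epochStart_succ T k)
  have hmono := episodeStart_strictMono (σ := σ) (T := T) (arm := fun i => arm i ω)
    (reward := fun i => reward i ω) hX hXc hD ho hτ
  have hlt : (episodeState X D order σ T (epochStart T (k + 1)) (fun i => arm i ω)
      (fun i => reward i ω) e).1 < T := (hmono (Nat.lt_succ_self e)).trans_le hlen
  have he := hmono.le_apply (x := e)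
  have hk : epochStart T (k + 1) ≤ _ := hmono.monotone (Nat.zero_le e)
  have hk' := le_epochStart hL (k + 1)
  exact ⟨k, by omega, e, he.trans_lt hlt, _, hlt, rfl, _, rfl, hlen, harm, v, hv⟩

/-- The favourable event has probability at least `1 - 3 / T`. -/
lemma measure_not_isGoodPath_le [IsProbabilityMeasure P] (hσ : 0 < σ) (hα₀ : 0 < α₀) (hT0 : 0 < T)
    (hlog : 1 ≤ Real.log T) {alg : PhaseTwo}
    (halg : (alg = PhaseTwo.linPE ∧ IsMeasurableLinPE X D order σ T) ∨
      ∃ α, α₀ ≤ α ∧ α ≤ α₁ ∧ alg = PhaseTwo.linUCB α)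
    (hb : IsBanditInteraction P ℱ T θ σ flag sample arm reward)
    (hc : IsCoinSequence P ℱ T ρ flag sample) (hρ : IsDesign X ρ) (hX : X.Nonempty)
    (hXc : IsCompact X) (hD : IsDesignOracle X D) (ho : IsEnumeration order) :
    P {ω | ¬ IsGoodPath alg X D order σ T θ (fun i => flag i ω) (fun i => arm i ω)
      (fun i => reward i ω)} ≤ ENNReal.ofReal (3 / T) := by
  have e : ENNReal.ofReal (3 / T)
      = ENNReal.ofReal (1 / T) + ENNReal.ofReal (1 / T) + ENNReal.ofReal (1 / T) := by
    rw [← ENNReal.ofReal_add (by positivity) (by positivity),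
      ← ENNReal.ofReal_add (by positivity) (by positivity)]
    congr 1
    ring
  have h1 := measure_flags_le hlog hT0 hc hρ
  have h2 := measure_phaseOne_le hσ hT0 hb hc (hD X le_rfl hX hXc).design
  rw [e]
  rcases halg with ⟨rfl, hm⟩ | ⟨α, h0, -, rfl⟩
  · have h3 := measure_linPE_le hσ hT0 hlog hb hc hX hXc hD ho hm
    refine (measure_mono ?_).trans ((measure_union_le _ _).trans
      (add_le_add ((measure_union_le _ _).trans (add_le_add h1 h2)) h3))
    intro ω hω
    by_contra hcon
    simp only [Set.mem_union, Set.mem_ofPred_eq, not_or, not_not] at hcon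
    exact hω ⟨hcon.1.1, hcon.1.2, fun _ h => by simp at h, fun _ => hcon.2⟩
  · have h3 := measure_linUCB_le hσ hT0 hb hc (hα₀.trans_le h0)
    refine (measure_mono ?_).trans ((measure_union_le _ _).trans
      (add_le_add ((measure_union_le _ _).trans (add_le_add h1 h2)) h3))
    intro ω hω
    by_contra hcon
    simp only [Set.mem_union, Set.mem_ofPred_eq, not_or, not_not] at hcon
    refine hω ⟨hcon.1.1, hcon.1.2, fun α' h => ?_, fun h => by simp at h⟩
    obtain rfl : α = α' := by simpa using h
    exact hcon.2

end GoodEvent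

/-! ### The Nash regret -/

lemma eventually_isLargeHorizon {d : ℕ} (hd : 0 < d) {σ α₀ : ℝ} (hσ : 0 < σ) (hα₀ : 0 < α₀)
    (α₁ : ℝ) : ∀ᶠ T : ℕ in Filter.atTop, IsLargeHorizon d σ α₀ α₁ T := by
  have hlog : Filter.Tendsto (fun T : ℕ => Real.log T) Filter.atTop Filter.atTop :=
    Real.tendsto_log_atTop.comp tendsto_natCast_atTop_atTop
  have hcast : Filter.Tendsto (fun T : ℕ => (T : ℝ)) Filter.atTop Filter.atTop :=
    tendsto_natCast_atTop_atTop
  have hlittle : ∀ᶠ T : ℕ in Filter.atTop, 74 * Real.log T ≤ σ * √(T : ℝ) := by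
    have h := (isLittleO_log_rpow_atTop (show (0 : ℝ) < 1 / 2 by norm_num)).def
      (show 0 < σ / 74 by positivity)
    filter_upwards [hcast.eventually h] with T hT
    rw [← Real.sqrt_eq_rpow, Real.norm_of_nonneg (Real.log_natCast_nonneg T),
      Real.norm_of_nonneg (Real.sqrt_nonneg _)] at hT
    linarith
  have hd' : (0 : ℝ) < d := by exact_mod_cast hd
  filter_upwards [hlog.eventually_ge_atTop 1, hlog.eventually_ge_atTop ((d : ℝ) ^ 2),
    hlog.eventually_ge_atTop (α₁ / σ ^ 2), hcast.eventually_ge_atTop (1 + (d : ℝ)),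
    hcast.eventually_ge_atTop (1 + 1 / (d * α₀)), hcast.eventually_ge_atTop (32 * ((d : ℝ) + 1)),
    hlittle] with T h1 h2 h3 h4 h5 h6 h7
  refine ⟨h1, h2, by nlinarith, ?_, ?_, h6, h7⟩
  · have : 0 < 1 / (d * α₀) := by positivity
    rw [div_eq_mul_one_div]
    nlinarith
  · rw [div_le_iff₀ (by positivity)] at h3
    linarith

/-- A lower bound for the geometric mean. -/
lemma sub_geom_mean_le {T : ℕ} (hT : 0 < T) {E : ℕ → ℝ} {μ K N R : ℝ} (hμ : 0 < μ) (hK : 1 ≤ K)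
    (hN : 0 ≤ N) (h1 : ∀ t < T, μ / K ≤ E t) (h2 : ∀ t < T, N ≤ t → μ / 4 ≤ E t)
    (h3 : ∀ t < T, E t ≤ μ)
    (h4 : ∑ t ∈ Finset.range T, (if N ≤ t then μ - E t else 0) ≤ R) :
    μ - (∏ t ∈ Finset.range T, E t) ^ (1 / (T : ℝ)) ≤ (μ * ((N + 1) * Real.log K) + 4 * R) / T := by
  have hT' : (0 : ℝ) < T := by exact_mod_cast hT
  have hK0 : 0 < K := by linarith
  have hE : ∀ t ∈ Finset.range T, 0 < E t := fun t ht =>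
    (div_pos hμ hK0).trans_le (h1 t (Finset.mem_range.1 ht))
  have hlogK := Real.log_nonneg hK
  -- With x = E/μ: early rounds lose at most log K, and for 1/4 ≤ x ≤ 1 one has log x ≥ 1 - 1/x ≥
  -- -4(1 - x).
  have hterm : ∀ t ∈ Finset.range T, -((if (t : ℝ) < N then Real.log K else 0)
      + 4 / μ * (if N ≤ t then μ - E t else 0)) ≤ Real.log (E t / μ) := by
    intro t ht
    have ht' := Finset.mem_range.1 ht
    by_cases hNt : N ≤ t
    · rw [if_neg (not_lt.2 hNt), if_pos hNt, zero_add]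
      have hlow := h2 t ht' hNt
      have hx := Real.one_sub_inv_le_log_of_pos (div_pos (hE t ht) hμ)
      refine le_trans ?_ hx
      rw [inv_div, ← sub_nonneg]
      have h5 := hE t ht
      have e : 1 - μ / E t - -(4 / μ * (μ - E t)) = (μ - E t) * (4 * E t - μ) / (μ * E t) := by
        field_simp
        ring
      rw [e]
      have := h3 t ht'
      exact div_nonneg (mul_nonneg (by linarith) (by linarith)) (by positivity)
    · rw [if_pos (not_le.1 hNt), if_neg hNt, mul_zero, add_zero, ← Real.log_inv]
      refine Real.log_le_log (by positivity) ?_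
      rw [le_div_iff₀ hμ]
      have := h1 t ht'
      rwa [div_eq_inv_mul] at this
  have hcount : ∑ t ∈ Finset.range T, (if (t : ℝ) < N then Real.log K else 0)
      ≤ (N + 1) * Real.log K := by
    rw [← Finset.sum_filter, Finset.sum_const, nsmul_eq_mul]
    refine mul_le_mul_of_nonneg_right ?_ hlogK
    have hsub : (Finset.range T).filter (fun t : ℕ => (t : ℝ) < N) ⊆ Finset.range ⌈N⌉₊ := by
      intro t ht
      exact Finset.mem_range.2 (Nat.lt_ceil.2 (Finset.mem_filter.1 ht).2)
    have := Finset.card_le_card hsub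
    rw [Finset.card_range] at this
    have h5 : (((Finset.range T).filter (fun t : ℕ => (t : ℝ) < N)).card : ℝ) ≤ (⌈N⌉₊ : ℝ) := by
      exact_mod_cast this
    exact h5.trans (Nat.ceil_lt_add_one hN).le
  have hsum : -((N + 1) * Real.log K + 4 / μ * R) ≤ ∑ t ∈ Finset.range T, Real.log (E t / μ) := by
    refine le_trans ?_ (Finset.sum_le_sum hterm)
    rw [Finset.sum_neg_distrib, Finset.sum_add_distrib, ← Finset.mul_sum]
    have := mul_le_mul_of_nonneg_left h4 (show 0 ≤ 4 / μ by positivity)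
    linarith
  have hprod : (∏ t ∈ Finset.range T, E t) ^ (1 / (T : ℝ))
      = μ * Real.exp ((∑ t ∈ Finset.range T, Real.log (E t / μ)) / T) := by
    have e1 : ∏ t ∈ Finset.range T, E t = μ ^ T * ∏ t ∈ Finset.range T, (E t / μ) := by
      rw [Finset.prod_div_distrib, Finset.prod_const, Finset.card_range,
        mul_div_cancel₀ _ (by positivity)]
    have hpos : 0 < ∏ t ∈ Finset.range T, (E t / μ) :=
      Finset.prod_pos fun t ht => div_pos (hE t ht) hμ
    rw [e1, Real.mul_rpow (by positivity) hpos.le, ← Real.rpow_natCast, ← Real.rpow_mul hμ.le,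
      mul_one_div_cancel hT'.ne', Real.rpow_one, Real.rpow_def_of_pos hpos,
      Real.log_prod fun t ht => (div_pos (hE t ht) hμ).ne', mul_one_div]
  -- exp y ≥ 1 + y turns the bound on the mean logarithm into a bound on the difference from μ.
  have hexp := Real.add_one_le_exp ((∑ t ∈ Finset.range T, Real.log (E t / μ)) / T)
  have h5 := mul_le_mul_of_nonneg_left hexp hμ.le
  have h6 := mul_le_mul_of_nonneg_left (div_le_div_of_nonneg_right hsum hT'.le) hμ.le
  rw [hprod]
  have e2 : (μ * ((N + 1) * Real.log K) + 4 * R) / T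
      = -(μ * (-((N + 1) * Real.log K + 4 / μ * R) / T)) := by
    field_simp
  rw [e2]
  linarith

section NashRegret

variable {d : ℕ} {Ω : Type*} {mΩ : MeasurableSpace Ω} {P : Measure Ω}
  {ℱ : Filtration ℕ mΩ} {T : ℕ} {θ : Vec d} {σ α₀ α₁ : ℝ} {ρ : Vec d →₀ ℝ}
  {flag : ℕ → Ω → Bool} {sample arm : ℕ → Ω → Vec d} {reward : ℕ → Ω → ℝ}
  {X : Set (Vec d)} {D : Set (Vec d) → (Vec d →₀ ℝ)} {order : Finset (Vec d) → List (Vec d)}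
  {alg : PhaseTwo}

lemma IsBanditInteraction.integrable_mean [IsProbabilityMeasure P]
    (hb : IsBanditInteraction P ℱ T θ σ flag sample arm reward)
    (hc : IsCoinSequence P ℱ T ρ flag sample) (hXc : IsCompact X) (hθ0 : ∀ x ∈ X, 0 ≤ x ⬝ᵥ θ)
    {t : ℕ} (ht : t < T) (harm : ∀ᵐ ω ∂P, arm t ω ∈ X) :
    Integrable (fun ω => arm t ω ⬝ᵥ θ) P := by
  have hm : Measurable (arm t) := (hb.measurable_arm hc (Nat.lt_succ_self t) ht).mono (ℱ.le _) le_rfl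
  refine Integrable.of_bound (measurable_dotProduct hm measurable_const).aestronglyMeasurable
    (maxReward X θ) ?_
  filter_upwards [harm] with ω hω
  rw [Real.norm_of_nonneg (hθ0 _ hω)]
  exact le_maxReward hXc θ hω

lemma ae_arm_mem [IsProbabilityMeasure P] (hlog : 1 ≤ Real.log T) (hX : X.Nonempty)
    (hXc : IsCompact X) (hD : IsDesignOracle X D) (ho : IsEnumeration order) (hρ : IsDesign X ρ)
    (hc : IsCoinSequence P ℱ T ρ flag sample)
    (hf : ∀ᵐ ω ∂P, FollowsFairLinBandit alg X D order σ T (fun i => flag i ω)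
      (fun i => sample i ω) (fun i => arm i ω) (fun i => reward i ω)) :
    ∀ᵐ ω ∂P, (∀ i < T, sample i ω ∈ X) ∧ ∀ i < T, arm i ω ∈ X := by
  have hs : ∀ᵐ ω ∂P, ∀ i < T, sample i ω ∈ X := by
    rw [ae_all_iff]
    intro i
    by_cases hi : i < T
    · filter_upwards [hc.ae_sample_mem hρ hi] with ω hω _
      exact hρ.mem _ hω
    · exact Filter.Eventually.of_forall fun _ h => absurd h hi
  filter_upwards [hs, hf] with ω h1 h2
  exact ⟨h1, fun i hi => arm_mem (Nat.ceil_pos.2 (by linarith)) hX hXc hD ho h2 h1 hi⟩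

/-- Bounds for the expected rewards. -/
lemma mean_bounds [IsProbabilityMeasure P] (hd : 0 < d) (hσ : 0 < σ) (hα₀ : 0 < α₀)
    (halg : (alg = PhaseTwo.linPE ∧ IsMeasurableLinPE X D order σ T) ∨
      ∃ α, α₀ ≤ α ∧ α ≤ α₁ ∧ alg = PhaseTwo.linUCB α)
    (hT : IsLargeHorizon d σ α₀ α₁ T) (hX : X.Nonempty) (hXc : IsCompact X)
    (hX1 : ∀ x ∈ X, euclNorm x ≤ 1) (hθ : euclNorm θ ≤ 1) (hθ0 : ∀ x ∈ X, 0 ≤ x ⬝ᵥ θ)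
    (hD : IsDesignOracle X D) (ho : IsEnumeration order) (hρ : IsJohnDistribution X ρ)
    (hb : IsBanditInteraction P ℱ T θ σ flag sample arm reward)
    (hc : IsCoinSequence P ℱ T ρ flag sample)
    (hf : ∀ᵐ ω ∂P, FollowsFairLinBandit alg X D order σ T (fun i => flag i ω)
      (fun i => sample i ω) (fun i => arm i ω) (fun i => reward i ω))
    (hμ : 0 < maxReward X θ) :
    (∀ t < T, maxReward X θ / (8 * (d + 1)) ≤ ∫ ω, arm t ω ⬝ᵥ θ ∂P) ∧
    (∀ t < T, phaseOneBound d σ T (maxReward X θ) ≤ t →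
      maxReward X θ / 4 ≤ ∫ ω, arm t ω ⬝ᵥ θ ∂P) ∧
    (∀ t < T, ∫ ω, arm t ω ⬝ᵥ θ ∂P ≤ maxReward X θ) ∧
    ∑ t ∈ Finset.range T, (if phaseOneBound d σ T (maxReward X θ) ≤ t then
      maxReward X θ - ∫ ω, arm t ω ⬝ᵥ θ ∂P else 0)
      ≤ 112 * (σ * d * Real.log T * √(T : ℝ)) + 3 * maxReward X θ := by
  have hlog := hT.one_le_log
  have hd' : (1 : ℝ) ≤ d := by exact_mod_cast hd
  have hT32 := hT.dim_le
  have hTpos : (0 : ℝ) < T := by linarith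
  have hT0 : 0 < T := by exact_mod_cast hTpos
  set μ := maxReward X θ
  have hmem := ae_arm_mem hlog hX hXc hD ho hρ.design hc hf
  have hint : ∀ t < T, Integrable (fun ω => arm t ω ⬝ᵥ θ) P := fun t ht =>
    hb.integrable_mean hc hXc hθ0 ht (hmem.mono fun ω h => h.2 t ht)
  have hbad := measure_not_isGoodPath_le hσ hα₀ hT0 hlog halg hb hc hρ.design hX hXc hD ho
  -- The bad event need not be measurable, so it is replaced by a measurable hull of the same
  -- probability.
  set B : Set Ω := toMeasurable P {ω | ¬ IsGoodPath alg X D order σ T θ (fun i => flag i ω)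
    (fun i => arm i ω) (fun i => reward i ω)}
  have hBm : MeasurableSet B := measurableSet_toMeasurable _ _
  have hBint : Integrable (B.indicator fun _ => (1 : ℝ)) P := (integrable_const _).indicator hBm
  have hB : ∫ ω, B.indicator (fun _ => (1 : ℝ)) ω ∂P ≤ 3 / T := by
    rw [integral_indicator_const _ hBm, smul_eq_mul, mul_one, measureReal_def]
    refine ENNReal.toReal_le_of_le_ofReal (by positivity) ?_
    rw [measure_toMeasurable]
    exact hbad
  have halg' : alg = PhaseTwo.linPE ∨ ∃ α, α₀ ≤ α ∧ α ≤ α₁ ∧ alg = PhaseTwo.linUCB α :=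
    halg.imp_left And.left
  have hpath : ∀ᵐ ω ∂P, ω ∉ B → (∀ i < T, μ / 2 ≤ arm i ω ⬝ᵥ θ ∨
      ((i : ℝ) < phaseOneBound d σ T μ ∧ (flag i ω = false → arm i ω = sample i ω))) ∧
      ∑ i ∈ Finset.range T, (if phaseOneBound d σ T μ ≤ i then μ - arm i ω ⬝ᵥ θ else 0)
        ≤ 112 * (σ * d * Real.log T * √(T : ℝ)) := by
    filter_upwards [hmem, hf] with ω h1 h2 hω
    have hg := not_not.1 fun h => hω (subset_toMeasurable P _ h)
    exact goodPath_regret hd hσ hα₀ halg' hT hX hXc hX1 hθ hθ0 hD ho hg h2 h1.2 hμ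
  have h3T : 3 / (T : ℝ) ≤ 1 / (8 * (d + 1)) := by
    rw [div_le_div_iff₀ hTpos (by positivity)]
    linarith
  refine ⟨fun t ht => ?_, fun t ht hNt => ?_, fun t ht => ?_, ?_⟩
  · obtain ⟨hi, he⟩ := hc.integral_sample hρ.design ht θ
    -- Off `B` the reward is at least μ/2, which is no less than half the sampled reward, or else
    -- the flag U pulls the sample itself. The mean is therefore at least μ/(4(d+1)) minus μ P(B) ≤
    -- μ/(8(d+1)).
    have hle : ∫ ω, ((if flag t ω then 0 else sample t ω ⬝ᵥ θ) / 2
        - μ * B.indicator (fun _ => (1 : ℝ)) ω) ∂P ≤ ∫ ω, arm t ω ⬝ᵥ θ ∂P := by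
      refine integral_mono_ae ((hi.div_const 2).sub (hBint.const_mul μ)) (hint t ht) ?_
      filter_upwards [hmem, hpath] with ω h1 h2
      have hs := le_maxReward hXc θ (h1.1 t ht)
      have ha := hθ0 _ (h1.2 t ht)
      have hs0 := hθ0 _ (h1.1 t ht)
      by_cases hω : ω ∈ B
      · simp only [Set.indicator_of_mem hω]
        split_ifs <;> linarith
      · simp only [Set.indicator_of_notMem hω]
        rcases (h2 hω).1 t ht with h | ⟨-, h⟩
        · split_ifs <;> linarith
        · cases hfl : flag t ω
          · rw [h hfl]
            simp only [Bool.false_eq_true, if_false]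
            linarith
          · simp only [if_true]
            linarith
    rw [integral_sub (hi.div_const 2) (hBint.const_mul μ), integral_div, integral_const_mul,
      he] at hle
    obtain ⟨z, hz, ez, -⟩ := exists_maxReward_eq hXc hX θ
    have hjohn := IsJohnCenter.dotProduct_le hX hXc hρ.mean hθ0 hz
    rw [← ez] at hjohn
    have h4 := mul_le_mul_of_nonneg_left (hB.trans h3T) hμ.le
    have h5 : μ / (d + 1) ≤ (ρ.sum fun x w => w • x) ⬝ᵥ θ := by
      rw [div_le_iff₀ (by positivity), mul_comm]
      exact hjohn
    have e1 : μ / (d + 1) = 8 * (μ / (8 * (d + 1))) := by field_simp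
    have e2 : μ * (1 / (8 * (d + 1))) = μ / (8 * (d + 1)) := mul_one_div _ _
    rw [e2] at h4
    linarith
  · have hle : ∫ ω, (μ / 2 - μ * B.indicator (fun _ => (1 : ℝ)) ω) ∂P ≤ ∫ ω, arm t ω ⬝ᵥ θ ∂P := by
      refine integral_mono_ae ((integrable_const _).sub (hBint.const_mul μ)) (hint t ht) ?_
      filter_upwards [hmem, hpath] with ω h1 h2
      have ha := hθ0 _ (h1.2 t ht)
      by_cases hω : ω ∈ B
      · simp only [Set.indicator_of_mem hω]
        linarith
      · simp only [Set.indicator_of_notMem hω]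
        rcases (h2 hω).1 t ht with h | ⟨h, -⟩
        · linarith
        · exact absurd hNt (not_le.2 h)
    rw [integral_sub (integrable_const _) (hBint.const_mul μ), integral_const_mul,
      integral_const, probReal_univ, one_smul] at hle
    have h6 : 1 / (8 * ((d : ℝ) + 1)) ≤ 1 / 4 := by
      rw [div_le_div_iff₀ (by positivity) (by norm_num)]
      linarith
    have h4 := mul_le_mul_of_nonneg_left ((hB.trans h3T).trans h6) hμ.le
    linarith
  · have hle : ∫ ω, arm t ω ⬝ᵥ θ ∂P ≤ ∫ _, μ ∂P :=
      integral_mono_ae (hint t ht) (integrable_const _)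
        (hmem.mono fun ω h => le_maxReward hXc θ (h.2 t ht))
    rwa [integral_const, probReal_univ, one_smul] at hle
  · set g : ℕ → Ω → ℝ := fun t ω => if phaseOneBound d σ T μ ≤ t then μ - arm t ω ⬝ᵥ θ else 0
    have hg : ∀ t ∈ Finset.range T, Integrable (g t) P := by
      intro t ht
      by_cases hN : phaseOneBound d σ T μ ≤ t
      · simp only [g, hN, if_true]
        exact (integrable_const _).sub (hint t (Finset.mem_range.1 ht))
      · simp only [g, hN, if_false]
        exact integrable_zero _ _ _
    have e1 : ∑ t ∈ Finset.range T, (if phaseOneBound d σ T μ ≤ t then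
        μ - ∫ ω, arm t ω ⬝ᵥ θ ∂P else 0) = ∫ ω, ∑ t ∈ Finset.range T, g t ω ∂P := by
      rw [integral_finsetSum _ hg]
      refine Finset.sum_congr rfl fun t ht => ?_
      by_cases hN : phaseOneBound d σ T μ ≤ t
      · simp only [g, hN, if_true]
        rw [integral_sub (integrable_const _) (hint t (Finset.mem_range.1 ht)), integral_const,
          probReal_univ, one_smul]
      · simp only [g, hN, if_false, integral_zero]
    have hR : 0 ≤ 112 * (σ * d * Real.log T * √(T : ℝ)) := by positivity
    -- On the bad event the regret is at most Tμ; with probability at most 3/T this contributes 3μ.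
    have hle : ∫ ω, ∑ t ∈ Finset.range T, g t ω ∂P ≤ ∫ ω, (112 * (σ * d * Real.log T * √(T : ℝ))
        + T * μ * B.indicator (fun _ => (1 : ℝ)) ω) ∂P := by
      refine integral_mono_ae (integrable_finsetSum _ hg)
        ((integrable_const _).add (hBint.const_mul _)) ?_
      filter_upwards [hmem, hpath] with ω h1 h2
      by_cases hω : ω ∈ B
      · simp only [Set.indicator_of_mem hω]
        have : ∑ t ∈ Finset.range T, g t ω ≤ ∑ t ∈ Finset.range T, μ := by
          refine Finset.sum_le_sum fun t ht => ?_
          have ha := hθ0 _ (h1.2 t (Finset.mem_range.1 ht))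
          simp only [g]
          split_ifs <;> linarith
        rw [Finset.sum_const, Finset.card_range, nsmul_eq_mul] at this
        linarith
      · simp only [Set.indicator_of_notMem hω]
        have := (h2 hω).2
        simp only [g]
        linarith
    rw [integral_add (integrable_const _) (hBint.const_mul _), integral_const_mul (T * μ),
      integral_const, probReal_univ, one_smul] at hle
    rw [e1]
    have h4 := mul_le_mul_of_nonneg_left hB (show 0 ≤ T * μ by positivity)
    have e2 : T * μ * (3 / T) = 3 * μ := by field_simp
    linarith

/-- The Nash regret of FairLinBandit for large horizons. -/
theorem nashRegret_le [IsProbabilityMeasure P] (hd : 0 < d) (hσ : 0 < σ) (hα₀ : 0 < α₀)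
    (halg : (alg = PhaseTwo.linPE ∧ IsMeasurableLinPE X D order σ T) ∨
      ∃ α, α₀ ≤ α ∧ α ≤ α₁ ∧ alg = PhaseTwo.linUCB α)
    (hT : IsLargeHorizon d σ α₀ α₁ T) (hX : X.Nonempty) (hXc : IsCompact X)
    (hX1 : ∀ x ∈ X, euclNorm x ≤ 1) (hθ : euclNorm θ ≤ 1) (hθ0 : ∀ x ∈ X, 0 ≤ x ⬝ᵥ θ)
    (hD : IsDesignOracle X D) (ho : IsEnumeration order) (hρ : IsJohnDistribution X ρ)
    (hb : IsBanditInteraction P ℱ T θ σ flag sample arm reward)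
    (hc : IsCoinSequence P ℱ T ρ flag sample)
    (hf : ∀ᵐ ω ∂P, FollowsFairLinBandit alg X D order σ T (fun i => flag i ω)
      (fun i => sample i ω) (fun i => arm i ω) (fun i => reward i ω)) :
    nashRegret P X θ T arm ≤ 4000 * (σ * d * Real.log T / √(T : ℝ)) := by
  have hlog := hT.one_le_log
  have hd' : (1 : ℝ) ≤ d := by exact_mod_cast hd
  have hT32 := hT.dim_le
  have hTpos : (0 : ℝ) < T := by linarith
  have hT0 : 0 < T := by exact_mod_cast hTpos
  have hsq : 0 < √(T : ℝ) := Real.sqrt_pos.2 hTpos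
  have hsq2 : √(T : ℝ) * √(T : ℝ) = T := Real.mul_self_sqrt hTpos.le
  set κ := σ * d * Real.log T / √(T : ℝ)
  have hκ : 0 < κ := by positivity
  have hκ1 : κ * √(T : ℝ) = σ * d * Real.log T := div_mul_cancel₀ _ hsq.ne'
  have hR : σ * d * Real.log T * √(T : ℝ) = κ * T := by rw [← hκ1, mul_assoc, hsq2]
  rw [nashRegret]
  -- For small μ nonnegativity of the geometric mean suffices; the lower bound μ > κ is what absorbs
  -- κ²/μ below.
  rcases le_or_gt (maxReward X θ) κ with hsmall | hlarge
  · have hmem := ae_arm_mem hlog hX hXc hD ho hρ.design hc hf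
    have : 0 ≤ (∏ t ∈ Finset.range T, ∫ ω, arm t ω ⬝ᵥ θ ∂P) ^ (1 / (T : ℝ)) :=
      Real.rpow_nonneg (Finset.prod_nonneg fun t ht => integral_nonneg_of_ae
        (hmem.mono fun ω h => hθ0 _ (h.2 t (Finset.mem_range.1 ht)))) _
    linarith
  · have hμ : 0 < maxReward X θ := hκ.trans hlarge
    have hμ1 : maxReward X θ ≤ 1 := by
      obtain ⟨z, hz, ez, -⟩ := exists_maxReward_eq hXc hX θ
      rw [ez]
      refine (le_abs_self _).trans ((abs_dotProduct_le z θ).trans ?_)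
      exact mul_le_one₀ (hX1 z hz) (Real.sqrt_nonneg _) hθ
    obtain ⟨h1, h2, h3, h4⟩ := mean_bounds hd hσ hα₀ halg hT hX hXc hX1 hθ hθ0 hD ho hρ hb hc hf hμ
    set μ := maxReward X θ
    have hN : 0 ≤ phaseOneBound d σ T μ := by rw [phaseOneBound]; positivity
    refine (sub_geom_mean_le hT0 hμ (by linarith) hN h1 h2 h3 h4).trans ?_
    have hlogK : Real.log (8 * ((d : ℝ) + 1)) ≤ Real.log T :=
      Real.log_le_log (by positivity) (by linarith)
    -- The leading term is 3362 κ²T/μ ≤ 3362 κT; the logarithmic part of the length costs at most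
    -- one more κT for large T.
    have hmain : μ * ((phaseOneBound d σ T μ + 1) * Real.log (8 * ((d : ℝ) + 1)))
        ≤ 3363 * (κ * T) := by
      have hκ2 : d ^ 2 * σ ^ 2 * Real.log T ^ 2 = κ ^ 2 * T := by
        linear_combination (-(κ * √(T : ℝ) + σ * d * Real.log T)) * hκ1 + κ ^ 2 * hsq2
      have hA : μ * (d ^ 2 * σ ^ 2 * Real.log T / μ ^ 2 * Real.log T) ≤ κ * T := by
        have : μ * (d ^ 2 * σ ^ 2 * Real.log T / μ ^ 2 * Real.log T) = κ ^ 2 * T / μ := by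
          rw [← hκ2]
          field_simp
        rw [this, div_le_iff₀ hμ]
        have h5 : 0 ≤ κ * T := by positivity
        nlinarith
      have hBd : μ * ((72 * Real.log T + 2) * Real.log T) ≤ κ * T := by
        have h6 := hT.log_le
        rw [← hR]
        calc μ * ((72 * Real.log T + 2) * Real.log T)
            ≤ 1 * ((74 * Real.log T) * Real.log T) := by
              refine mul_le_mul hμ1 ?_ (by positivity) zero_le_one
              exact mul_le_mul_of_nonneg_right (by linarith) (by linarith)
          _ ≤ (σ * √(T : ℝ)) * Real.log T := by
              rw [one_mul]
              exact mul_le_mul_of_nonneg_right h6 (by linarith)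
          _ ≤ d * ((σ * √(T : ℝ)) * Real.log T) := le_mul_of_one_le_left (by positivity) hd'
          _ = σ * d * Real.log T * √(T : ℝ) := by ring
      calc μ * ((phaseOneBound d σ T μ + 1) * Real.log (8 * ((d : ℝ) + 1)))
          ≤ μ * ((phaseOneBound d σ T μ + 1) * Real.log T) := by gcongr
        _ = 3362 * (μ * (d ^ 2 * σ ^ 2 * Real.log T / μ ^ 2 * Real.log T))
            + μ * ((72 * Real.log T + 2) * Real.log T) := by rw [phaseOneBound]; ring
        _ ≤ 3363 * (κ * T) := by linarith
    have hlast : 12 * μ ≤ 12 * (κ * T) := by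
      have : μ ≤ κ * T := by
        rw [← hR]
        have h6 := hT.log_le
        have h7 : 1 ≤ σ * √(T : ℝ) := by linarith
        have h8 : 1 ≤ d * Real.log T := by nlinarith
        nlinarith
      linarith
    -- The constants add up to 3363 + 4 · 112 + 12 = 3823.
    rw [div_le_iff₀ hTpos, hR]
    have : 0 ≤ κ * T := by positivity
    linarith

end NashRegret

end FairLinBandit

theorem theorem1 :
    ∃ C : ℝ, 0 < C ∧
      ∀ (d : ℕ) (σ α₀ α₁ : ℝ), 0 < d → 0 < σ → 0 < α₀ → α₀ ≤ α₁ →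
      ∃ T₀ : ℕ, ∀ T : ℕ, T₀ ≤ T →
      ∀ (X : Set (FairLinBandit.Vec d)) (θ : FairLinBandit.Vec d),
        X.Nonempty → IsCompact X →
        FairLinBandit.euclNorm θ ≤ 1 →
        (∀ x ∈ X, FairLinBandit.euclNorm x ≤ 1) →
        (∀ x ∈ X, 0 ≤ x ⬝ᵥ θ) →
      ∀ (D : Set (FairLinBandit.Vec d) → (FairLinBandit.Vec d →₀ ℝ))
        (order : Finset (FairLinBandit.Vec d) → List (FairLinBandit.Vec d))
        (ρ : FairLinBandit.Vec d →₀ ℝ),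
        FairLinBandit.IsDesignOracle X D →
        FairLinBandit.IsEnumeration order →
        FairLinBandit.IsJohnDistribution X ρ →
      ∀ (alg : FairLinBandit.PhaseTwo),
        ((alg = FairLinBandit.PhaseTwo.linPE ∧
            FairLinBandit.IsMeasurableLinPE X D order σ T) ∨
          ∃ α : ℝ, α₀ ≤ α ∧ α ≤ α₁ ∧ alg = FairLinBandit.PhaseTwo.linUCB α) →
      ∀ (Ω : Type*) [mΩ : MeasurableSpace Ω] (P : Measure Ω) [IsProbabilityMeasure P]
        (ℱ : Filtration ℕ mΩ)
        (flag : ℕ → Ω → Bool) (sample arm : ℕ → Ω → FairLinBandit.Vec d) (reward : ℕ → Ω → ℝ),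
        FairLinBandit.IsCoinSequence P ℱ T ρ flag sample →
        FairLinBandit.IsBanditInteraction P ℱ T θ σ flag sample arm reward →
        (∀ᵐ ω ∂P, FairLinBandit.FollowsFairLinBandit alg X D order σ T
          (fun i => flag i ω) (fun i => sample i ω) (fun i => arm i ω) (fun i => reward i ω)) →
        FairLinBandit.nashRegret P X θ T arm ≤ C * (σ * d * Real.log T / √(T : ℝ)) := by
  refine ⟨4000, by norm_num, fun d σ α₀ α₁ hd hσ hα₀ _ => ?_⟩
  obtain ⟨T₀, hT₀⟩ := Filter.eventually_atTop.1
    (FairLinBandit.eventually_isLargeHorizon hd hσ hα₀ α₁)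
  refine ⟨T₀, fun T hT X θ hX hXc hθ hX1 hθ0 D order ρ hD ho hρ alg halg Ω mΩ P _ ℱ flag sample arm
    reward hc hb hf => ?_⟩
  exact FairLinBandit.nashRegret_le hd hσ hα₀ halg (hT₀ T hT) hX hXc hX1 hθ hθ0 hD ho hρ hb hc hf
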